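/- Let $F$ be a (positive definite, positively homogeneous) Finsler metric on a smooth manifold $M$ of dimension $n\ge 2$, i.e. $F:TM\to\mathbb R$ is $C^\infty$ on $TM\setminus 0$, positive there, satisfies $F(x,\lambda y)=\lambda F(x,y)$ for $\lambda>0$, and $g_{ij}=\tfrac12[F^2]_{y^iy^j}$ is positive definite. In standard local coordinates $(x^i,y^i)$ on $TM$ put $G^i=\tfrac14 g^{il}\{[F^2]_{x^ky^l}y^k-[F^2]_{x^l}\}$ and let $$\tau=\ln\Big[\frac{\sqrt{\det(g_{ij})}}{\mathrm{Vol}(B^n(1))}\,\mathrm{Vol}\{(w^i)\in\mathbb R^n: F(x,w)<1\}\Big],\qquad I_i=\frac{\partial\tau}{\partial y^i},$$ $$J_i=y^m\frac{\partial I_i}{\partial x^m}-I_m\frac{\partial G^m}{\partial y^i}-2G^m\frac{\partial I_i}{\partial y^m}$$ be the distortion, the mean Cartan torsion and the mean Landsberg curvature. The S-curvature is $\mathbf S(x,y)=\frac{d}{dt}\big|_{t=0}\tau(\gamma(t),\dot\gamma(t))$, where $\gamma$ is the geodesic ($\ddot\gamma^i+2G^i(\gamma,\dot\gamma)=0$)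 with $\gamma(0)=x$, $\dot\gamma(0)=y$. The Riemann curvature is $$K^i{}_k=2\frac{\partial G^i}{\partial x^k}-y^j\frac{\partial^2G^i}{\partial x^j\partial y^k}+2G^j\frac{\partial^2G^i}{\partial y^j\partial y^k}-\frac{\partial G^i}{\partial y^j}\frac{\partial G^j}{\partial y^k},$$ and the flag curvature of $P=\mathrm{span}\{y,u\}$ with flagpole $y$ is $\mathbf K(P,y)=\frac{g_{ij}u^iK^j{}_ku^k}{g(y,y)g(u,u)-g(y,u)^2}$, $g=g_{ij}(x,y)$. Suppose that $F$ is of scalar curvature, i.e. $\mathbf K(P,y)=\mathbf K(x,y)$ does not depend on the plane $P\ni y$, and that for some $C^\infty$ function $c=c(x)$ on $M$ $$\mathbf S=(n+1)\,c(x)\,F,\qquad \mathbf J+c(x)F\,\mathbf I=0 .$$ Then there are $C^\infty$ functions $\sigma=\sigma(x)$ and $\nu=\nu(x)$ on $M$ such that for all $x\in M$ and $y\in T_xM\setminus\{0\}$ $$\mathbf K(x,y)=\frac{3\,c_{x^m}(x)y^m}{F(x,y)}+\sigma(x)=-\frac{3c(x)^2+\sigma(x)}{2}+\nu(x)\,e^{-2\tau(x,y)/(n+1)},$$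 and moreover: (a) If $F$ is not Riemannian on any nonempty open subset of $M$ (Riemannian on $U$ means: $g_{ij}(x,y)$ does not depend on $y\neq0$ for $x\in U$) and $c$ is constant, then $\mathbf K=-c^2$, $\sigma=-c^2$ and $\nu=0$. (b) At every point $x$ with $dc(x)\ne0$ (such points exist if $M$ is connected and $c$ is not constant) one has $\nu(x)\neq0$. At every point $x$ with $\nu(x)\neq 0$, for all $y\in T_xM\setminus\{0\}$, the denominator below is nonzero, the expression in braces is positive, and $$\tau(x,y)=\ln\Big\{\frac{2\nu(x)F(x,y)}{6\,c_{x^m}(x)y^m+3[\sigma(x)+c(x)^2]F(x,y)}\Big\}^{\frac{n+1}{2}} .$$ -/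

import Mathlib

open scoped Manifold ContDiff Topology
open MeasureTheory

noncomputable section

namespace Finsler

variable {n : ℕ}

/-- The coordinate space `ℝⁿ`. -/
abbrev Vec (n : ℕ) : Type := EuclideanSpace ℝ (Fin n)

/-! ### A single tangent space -/

/-- The partial derivative `∂f/∂yⁱ` of a function on `ℝⁿ`. -/
def pd (i : Fin n) (f : Vec n → ℝ) (y : Vec n) : ℝ :=
  fderiv ℝ f y (EuclideanSpace.single i 1)

/-- The fundamental tensor `g_ij(y) = ½ [f²]_{yⁱ yʲ}` of a function `f` on one tangent space. -/
def gram (f : Vec n → ℝ) (y : Vec n) : Matrix (Fin n) (Fin n) ℝ :=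
  Matrix.of fun i j => (1 / 2) * pd i (pd j (fun w => f w ^ 2)) y

/-- The distortion
`τ(y) = ln ( √det(g_ij(y)) / Vol(Bⁿ(1)) * Vol {w | f(w) < 1} )`
of a function `f` on one tangent space. -/
def fiberDistortion (f : Vec n → ℝ) (y : Vec n) : ℝ :=
  Real.log (√((gram f y).det) / (volume : Measure (Vec n)).real (Metric.ball 0 1)
    * (volume : Measure (Vec n)).real {w | f w < 1})

/-! ### Standard local coordinates `(xⁱ, yⁱ)`

Here `L (x, y)` is the expression of a Finsler metric in standard local coordinates. -/

/-- The partial derivative `∂f/∂xⁱ`. -/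
def dx (i : Fin n) (f : Vec n × Vec n → ℝ) (z : Vec n × Vec n) : ℝ :=
  pd i (fun w => f (w, z.2)) z.1

/-- The partial derivative `∂f/∂yⁱ`. -/
def dy (i : Fin n) (f : Vec n × Vec n → ℝ) (z : Vec n × Vec n) : ℝ :=
  pd i (fun w => f (z.1, w)) z.2

/-- The fundamental tensor `g_ij(x, y)`. -/
def metricMatrix (L : Vec n × Vec n → ℝ) (z : Vec n × Vec n) : Matrix (Fin n) (Fin n) ℝ :=
  gram (fun w => L (z.1, w)) z.2

/-- The spray coefficients `Gⁱ = ¼ gⁱˡ ( [F²]_{xᵏ yˡ} yᵏ - [F²]_{xˡ} )`. -/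
def spray (L : Vec n × Vec n → ℝ) (i : Fin n) (z : Vec n × Vec n) : ℝ :=
  (1 / 4) * ∑ l, (metricMatrix L z)⁻¹ i l *
    ((∑ k, dx k (dy l (fun w => L w ^ 2)) z * z.2 k) - dx l (fun w => L w ^ 2) z)

/-- The distortion `τ(x, y)`. -/
def localDistortion (L : Vec n × Vec n → ℝ) (z : Vec n × Vec n) : ℝ :=
  fiberDistortion (fun w => L (z.1, w)) z.2

/-- The mean Cartan torsion `I_i = ∂τ/∂yⁱ`. -/
def meanCartan (L : Vec n × Vec n → ℝ) (i : Fin n) (z : Vec n × Vec n) : ℝ :=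
  dy i (localDistortion L) z

/-- The mean Landsberg curvature
`J_i = yᵐ ∂I_i/∂xᵐ - I_m ∂Gᵐ/∂yⁱ - 2 Gᵐ ∂I_i/∂yᵐ`. -/
def meanLandsberg (L : Vec n × Vec n → ℝ) (i : Fin n) (z : Vec n × Vec n) : ℝ :=
  (∑ m, z.2 m * dx m (meanCartan L i) z) - (∑ m, meanCartan L m z * dy i (spray L m) z)
    - 2 * ∑ m, spray L m z * dy m (meanCartan L i) z

/-- `s` is, for times near `0`, a geodesic `s̈ⁱ + 2 Gⁱ(s, ṡ) = 0` with `(s(0), ṡ(0)) = z`. -/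
def IsGeodesicFrom (L : Vec n × Vec n → ℝ) (z : Vec n × Vec n) (s : ℝ → Vec n) : Prop :=
  s 0 = z.1 ∧ deriv s 0 = z.2 ∧
    ∀ᶠ t in 𝓝 (0 : ℝ), DifferentiableAt ℝ s t ∧
      ∀ i, HasDerivAt (fun r => deriv s r i) (-2 * spray L i (s t, deriv s t)) t

/-- A geodesic with initial data `z`; its germ at time `0` is unique. -/
def geodesic (L : Vec n × Vec n → ℝ) (z : Vec n × Vec n) : ℝ → Vec n :=
  Classical.epsilon (IsGeodesicFrom L z)

/-- The S-curvature `S(x, y) = d/dt [τ(s(t), ṡ(t))]` at `t = 0`, for the geodesic `s` with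
`s(0) = x` and `ṡ(0) = y`. -/
def sCurvature (L : Vec n × Vec n → ℝ) (z : Vec n × Vec n) : ℝ :=
  deriv (fun t => localDistortion L (geodesic L z t, deriv (geodesic L z) t)) 0

/-- The coefficients of the Riemann curvature,
`Kⁱ_k = 2 ∂Gⁱ/∂xᵏ - yʲ ∂²Gⁱ/∂xʲ∂yᵏ + 2 Gʲ ∂²Gⁱ/∂yʲ∂yᵏ - ∂Gⁱ/∂yʲ ∂Gʲ/∂yᵏ`. -/
def riemannCurvature (L : Vec n × Vec n → ℝ) (z : Vec n × Vec n) : Matrix (Fin n) (Fin n) ℝ :=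
  Matrix.of fun i k =>
    2 * dx k (spray L i) z - (∑ j, z.2 j * dx j (dy k (spray L i)) z)
      + 2 * (∑ j, spray L j z * dy j (dy k (spray L i)) z)
      - ∑ j, dy j (spray L i) z * dy k (spray L j) z

/-- The bilinear form `g_y(u, v) = g_ij(x, y) uⁱ vʲ`. -/
def metricForm (L : Vec n × Vec n → ℝ) (z : Vec n × Vec n) (u v : Fin n → ℝ) : ℝ :=
  ∑ i, ∑ j, metricMatrix L z i j * u i * v j

/-- The flag curvature `K(P, y)` of the flag `P = span {y, u}` with flagpole `y`, `z = (x, y)`. -/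
def flagCurvature (L : Vec n × Vec n → ℝ) (z : Vec n × Vec n) (u : Vec n) : ℝ :=
  metricForm L z u ((riemannCurvature L z).mulVec u) /
    (metricForm L z z.2 z.2 * metricForm L z u u - metricForm L z z.2 u ^ 2)

/-! ### Finsler manifolds -/

variable {M : Type*} [TopologicalSpace M] [ChartedSpace (Vec n) M] [IsManifold (𝓡 n) ∞ M]

/-- The restriction of `F` to the tangent space at `x`. -/
def fiber (F : TangentBundle (𝓡 n) M → ℝ) (x : M) (y : Vec n) : ℝ :=
  F ⟨x, y⟩

/-- A Finsler metric: a function on the tangent bundle that is smooth away from the zero section,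
positive there, positively homogeneous of degree one, and has positive definite `g_ij`. -/
structure IsFinslerMetric (F : TangentBundle (𝓡 n) M → ℝ) : Prop where
  smooth : ContMDiffOn (𝓡 n).tangent 𝓘(ℝ, ℝ) ∞ F {v | v.2 ≠ 0}
  pos : ∀ (x : M) (y : Vec n), y ≠ 0 → 0 < fiber F x y
  homog : ∀ (x : M) (y : Vec n) (a : ℝ), 0 < a → fiber F x (a • y) = a * fiber F x y
  posDef : ∀ (x : M) (y : Vec n), y ≠ 0 → (gram (fiber F x) y).PosDef

/-- The standard coordinates `(xⁱ, yⁱ)` on the tangent bundle induced by the chart of `M` around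
`p`, as a map from coordinates to tangent vectors `yⁱ ∂/∂xⁱ`. -/
def tangentCoord (p : M) : Vec n × Vec n → TangentBundle (𝓡 n) M :=
  (extChartAt (𝓡 n).tangent (⟨p, 0⟩ : TangentBundle (𝓡 n) M)).symm

/-- `F` in the standard coordinates induced by the chart around `p`. -/
def loc (F : TangentBundle (𝓡 n) M → ℝ) (p : M) : Vec n × Vec n → ℝ :=
  fun z => F (tangentCoord p z)

/-- The coordinates of the nonzero tangent vectors over the domain of the chart around `p`. -/
def slitDomain (n : ℕ) {M : Type*} [TopologicalSpace M] [ChartedSpace (Vec n) M] (p : M) :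
    Set (Vec n × Vec n) :=
  {z | z.1 ∈ (extChartAt (𝓡 n) p).target ∧ z.2 ≠ 0}

/-- The distortion as a function on the slit tangent bundle. -/
def distortion (F : TangentBundle (𝓡 n) M → ℝ) (v : TangentBundle (𝓡 n) M) : ℝ :=
  fiberDistortion (fiber F v.1) v.2

/-- `F` is of scalar curvature with flag curvature `K`: every flag `span {y, u} ⊆ T_x M` with
flagpole `y` has flag curvature `K(x, y)`. -/
def IsOfScalarCurvature (F K : TangentBundle (𝓡 n) M → ℝ) : Prop :=
  ∀ (p : M), ∀ z ∈ slitDomain n p, ∀ u : Vec n, LinearIndependent ℝ ![z.2, u] →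
    flagCurvature (loc F p) z u = K (tangentCoord p z)

/-- The S-curvature is isotropic: `S = (n + 1) c(x) F`. -/
def HasIsotropicSCurvature (F : TangentBundle (𝓡 n) M → ℝ) (c : M → ℝ) : Prop :=
  ∀ (p : M), ∀ z ∈ slitDomain n p,
    sCurvature (loc F p) z = (n + 1) * c (tangentCoord p z).1 * loc F p z

/-- The relative mean Landsberg curvature is isotropic: `J + c(x) F I = 0`. -/
def HasIsotropicMeanLandsberg (F : TangentBundle (𝓡 n) M → ℝ) (c : M → ℝ) : Prop :=
  ∀ (p : M), ∀ z ∈ slitDomain n p, ∀ i,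
    meanLandsberg (loc F p) i z + c (tangentCoord p z).1 * loc F p z * meanCartan (loc F p) i z = 0

/-- `F` is Riemannian on `U`: `g_ij(x, y)` depends only on `x`, for `x ∈ U`. -/
def IsRiemannianOn (F : TangentBundle (𝓡 n) M → ℝ) (U : Set M) : Prop :=
  ∀ x ∈ U, ∀ y y' : Vec n, y ≠ 0 → y' ≠ 0 → gram (fiber F x) y = gram (fiber F x) y'

/-- The differential `c_{xᵐ} yᵐ` of a function on `M` at the tangent vector `y ∈ T_x M`. -/
def dAt (c : M → ℝ) (x : M) (y : Vec n) : ℝ :=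
  mfderiv (𝓡 n) 𝓘(ℝ, ℝ) c x y

end Finsler

end

/-! Write X = yᵐ∂/∂xᵐ - 2Gᵐ∂/∂yᵐ for the geodesic spray, N^m_k = ∂Gᵐ/∂yᵏ, δ_k = ∂/∂xᵏ - N^m_k ∂/∂yᵐ
and c₀ = c_{xᵐ}yᵐ; below, lower indices on K, F, τ, S denote vertical derivatives. Two identities
carry the proof.

(1) F² K_k = 3(c_{xᵏ}F - c₀F_k), `dV_flagCurvature`. The contracted Bianchi identity `trace_dV_curv`
expresses vertical derivatives of the Riemann curvature by the Euler–Lagrange expression of N^m_m.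
Since Xτ = S differs from N^m_m by the total derivative of a function of x, this is also the
expression of S = (n+1)cF. As F solves its own Euler–Lagrange equation, only derivatives of c
survive. Scalar curvature turns the curvature side into K and its derivatives.

(2) (n+1)(c₀F_k - c_{xᵏ}F) = (c²F² - c₀F + KF²)τ_k, `dV_distortion`. The condition J + cFI = 0 says
δ_kτ = S_k + cFτ_k; this is inserted into the commutator [X, δ_k] of `sprayField_horiz` applied to
τ.

Because (c₀/F)_k = (c_{xᵏ}F - c₀F_k)/F², identity (1) makes K - 3c₀/F constant along fibres. With Q
= K + c² - c₀/F the two identities give (n+1)Q_k = -2Qτ_k, so Q·exp(2τ/(n+1)) is constant along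
fibres too. These constants are σ and 2ν/3, and eliminating c₀/F gives the second formula for K.

For (a), dc = 0 gives K = σ, and (σ + c²)exp(2τ/(n+1)) depends on x alone. Where σ ≠ -c², an open
condition, τ is constant on fibres and Deicke's theorem `gram_eq_of_det_eq` makes F Riemannian. For
(b), ν = 0 would make c₀/F independent of y, impossible for c₀ ≠ 0 since c₀ is odd and F positive.
Equating the two formulas for K and solving for τ gives the rest.

The tensor calculus takes place in an abstract commutative algebra with derivations, later
specialized to smooth functions on the slit tangent bundle of a chart. The analytic inputs are
smoothness of the unit ball volume, existence of geodesics, and Deicke's theorem, proved by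
integrating a divergence. -/

noncomputable section

namespace Finsler

/-! ### Spray calculus with commuting derivations. -/

section Algebra

/-- Algebras of smooth functions have zero divisors, so integer factors are removed by scaling with
their real inverse. -/
theorem natCast_mul_cancel {A : Type*} [CommRing A] [Algebra ℝ A] {k : ℕ} (hk : k ≠ 0) {a b : A}
    (h : (k : A) * a = k * b) : a = b := by
  have h2 := congrArg (fun u => ((k : ℝ)⁻¹) • u) h
  have key : ∀ u : A, ((k : ℝ)⁻¹) • ((k : A) * u) = u := fun u => by
    rw [← nsmul_eq_mul, ← Nat.cast_smul_eq_nsmul ℝ, smul_smul,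
      inv_mul_cancel₀ (by exact_mod_cast hk), one_smul]
  simpa only [key] using h2

theorem derivation_sum_apply {R A ι : Type*} [CommRing R] [CommRing A] [Algebra R A]
    (s : Finset ι) (D : ι → Derivation R A A) (f : A) : (∑ i ∈ s, D i) f = ∑ i ∈ s, D i f :=
  map_sum (⟨⟨fun D : Derivation R A A => D f, rfl⟩, fun _ _ => rfl⟩ : Derivation R A A →+ A) D s

theorem derivation_prod {R A ι : Type*} [CommRing R] [CommRing A] [Algebra R A] [DecidableEq ι]
    (D : Derivation R A A) (s : Finset ι) (f : ι → A) :
    D (∏ i ∈ s, f i) = ∑ i ∈ s, (∏ j ∈ s.erase i, f j) * D (f i) := by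
  induction s using Finset.induction_on with
  | empty => simp
  | insert a s ha ih =>
    rw [Finset.prod_insert ha, Derivation.leibniz, ih, Finset.sum_insert ha,
      Finset.erase_insert ha, add_comm, smul_eq_mul, smul_eq_mul, Finset.mul_sum]
    congr 1
    refine Finset.sum_congr rfl fun i hi => ?_
    have hne : a ≠ i := fun h => ha (h ▸ hi)
    rw [Finset.erase_insert_of_ne hne, Finset.prod_insert fun h => ha (Finset.mem_of_mem_erase h)]
    ring

/-- Jacobi's formula for a derivation of a commutative ring. -/
theorem derivation_det {R A ι : Type*} [CommRing R] [CommRing A] [Algebra R A] [Fintype ι]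
    [DecidableEq ι] (D : Derivation R A A) (M : Matrix ι ι A) :
    D M.det = ∑ i, ∑ j, M.adjugate i j * D (M j i) := by
  -- By Cramer's rule the inner sum is the determinant with column `i` differentiated; the Leibniz
  -- expansion of `det` is the sum of these.
  have h1 : ∀ i, ∑ j, M.adjugate i j * D (M j i) = (M.updateCol i fun j => D (M j i)).det := by
    intro i
    rw [← Matrix.cramer_apply, Matrix.cramer_eq_adjugate_mulVec]
    rfl
  simp only [h1]
  simp only [Matrix.det_apply, map_sum]
  rw [Finset.sum_comm]
  refine Finset.sum_congr rfl fun σ _ => ?_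
  rw [← Finset.smul_sum, Units.smul_def, Units.smul_def, map_zsmul]
  congr 1
  rw [derivation_prod]
  refine Finset.sum_congr rfl fun i _ => ?_
  rw [← Finset.mul_prod_erase Finset.univ _ (Finset.mem_univ i), Matrix.updateCol_self, mul_comm]
  congr 1
  refine Finset.prod_congr rfl fun j hj => ?_
  rw [Matrix.updateCol_ne (Finset.ne_of_mem_erase hj)]

/-- Commuting derivations `∂/∂xⁱ`, `∂/∂yⁱ` together with the coordinate functions `yⁱ`, on an
algebra of functions on a tangent bundle. -/
structure CoordDerivations (n : ℕ) (A : Type*) [CommRing A] [Algebra ℝ A] where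
  dX : Fin n → Derivation ℝ A A
  dV : Fin n → Derivation ℝ A A
  y : Fin n → A
  dX_comm : ∀ i j f, dX i (dX j f) = dX j (dX i f)
  dV_comm : ∀ i j f, dV i (dV j f) = dV j (dV i f)
  dV_dX : ∀ i j f, dV i (dX j f) = dX j (dV i f)
  dX_y : ∀ i j, dX i (y j) = 0
  dV_y : ∀ i j, dV i (y j) = if i = j then 1 else 0

namespace CoordDerivations

variable {n : ℕ} {A : Type*} [CommRing A] [Algebra ℝ A] (E : CoordDerivations n A) (G : Fin n → A)

/-- The spray `yᵐ ∂/∂xᵐ - 2 Gᵐ ∂/∂yᵐ`. -/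
def sprayField : Derivation ℝ A A :=
  ∑ m, (E.y m • E.dX m - (2 * G m) • E.dV m)

/-- The connection coefficients `Nᵐ_k = ∂Gᵐ/∂yᵏ`. -/
def conn (m k : Fin n) : A := E.dV k (G m)

/-- The horizontal derivative `δ_k = ∂/∂xᵏ - Nᵐ_k ∂/∂yᵐ`. -/
def horiz (k : Fin n) : Derivation ℝ A A :=
  E.dX k - ∑ m, E.conn G m k • E.dV m

/-- The Riemann curvature of a spray. -/
def curv (i k : Fin n) : A :=
  2 * E.dX k (G i) - E.sprayField G (E.conn G i k) - ∑ j, E.conn G i j * E.conn G j k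

theorem sprayField_apply (f : A) :
    E.sprayField G f = ∑ m, (E.y m * E.dX m f - 2 * G m * E.dV m f) := by
  simp only [sprayField, derivation_sum_apply]
  rfl

theorem horiz_apply (k : Fin n) (f : A) :
    E.horiz G k f = E.dX k f - ∑ m, E.conn G m k * E.dV m f := by
  simp only [horiz, Derivation.sub_apply, derivation_sum_apply]
  rfl

/-- The extra terms come from differentiating the coefficients `yᵐ` and `2Gᵐ` of the spray. They are
`δ_k` except that the connection term is doubled. -/
theorem dV_sprayField (k : Fin n) (f : A) :
    E.dV k (E.sprayField G f) = E.sprayField G (E.dV k f) + E.dX k f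
      - 2 * ∑ m, E.conn G m k * E.dV m f := by
  -- A Kronecker sum lets the identity be checked term by term under one sum over `m`.
  have h0 : E.dX k f = ∑ m, (if k = m then 1 else 0) * E.dX m f := by simp
  rw [h0]
  simp only [sprayField_apply, map_sum, Finset.mul_sum, ← Finset.sum_add_distrib,
    ← Finset.sum_sub_distrib]
  refine Finset.sum_congr rfl fun m _ => ?_
  have h2 : E.dV k (2 : A) = 0 := by
    exact_mod_cast (E.dV k).map_natCast 2
  simp only [map_sub, Derivation.leibniz, smul_eq_mul, E.dV_y, E.dV_dX, E.dV_comm k m, h2, conn]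
  ring

theorem sprayField_y (k : Fin n) : E.sprayField G (E.y k) = -2 * G k := by
  simp [sprayField_apply, E.dX_y, E.dV_y]

theorem sprayField_dX (k : Fin n) (f : A) :
    E.sprayField G (E.dX k f) = E.dX k (E.sprayField G f) + 2 * ∑ m, E.dX k (G m) * E.dV m f := by
  simp only [sprayField_apply, map_sum, Finset.mul_sum, ← Finset.sum_add_distrib]
  refine Finset.sum_congr rfl fun m _ => ?_
  have h2 : E.dX k (2 : A) = 0 := by
    exact_mod_cast (E.dX k).map_natCast 2
  simp only [map_sub, Derivation.leibniz, smul_eq_mul, E.dX_y, E.dV_dX, E.dX_comm k m, h2]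
  ring

/-- The commutator of the spray with a horizontal derivative. -/
theorem sprayField_horiz (k : Fin n) (f : A) :
    E.sprayField G (E.horiz G k f) = E.horiz G k (E.sprayField G f)
      + ∑ m, E.conn G m k * E.horiz G m f + ∑ m, E.curv G m k * E.dV m f := by
  have h1 : ∑ m, E.conn G m k * E.horiz G m f = ∑ m, E.conn G m k * E.dX m f
      - ∑ m, ∑ j, E.conn G m j * E.conn G j k * E.dV m f := by
    rw [Finset.sum_comm]
    simp only [horiz_apply, mul_sub, Finset.sum_sub_distrib, Finset.mul_sum]
    congr 1
    exact Finset.sum_congr rfl fun m _ => Finset.sum_congr rfl fun j _ => by ring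
  have h2 : ∑ m, E.curv G m k * E.dV m f = 2 * ∑ m, E.dX k (G m) * E.dV m f
      - ∑ m, E.sprayField G (E.conn G m k) * E.dV m f
      - ∑ m, ∑ j, E.conn G m j * E.conn G j k * E.dV m f := by
    simp only [curv, sub_mul, Finset.sum_sub_distrib, Finset.mul_sum, Finset.sum_mul, mul_assoc]
  have h3 : E.sprayField G (E.horiz G k f) = E.sprayField G (E.dX k f)
      - ∑ m, E.sprayField G (E.conn G m k) * E.dV m f
      - ∑ m, E.conn G m k * E.sprayField G (E.dV m f) := by
    rw [horiz_apply, map_sub, map_sum, sub_sub, ← Finset.sum_add_distrib]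
    congr 1
    refine Finset.sum_congr rfl fun m _ => ?_
    simp only [Derivation.leibniz, smul_eq_mul]
    ring
  have h4 : E.horiz G k (E.sprayField G f) = E.dX k (E.sprayField G f)
      - ∑ m, E.conn G m k * E.sprayField G (E.dV m f) - ∑ m, E.conn G m k * E.dX m f
      + 2 * ∑ m, ∑ j, E.conn G m j * E.conn G j k * E.dV m f := by
    rw [horiz_apply, Finset.sum_comm]
    simp only [dV_sprayField, mul_sub, mul_add, Finset.sum_sub_distrib, Finset.sum_add_distrib,
      Finset.mul_sum]
    have : ∑ m, ∑ j, E.conn G m k * (2 * (E.conn G j m * E.dV j f))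
        = ∑ m, ∑ j, 2 * (E.conn G j m * E.conn G m k * E.dV j f) :=
      Finset.sum_congr rfl fun m _ => Finset.sum_congr rfl fun j _ => by ring
    rw [this]
    ring
  -- The double sums N^m_j N^j_k ∂f/∂yᵐ enter with coefficients 2, -1, -1 and cancel.
  rw [h1, h2, h3, h4, sprayField_dX]
  ring

theorem dV_conn_comm (p k m : Fin n) : E.dV p (E.conn G m k) = E.dV k (E.conn G m p) :=
  E.dV_comm _ _ _

theorem dV_curv (p m k : Fin n) :
    E.dV p (E.curv G m k) = 2 * E.dX k (E.conn G m p) - E.dX p (E.conn G m k)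
      - E.sprayField G (E.dV p (E.conn G m k)) + 2 * ∑ l, E.conn G l p * E.dV l (E.conn G m k)
      - ∑ l, E.conn G l k * E.dV p (E.conn G m l) - ∑ l, E.conn G m l * E.dV p (E.conn G l k) := by
  have h2 : E.dV p (2 : A) = 0 := by
    exact_mod_cast (E.dV p).map_natCast 2
  have h3 : E.dV p (∑ j, E.conn G m j * E.conn G j k)
      = ∑ l, E.conn G m l * E.dV p (E.conn G l k) + ∑ l, E.conn G l k * E.dV p (E.conn G m l) := by
    simp only [map_sum, Derivation.leibniz, smul_eq_mul, Finset.sum_add_distrib]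
  rw [curv, map_sub, map_sub, h3, dV_sprayField]
  simp only [Derivation.leibniz, smul_eq_mul, h2, E.dV_dX, conn]
  ring

/-- Terms symmetric in `p` and `k`, by equality of second vertical derivatives of `G`, drop out, and
the `x`-derivatives combine with weight 2 + 1. The bracket on the right gives the components of the
vertical field [δ_p, δ_k]. -/
theorem dV_curv_antisymm (p m k : Fin n) :
    E.dV p (E.curv G m k) - E.dV k (E.curv G m p)
      = 3 * (E.horiz G k (E.conn G m p) - E.horiz G p (E.conn G m k)) := by
  rw [dV_curv, dV_curv, horiz_apply, horiz_apply, E.dV_conn_comm G k p m]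
  have h1 : ∀ p k, ∑ l, E.conn G l k * E.dV p (E.conn G m l)
      = ∑ l, E.conn G l k * E.dV l (E.conn G m p) := fun p k =>
    Finset.sum_congr rfl fun l _ => by rw [E.dV_conn_comm G p l m]
  have h2 : ∑ l, E.conn G m l * E.dV k (E.conn G l p)
      = ∑ l, E.conn G m l * E.dV p (E.conn G l k) :=
    Finset.sum_congr rfl fun l _ => by rw [E.dV_conn_comm G k p l]
  rw [h1, h1, h2]
  ring

/-- The contracted second Bianchi identity. -/
theorem trace_dV_curv (k : Fin n) :
    2 * ∑ m, E.dV m (E.curv G m k) + E.dV k (∑ m, E.curv G m m)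
      = 3 * (E.dX k (∑ m, E.conn G m m) - E.sprayField G (E.dV k (∑ m, E.conn G m m))) := by
  -- Relabelling leaves two kinds of quadratic sums, whose coefficients 4 - 2 - 1 - 1 and -2 + 2
  -- vanish; the terms ∂N^m_k/∂xᵐ cancel as well.
  have e1 : ∑ m, ∑ l, E.conn G l m * E.dV l (E.conn G m k)
      = ∑ m, ∑ l, E.conn G m l * E.dV m (E.conn G l k) := Finset.sum_comm
  have e2 : ∑ m, ∑ l, E.conn G l k * E.dV m (E.conn G m l)
      = ∑ m, ∑ l, E.conn G l k * E.dV l (E.conn G m m) :=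
    Finset.sum_congr rfl fun m _ => Finset.sum_congr rfl fun l _ => by rw [E.dV_conn_comm]
  have e3 : ∑ m, ∑ l, E.conn G l m * E.dV k (E.conn G m l)
      = ∑ m, ∑ l, E.conn G m l * E.dV m (E.conn G l k) := by
    rw [Finset.sum_comm]
    exact Finset.sum_congr rfl fun m _ => Finset.sum_congr rfl fun l _ => by rw [E.dV_conn_comm]
  have e4 : ∑ m, ∑ l, E.conn G m l * E.dV k (E.conn G l m)
      = ∑ m, ∑ l, E.conn G m l * E.dV m (E.conn G l k) :=
    Finset.sum_congr rfl fun m _ => Finset.sum_congr rfl fun l _ => by rw [E.dV_conn_comm]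
  have e5 : ∀ m, E.dV m (E.conn G m k) = E.dV k (E.conn G m m) := fun m => E.dV_conn_comm G _ _ _
  simp only [map_sum, dV_curv, Finset.sum_add_distrib, Finset.sum_sub_distrib, ← Finset.mul_sum,
    e1, e2, e3, e4, e5]
  ring

end CoordDerivations

end Algebra

/-! ### Identities for a Finsler function, its spray and its distortion. -/

section FinslerAlgebra

/-- The algebraic relations between a Finsler function `F`, its inverse and its spray `G`. -/
structure FinslerRelations {n : ℕ} {A : Type*} [CommRing A] [Algebra ℝ A]
    (E : CoordDerivations n A) (F Fi : A) (G : Fin n → A) : Prop where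
  mul_inv : F * Fi = 1
  euler : ∑ k, E.y k * E.dV k F = F
  spray_eq : ∀ l, 2 * ∑ m, E.dV l (E.dV m (F * F)) * G m
    = ∑ k, E.y k * E.dX k (E.dV l (F * F)) - E.dX l (F * F)
  isUnit_det : IsUnit (Matrix.of fun i j => E.dV i (E.dV j (F * F))).det

namespace FinslerRelations

variable {n : ℕ} {A : Type*} [CommRing A] [Algebra ℝ A] {E : CoordDerivations n A} {F Fi : A}
  {G : Fin n → A}

theorem two_cancel {a b : A} (h : 2 * a = 2 * b) : a = b :=
  natCast_mul_cancel (k := 2) two_ne_zero (by exact_mod_cast h)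

/-- The spray equation, rearranged: the Euler–Lagrange equation of the energy `F²`. -/
theorem sprayField_dV_sq (h : FinslerRelations E F Fi G) (k : Fin n) :
    E.sprayField G (E.dV k (F * F)) = E.dX k (F * F) := by
  have h1 := h.spray_eq k
  have h2 : ∑ m, 2 * G m * E.dV m (E.dV k (F * F)) = 2 * ∑ m, E.dV k (E.dV m (F * F)) * G m := by
    rw [Finset.mul_sum]
    exact Finset.sum_congr rfl fun m _ => by rw [E.dV_comm k m]; ring
  rw [E.sprayField_apply, Finset.sum_sub_distrib, h2, h1]
  ring

theorem euler_sq (h : FinslerRelations E F Fi G) :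
    ∑ k, E.y k * E.dV k (F * F) = 2 * (F * F) := by
  have : ∑ k, E.y k * E.dV k (F * F) = 2 * F * ∑ k, E.y k * E.dV k F := by
    rw [Finset.mul_sum]
    refine Finset.sum_congr rfl fun k _ => ?_
    simp only [Derivation.leibniz, smul_eq_mul]
    ring
  rw [this, h.euler]
  ring

/-- Conservation of energy. Applying the spray to Euler's identity for `F²` gives X(F²) on one side,
by the Euler–Lagrange equation, and 2X(F²) on the other. -/
theorem sprayField_sq (h : FinslerRelations E F Fi G) : E.sprayField G (F * F) = 0 := by
  have h1 := congrArg (E.sprayField G) h.euler_sq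
  have h2 : E.sprayField G (2 : A) = 0 := by
    exact_mod_cast (E.sprayField G).map_natCast 2
  have h3 : E.sprayField G (∑ k, E.y k * E.dV k (F * F)) = E.sprayField G (F * F) := by
    rw [map_sum, E.sprayField_apply]
    refine Finset.sum_congr rfl fun k _ => ?_
    rw [Derivation.leibniz, h.sprayField_dV_sq, E.sprayField_y]
    simp only [smul_eq_mul]
    ring
  rw [h3, (E.sprayField G).leibniz 2, h2] at h1
  simp only [smul_eq_mul] at h1
  linear_combination -h1

/-- The vertical derivative of X(F²) = 0, rewritten by the commutator and the Euler–Lagrange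
equation, is twice this identity. -/
theorem horiz_sq (h : FinslerRelations E F Fi G) (k : Fin n) : E.horiz G k (F * F) = 0 := by
  have h1 := E.dV_sprayField G k (F * F)
  rw [h.sprayField_sq, h.sprayField_dV_sq, map_zero] at h1
  rw [E.horiz_apply]
  refine two_cancel ?_
  linear_combination -h1

theorem dX_sq (h : FinslerRelations E F Fi G) (k : Fin n) :
    E.dX k (F * F) = ∑ m, E.conn G m k * E.dV m (F * F) := by
  have := h.horiz_sq k
  rw [E.horiz_apply] at this
  linear_combination this

/-- `F` is a non-zero-divisor, so a derivation killing `F²` kills `F`. -/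
theorem apply_eq_zero_of_sq (h : FinslerRelations E F Fi G) (D : Derivation ℝ A A)
    (hD : D (F * F) = 0) : D F = 0 := by
  rw [Derivation.leibniz, smul_eq_mul] at hD
  refine two_cancel ?_
  linear_combination Fi * hD - 2 * D F * h.mul_inv

theorem sprayField_self (h : FinslerRelations E F Fi G) : E.sprayField G F = 0 :=
  h.apply_eq_zero_of_sq _ h.sprayField_sq

theorem horiz_self (h : FinslerRelations E F Fi G) (k : Fin n) : E.horiz G k F = 0 :=
  h.apply_eq_zero_of_sq _ (h.horiz_sq k)

theorem sprayField_dV_self (h : FinslerRelations E F Fi G) (k : Fin n) :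
    E.sprayField G (E.dV k F) = E.dX k F := by
  have h1 := E.dV_sprayField G k F
  have h2 := h.horiz_self k
  rw [h.sprayField_self, map_zero] at h1
  rw [E.horiz_apply] at h2
  linear_combination -h1 - 2 * h2

theorem curv_dV_sq (h : FinslerRelations E F Fi G) (k : Fin n) :
    ∑ m, E.curv G m k * E.dV m (F * F) = 0 := by
  have := E.sprayField_horiz G k (F * F)
  simp only [h.horiz_sq, h.sprayField_sq, map_zero, mul_zero, Finset.sum_const_zero] at this
  linear_combination -this

/-- `F²` is horizontally constant, so the vertical field [δ_j, δ_k] annihilates it. In coordinates,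
δ_k is applied to ∂F²/∂xʲ = N^m_j ∂F²/∂yᵐ and the result antisymmetrized. -/
theorem horiz_conn_antisymm (h : FinslerRelations E F Fi G) (j k : Fin n) :
    ∑ m, (E.horiz G k (E.conn G m j) - E.horiz G j (E.conn G m k)) * E.dV m (F * F) = 0 := by
  have key : ∀ j k, ∑ m, E.horiz G k (E.conn G m j) * E.dV m (F * F)
      = E.dX k (E.dX j (F * F)) - ∑ m, E.conn G m k * E.dX j (E.dV m (F * F))
        - ∑ m, E.conn G m j * E.dX k (E.dV m (F * F))
        + ∑ m, ∑ l, E.conn G m j * E.conn G l k * E.dV m (E.dV l (F * F)) := by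
    intro j k
    have h1 : E.horiz G k (E.dX j (F * F)) = ∑ m, E.conn G m j * E.horiz G k (E.dV m (F * F))
        + ∑ m, E.horiz G k (E.conn G m j) * E.dV m (F * F) := by
      rw [h.dX_sq j, map_sum, ← Finset.sum_add_distrib]
      refine Finset.sum_congr rfl fun m _ => ?_
      rw [(E.horiz G k).leibniz (E.conn G m j), smul_eq_mul, smul_eq_mul]
      ring
    have h2 : ∑ m, E.conn G m j * E.horiz G k (E.dV m (F * F))
        = ∑ m, E.conn G m j * E.dX k (E.dV m (F * F))
        - ∑ m, ∑ l, E.conn G m j * E.conn G l k * E.dV m (E.dV l (F * F)) := by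
      simp only [E.horiz_apply, mul_sub, Finset.sum_sub_distrib, Finset.mul_sum]
      congr 1
      refine Finset.sum_congr rfl fun m _ => Finset.sum_congr rfl fun l _ => ?_
      rw [E.dV_comm l m]
      ring
    have h3 : E.horiz G k (E.dX j (F * F)) = E.dX k (E.dX j (F * F))
        - ∑ m, E.conn G m k * E.dX j (E.dV m (F * F)) := by
      simp only [E.horiz_apply, E.dV_dX]
    linear_combination -h1 + h3 - h2
  have h5 : ∑ m, ∑ l, E.conn G m j * E.conn G l k * E.dV m (E.dV l (F * F))
      = ∑ m, ∑ l, E.conn G m k * E.conn G l j * E.dV m (E.dV l (F * F)) := by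
    rw [Finset.sum_comm]
    refine Finset.sum_congr rfl fun m _ => Finset.sum_congr rfl fun l _ => ?_
    rw [E.dV_comm l m]
    ring
  simp only [sub_mul, Finset.sum_sub_distrib, key]
  rw [h5, E.dX_comm k j]
  ring

/-- The Riemann curvature is self-adjoint for the fundamental tensor. -/
theorem hess_curv_symm (h : FinslerRelations E F Fi G) (j k : Fin n) :
    ∑ m, E.dV j (E.dV m (F * F)) * E.curv G m k = ∑ m, E.dV k (E.dV m (F * F)) * E.curv G m j := by
  -- A vertical derivative of `curv_dV_sq` trades the Hessian for derivatives of the curvature,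
  -- whose antisymmetric part is a bracket of horizontal fields.
  have key : ∀ j k, ∑ m, E.dV j (E.dV m (F * F)) * E.curv G m k
      = - ∑ m, E.dV j (E.curv G m k) * E.dV m (F * F) := by
    intro j k
    have h1 := congrArg (E.dV j) (h.curv_dV_sq k)
    rw [map_sum, map_zero] at h1
    rw [eq_neg_iff_add_eq_zero, ← h1, ← Finset.sum_add_distrib]
    refine Finset.sum_congr rfl fun m _ => ?_
    rw [(E.dV j).leibniz (E.curv G m k)]
    simp only [smul_eq_mul]
    ring
  have h2 := h.horiz_conn_antisymm j k
  have h3 : ∑ m, (E.dV j (E.curv G m k) - E.dV k (E.curv G m j)) * E.dV m (F * F)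
      = 3 * ∑ m, (E.horiz G k (E.conn G m j) - E.horiz G j (E.conn G m k)) * E.dV m (F * F) := by
    rw [Finset.mul_sum]
    exact Finset.sum_congr rfl fun m _ => by rw [E.dV_curv_antisymm G j m k]; ring
  rw [h2] at h3
  simp only [sub_mul, Finset.sum_sub_distrib] at h3
  rw [key, key]
  linear_combination -h3

/-- Compatibility of the nonlinear connection with the fundamental tensor. Commuting the spray past
one vertical derivative leaves mixed `x`-derivatives, which cancel on adding the version with `j`
and `l` exchanged. -/
theorem sprayField_hess (h : FinslerRelations E F Fi G) (j l : Fin n) :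
    E.sprayField G (E.dV j (E.dV l (F * F))) = ∑ m, E.conn G m j * E.dV m (E.dV l (F * F))
      + ∑ m, E.conn G m l * E.dV m (E.dV j (F * F)) := by
  have key : ∀ j l, E.sprayField G (E.dV j (E.dV l (F * F))) + E.dX j (E.dV l (F * F))
      - 2 * ∑ m, E.conn G m j * E.dV m (E.dV l (F * F)) = E.dX l (E.dV j (F * F)) := by
    intro j l
    rw [← E.dV_sprayField, h.sprayField_dV_sq, E.dV_dX]
  have h1 := key j l
  have h2 := key l j
  rw [E.dV_comm l j] at h2
  refine two_cancel ?_
  linear_combination h1 + h2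

/-- The Hessian of `F²`, twice the fundamental tensor. -/
def hess (E : CoordDerivations n A) (F : A) : Matrix (Fin n) (Fin n) A :=
  Matrix.of fun i j => E.dV i (E.dV j (F * F))

/-- In Jacobi's formula the adjugate turns each of the two connection terms of `sprayField_hess`
into trace times determinant. -/
theorem sprayField_det (h : FinslerRelations E F Fi G) :
    E.sprayField G (hess E F).det = 2 * (∑ m, E.conn G m m) * (hess E F).det := by
  have hcomm : ∀ i j, hess E F i j = hess E F j i := fun i j => E.dV_comm i j _
  have e1 : ∀ m j, ∑ i, (hess E F).adjugate i j * hess E F m i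
      = if m = j then (hess E F).det else 0 := by
    intro m j
    have := congrFun (congrFun (hess E F).mul_adjugate m) j
    rw [Matrix.mul_apply] at this
    simp only [Matrix.smul_apply, Matrix.one_apply, smul_eq_mul, mul_ite, mul_one, mul_zero] at this
    rw [← this]
    exact Finset.sum_congr rfl fun i _ => mul_comm _ _
  have e2 : ∀ i m, ∑ j, (hess E F).adjugate i j * hess E F j m
      = if i = m then (hess E F).det else 0 := by
    intro i m
    have := congrFun (congrFun (hess E F).adjugate_mul i) m
    rw [Matrix.mul_apply] at this
    simpa only [Matrix.smul_apply, Matrix.one_apply, smul_eq_mul, mul_ite, mul_one, mul_zero]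
      using this
  rw [derivation_det]
  have e3 : ∀ i j, E.sprayField G (hess E F j i) = ∑ m, E.conn G m j * hess E F m i
      + ∑ m, E.conn G m i * hess E F m j := fun i j => h.sprayField_hess j i
  simp only [e3, mul_add, Finset.sum_add_distrib, Finset.mul_sum]
  have t1 : ∑ i, ∑ j, ∑ m, (hess E F).adjugate i j * (E.conn G m j * hess E F m i)
      = ∑ m, E.conn G m m * (hess E F).det := by
    calc _ = ∑ j, ∑ m, E.conn G m j * ∑ i, (hess E F).adjugate i j * hess E F m i := by
          rw [Finset.sum_comm]
          refine Finset.sum_congr rfl fun j _ => ?_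
          rw [Finset.sum_comm]
          refine Finset.sum_congr rfl fun m _ => ?_
          rw [Finset.mul_sum]
          exact Finset.sum_congr rfl fun i _ => by ring
      _ = _ := by simp [e1]
  have t2 : ∑ i, ∑ j, ∑ m, (hess E F).adjugate i j * (E.conn G m i * hess E F m j)
      = ∑ m, E.conn G m m * (hess E F).det := by
    calc _ = ∑ i, ∑ m, E.conn G m i * ∑ j, (hess E F).adjugate i j * hess E F j m := by
          refine Finset.sum_congr rfl fun i _ => ?_
          rw [Finset.sum_comm]
          refine Finset.sum_congr rfl fun m _ => ?_
          rw [Finset.mul_sum]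
          exact Finset.sum_congr rfl fun j _ => by rw [hcomm m j]; ring
      _ = _ := by simp [e2]
  rw [t1, t2, ← Finset.sum_mul, ← Finset.mul_sum]
  ring

theorem euler_dV_sq (h : FinslerRelations E F Fi G) (i : Fin n) :
    ∑ m, E.y m * E.dV m (E.dV i (F * F)) = E.dV i (F * F) := by
  have h1 := congrArg (E.dV i) h.euler_sq
  have h2 : E.dV i (2 : A) = 0 := by
    exact_mod_cast (E.dV i).map_natCast 2
  have h3 : E.dV i (∑ k, E.y k * E.dV k (F * F))
      = ∑ m, E.y m * E.dV m (E.dV i (F * F)) + E.dV i (F * F) := by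
    have : E.dV i (F * F) = ∑ m, (if i = m then 1 else 0) * E.dV m (F * F) := by simp
    rw [this, map_sum, ← Finset.sum_add_distrib, ← this]
    refine Finset.sum_congr rfl fun m _ => ?_
    rw [(E.dV i).leibniz (E.y m), E.dV_y, E.dV_comm i m]
    simp only [smul_eq_mul]
    ring
  rw [h3, (E.dV i).leibniz 2, h2] at h1
  simp only [smul_eq_mul, mul_zero, add_zero] at h1
  linear_combination h1

theorem euler_hess (h : FinslerRelations E F Fi G) (i j : Fin n) :
    ∑ m, E.y m * E.dV m (hess E F i j) = 0 := by
  have h1 := congrArg (E.dV i) (h.euler_dV_sq j)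
  have h3 : E.dV i (∑ m, E.y m * E.dV m (E.dV j (F * F)))
      = ∑ m, E.y m * E.dV m (hess E F i j) + E.dV i (E.dV j (F * F)) := by
    have : E.dV i (E.dV j (F * F)) = ∑ m, (if i = m then 1 else 0) * E.dV m (E.dV j (F * F)) := by
      simp
    rw [this, map_sum, ← Finset.sum_add_distrib]
    refine Finset.sum_congr rfl fun m _ => ?_
    rw [(E.dV i).leibniz (E.y m), E.dV_y, E.dV_comm i m]
    simp only [smul_eq_mul, hess, Matrix.of_apply]
    ring
  rw [h3] at h1
  linear_combination h1

theorem euler_det (h : FinslerRelations E F Fi G) : ∑ m, E.y m * E.dV m (hess E F).det = 0 := by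
  have : ∀ m, E.y m * E.dV m (hess E F).det
      = ∑ i, ∑ j, (hess E F).adjugate i j * (E.y m * E.dV m (hess E F j i)) := by
    intro m
    rw [derivation_det, Finset.mul_sum]
    refine Finset.sum_congr rfl fun i _ => ?_
    rw [Finset.mul_sum]
    exact Finset.sum_congr rfl fun j _ => by ring
  simp only [this]
  rw [Finset.sum_comm]
  refine Finset.sum_eq_zero fun i _ => ?_
  rw [Finset.sum_comm]
  refine Finset.sum_eq_zero fun j _ => ?_
  rw [← Finset.mul_sum, h.euler_hess, mul_zero]

/-- The distortion `τ` is `½ log det g` up to a function `v` of the base point. -/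
structure IsDistortion (E : CoordDerivations n A) (F τ v : A) : Prop where
  dX : ∀ k, 2 * (hess E F).det * E.dX k τ
    = E.dX k (hess E F).det + 2 * (hess E F).det * E.dX k v
  dV : ∀ k, 2 * (hess E F).det * E.dV k τ = E.dV k (hess E F).det
  dV_base : ∀ k, E.dV k v = 0

theorem det_cancel (h : FinslerRelations E F Fi G) {a b : A}
    (hab : (hess E F).det * a = (hess E F).det * b) : a = b :=
  h.isUnit_det.mul_left_cancel hab

theorem euler_distortion (h : FinslerRelations E F Fi G) {τ v : A} (hτ : IsDistortion E F τ v) :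
    ∑ m, E.y m * E.dV m τ = 0 := by
  refine h.det_cancel (two_cancel ?_)
  rw [mul_zero, mul_zero, ← h.euler_det, Finset.mul_sum, Finset.mul_sum]
  exact Finset.sum_congr rfl fun m _ => by linear_combination E.y m * hτ.dV m

/-- With τ = ½ log det + v, the first part contributes half of X(log det) = 2N^m_m. Working with
`det` times derivatives of τ avoids logarithms in the algebra. -/
theorem sprayField_distortion (h : FinslerRelations E F Fi G) {τ v : A}
    (hτ : IsDistortion E F τ v) :
    E.sprayField G τ = ∑ m, E.conn G m m + ∑ m, E.y m * E.dX m v := by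
  refine h.det_cancel (two_cancel ?_)
  have h1 := h.sprayField_det
  rw [E.sprayField_apply] at h1 ⊢
  have h2 : 2 * ((hess E F).det * ∑ m, (E.y m * E.dX m τ - 2 * G m * E.dV m τ))
      = ∑ m, (E.y m * E.dX m (hess E F).det - 2 * G m * E.dV m (hess E F).det)
        + 2 * (hess E F).det * ∑ m, E.y m * E.dX m v := by
    simp only [Finset.mul_sum, ← Finset.sum_add_distrib]
    refine Finset.sum_congr rfl fun m _ => ?_
    linear_combination E.y m * hτ.dX m - 2 * G m * hτ.dV m
  rw [h2, h1]
  ring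

/-- The Euler–Lagrange expression of the S-curvature, in terms of the connection. -/
theorem eulerLagrange_S (h : FinslerRelations E F Fi G) {τ v : A} (hτ : IsDistortion E F τ v)
    (k : Fin n) :
    E.sprayField G (E.dV k (E.sprayField G τ)) - E.dX k (E.sprayField G τ)
      = E.sprayField G (E.dV k (∑ m, E.conn G m m)) - E.dX k (∑ m, E.conn G m m) := by
  have h0 : ∀ m k, E.dV k (E.dX m v) = 0 := fun m k => by
    rw [E.dV_dX, hτ.dV_base, map_zero]
  -- The term yᵐ∂v/∂xᵐ is a total derivative, so its Euler–Lagrange expression vanishes.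
  have h1 : E.dV k (∑ m, E.y m * E.dX m v) = E.dX k v := by
    simp [map_sum, Derivation.leibniz, h0, E.dV_y]
  have h2 : E.sprayField G (E.dX k v) = E.dX k (∑ m, E.y m * E.dX m v) := by
    rw [E.sprayField_apply, map_sum]
    refine Finset.sum_congr rfl fun m _ => ?_
    rw [h0, Derivation.leibniz, E.dX_y, E.dX_comm k m]
    simp
  rw [h.sprayField_distortion hτ, map_add, map_add, map_add, h1, h2]
  ring

variable {τ v c κ : A}

/-- `F` is constant along the spray and satisfies its own Euler–Lagrange equation, so only
derivatives falling on `c` remain. -/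
theorem eulerLagrange_isotropic (h : FinslerRelations E F Fi G)
    (hc : ∀ k, E.dV k c = 0) (hS : E.sprayField G τ = (n + 1) * c * F) (k : Fin n) :
    E.sprayField G (E.dV k (E.sprayField G τ)) - E.dX k (E.sprayField G τ)
      = (n + 1) * ((∑ m, E.y m * E.dX m c) * E.dV k F - E.dX k c * F) := by
  have hn : ∀ D : Derivation ℝ A A, D ((n : A) + 1) = 0 := fun D => by
    exact_mod_cast D.map_natCast (n + 1)
  have h1 : E.sprayField G c = ∑ m, E.y m * E.dX m c := by
    simp [E.sprayField_apply, hc]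
  rw [hS, ← h1]
  simp only [Derivation.leibniz, hn, hc, smul_eq_mul, mul_zero, add_zero,
    h.sprayField_dV_self]
  ring

/-- The flag curvature of a metric of scalar curvature and isotropic S-curvature. -/
theorem dV_flagCurvature (h : FinslerRelations E F Fi G) (hn : 2 ≤ n)
    (hτ : IsDistortion E F τ v)
    (hκ : ∀ i k, E.curv G i k = κ * (F * F * (if i = k then 1 else 0) - E.y i * (F * E.dV k F)))
    (hc : ∀ k, E.dV k c = 0) (hS : E.sprayField G τ = (n + 1) * c * F) (k : Fin n) :
    F * F * E.dV k κ = 3 * (E.dX k c * F - (∑ m, E.y m * E.dX m c) * E.dV k F) := by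
  set c₀ := ∑ m, E.y m * E.dX m c with hc₀
  set r := ∑ m, E.y m * E.dV m κ with hr
  have tr : ∑ m, E.curv G m m = ((n : A) - 1) * κ * (F * F) := by
    have : ∑ m, E.curv G m m = (n : A) * κ * (F * F) - κ * F * ∑ m, E.y m * E.dV m F := by
      rw [Finset.mul_sum]
      simp only [hκ, if_true, mul_one, mul_sub, Finset.sum_sub_distrib, Finset.sum_const,
        Finset.card_univ, Fintype.card_fin, nsmul_eq_mul]
      congr 1
      · ring
      · exact Finset.sum_congr rfl fun m _ => by ring
    rw [this, h.euler]
    ring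
  have sq : ∀ k, E.dV k (F * F) = 2 * (F * E.dV k F) := fun k => by
    rw [Derivation.leibniz, smul_eq_mul]; ring
  have e1 : ∀ k, ∑ m, E.y m * E.dV m (F * E.dV k F) = F * E.dV k F := by
    intro k
    refine two_cancel ?_
    have := h.euler_dV_sq k
    have h2 : ∀ m, E.dV m (2 : A) = 0 := fun m => by
      exact_mod_cast (E.dV m).map_natCast 2
    simp only [sq] at this
    rw [← this, Finset.mul_sum]
    refine Finset.sum_congr rfl fun m _ => ?_
    rw [(E.dV m).leibniz 2, h2]
    simp only [smul_eq_mul]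
    ring
  have div : ∀ k, ∑ m, E.dV m (E.curv G m k) = E.dV k κ * (F * F) - r * (F * E.dV k F)
      + (1 - n) * κ * (F * E.dV k F) := by
    intro k
    have d1 : ∀ m, E.dV m (E.curv G m k)
        = (if m = k then 1 else 0) * (E.dV m κ * (F * F) + κ * E.dV m (F * F))
          - (E.y m * E.dV m κ) * (F * E.dV k F) - κ * (F * E.dV k F)
          - κ * (E.y m * E.dV m (F * E.dV k F)) := by
      intro m
      have hif : E.dV m (if m = k then (1 : A) else 0) = 0 := by split_ifs <;> simp
      rw [hκ, (E.dV m).leibniz κ, map_sub, (E.dV m).leibniz (E.y m), (E.dV m).leibniz (F * F) (if m = k then (1 : A) else 0), hif, E.dV_y]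
      simp only [smul_eq_mul, if_true]
      ring
    simp only [d1, Finset.sum_sub_distrib, ← Finset.mul_sum, ← Finset.sum_mul, e1, ← hr]
    simp [sq]
    ring
  -- Bianchi with both forms of the Euler–Lagrange expression of S; the radial derivative `r` of κ
  -- is still present.
  have main : ∀ k, (n + 1) * (F * F) * E.dV k κ - 2 * r * (F * E.dV k F)
      = 3 * ((n + 1) * (E.dX k c * F - c₀ * E.dV k F)) := by
    intro k
    have b1 := E.trace_dV_curv G k
    have b2 := h.eulerLagrange_S hτ k
    have b3 := h.eulerLagrange_isotropic hc hS k
    rw [div, tr] at b1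
    have hn1 : E.dV k ((n : A) - 1) = 0 := by
      rw [map_sub, Derivation.map_natCast, Derivation.map_one_eq_zero, sub_zero]
    rw [(E.dV k).leibniz (((n : A) - 1) * κ), (E.dV k).leibniz ((n : A) - 1), hn1, sq] at b1
    simp only [smul_eq_mul] at b1
    linear_combination b1 + 3 * b2 - 3 * b3
  -- Contraction with yᵏ annihilates the right side of `main` and leaves (n - 1)F²r on the left;
  -- here n ≥ 2 is needed.
  have hr0 : r = 0 := by
    have s1 : ∑ k, E.y k * ((n + 1) * (F * F) * E.dV k κ - 2 * r * (F * E.dV k F))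
        = (n + 1) * (F * F) * r - 2 * r * F * F := by
      calc _ = (n + 1) * (F * F) * ∑ k, E.y k * E.dV k κ - 2 * r * F * ∑ k, E.y k * E.dV k F := by
            simp only [Finset.mul_sum, ← Finset.sum_sub_distrib]
            exact Finset.sum_congr rfl fun m _ => by ring
        _ = _ := by rw [h.euler, ← hr]
    have s2 : ∑ k, E.y k * (3 * ((n + 1) * (E.dX k c * F - c₀ * E.dV k F))) = 0 := by
      calc _ = 3 * (n + 1) * F * ∑ k, E.y k * E.dX k c
            - 3 * (n + 1) * c₀ * ∑ k, E.y k * E.dV k F := by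
            simp only [Finset.mul_sum, ← Finset.sum_sub_distrib]
            exact Finset.sum_congr rfl fun m _ => by ring
        _ = _ := by rw [h.euler, ← hc₀]; ring
    simp only [main] at s1
    rw [s2] at s1
    refine natCast_mul_cancel (k := n - 1) (by omega) ?_
    rw [Nat.cast_sub (by omega)]
    push_cast
    linear_combination (-Fi * Fi) * s1 - (n - 1) * r * (F * Fi + 1) * h.mul_inv
  have := main k
  rw [hr0] at this
  refine natCast_mul_cancel (k := n + 1) (by omega) ?_
  push_cast
  linear_combination this

/-- The relation between the mean Cartan torsion and the vertical derivative of the flag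
curvature. -/
theorem dV_distortion (h : FinslerRelations E F Fi G) (hτ : IsDistortion E F τ v)
    (hκ : ∀ i k, E.curv G i k = κ * (F * F * (if i = k then 1 else 0) - E.y i * (F * E.dV k F)))
    (hc : ∀ k, E.dV k c = 0) (hS : E.sprayField G τ = (n + 1) * c * F)
    (hJ : ∀ k, E.sprayField G (E.dV k τ) - ∑ m, E.conn G m k * E.dV m τ = -(c * F * E.dV k τ))
    (k : Fin n) :
    (n + 1) * ((∑ m, E.y m * E.dX m c) * E.dV k F - E.dX k c * F)
      = (c * c * (F * F) - (∑ m, E.y m * E.dX m c) * F + κ * (F * F)) * E.dV k τ := by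
  set c₀ := ∑ m, E.y m * E.dX m c with hc₀
  have hXc : E.sprayField G c = c₀ := by
    simp [E.sprayField_apply, hc, hc₀]
  -- The Landsberg condition determines X(τ_k), and the commutator of X with ∂/∂yᵏ converts this
  -- into δ_kτ.
  have d1 : ∀ k, E.horiz G k τ = E.dV k (E.sprayField G τ) + c * F * E.dV k τ := by
    intro k
    rw [E.dV_sprayField, E.horiz_apply]
    linear_combination -hJ k
  have d2 := E.sprayField_horiz G k τ
  -- The radial part of the curvature drops out because τ is homogeneous of degree zero.
  have d3 : ∑ m, E.curv G m k * E.dV m τ = κ * (F * F) * E.dV k τ := by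
    have : ∑ m, E.curv G m k * E.dV m τ = κ * (F * F) * ∑ m, (if m = k then 1 else 0) * E.dV m τ
        - κ * (F * E.dV k F) * ∑ m, E.y m * E.dV m τ := by
      simp only [hκ, Finset.mul_sum, ← Finset.sum_sub_distrib]
      exact Finset.sum_congr rfl fun m _ => by ring
    rw [this, h.euler_distortion hτ]
    simp
  have d4 := h.eulerLagrange_isotropic hc hS k
  have d5 : E.horiz G k (E.sprayField G τ) = E.dX k (E.sprayField G τ)
      - ∑ m, E.conn G m k * E.dV m (E.sprayField G τ) := E.horiz_apply G _ _
  have d6 : ∑ m, E.conn G m k * E.horiz G m τ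
      = ∑ m, E.conn G m k * E.dV m (E.sprayField G τ)
        + c * F * ∑ m, E.conn G m k * E.dV m τ := by
    simp only [d1, Finset.mul_sum, ← Finset.sum_add_distrib]
    exact Finset.sum_congr rfl fun m _ => by ring
  have d7 : E.sprayField G (c * F * E.dV k τ) = c₀ * F * E.dV k τ
      + c * F * E.sprayField G (E.dV k τ) := by
    simp only [Derivation.leibniz, smul_eq_mul, hXc, h.sprayField_self]
    ring
  rw [d1, map_add, d7, d5, d6, d3] at d2
  linear_combination d2 - d4 - c * F * hJ k

end FinslerRelations

end FinslerAlgebra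

/-! ### The algebra of smooth functions on an open set. -/

section SmoothAlgebra

variable {W : Type*} [NormedAddCommGroup W] [NormedSpace ℝ W]

/-- The algebra of smooth functions on a subset of a normed space. -/
def smoothFun (Ω : Set W) : Subalgebra ℝ (Ω → ℝ) where
  carrier := {f | ∃ h : W → ℝ, ContDiffOn ℝ ∞ h Ω ∧ ∀ z : Ω, f z = h z}
  mul_mem' := by
    rintro f g ⟨h, hh, hf⟩ ⟨k, hk, hg⟩
    exact ⟨fun z => h z * k z, hh.mul hk, fun z => by simp [hf, hg]⟩
  add_mem' := by
    rintro f g ⟨h, hh, hf⟩ ⟨k, hk, hg⟩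
    exact ⟨fun z => h z + k z, hh.add hk, fun z => by simp [hf, hg]⟩
  algebraMap_mem' r := ⟨fun _ => r, contDiffOn_const, fun _ => rfl⟩

/-- `f` is the restriction of `h`. -/
def Represents {Ω : Set W} (f : smoothFun Ω) (h : W → ℝ) : Prop :=
  ∀ z : Ω, f.1 z = h z

/-- The restriction of a smooth function. -/
def restr {Ω : Set W} (h : W → ℝ) (hh : ContDiffOn ℝ ∞ h Ω) : smoothFun Ω :=
  ⟨fun z => h z, h, hh, fun _ => rfl⟩

theorem represents_restr {Ω : Set W} {h : W → ℝ} (hh : ContDiffOn ℝ ∞ h Ω) :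
    Represents (restr h hh) h := fun _ => rfl

theorem Represents.contDiffOn {Ω : Set W} {f : smoothFun Ω} {h : W → ℝ} (hf : Represents f h) :
    ContDiffOn ℝ ∞ h Ω := by
  obtain ⟨k, hk, hfk⟩ := f.2
  exact hk.congr fun z hz => (hf ⟨z, hz⟩).symm.trans (hfk ⟨z, hz⟩)

/-- An extension of a smooth function by an unspecified function outside `Ω`. -/
def extend {Ω : Set W} (f : smoothFun Ω) : W → ℝ := Classical.choose f.2

theorem represents_extend {Ω : Set W} (f : smoothFun Ω) : Represents f (extend f) :=
  (Classical.choose_spec f.2).2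

variable {Ω : Set W}

theorem Represents.eventuallyEq (hΩ : IsOpen Ω) {f : smoothFun Ω} {h k : W → ℝ}
    (hf : Represents f h) (hk : Represents f k) {z : W} (hz : z ∈ Ω) : h =ᶠ[𝓝 z] k := by
  filter_upwards [hΩ.mem_nhds hz] with w hw
  exact (hf ⟨w, hw⟩).symm.trans (hk ⟨w, hw⟩)

theorem Represents.differentiableAt (hΩ : IsOpen Ω) {f : smoothFun Ω} {h : W → ℝ}
    (hf : Represents f h) {z : W} (hz : z ∈ Ω) : DifferentiableAt ℝ h z :=
  (hf.contDiffOn.contDiffAt (hΩ.mem_nhds hz)).differentiableAt (by simp)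

theorem contDiffOn_fderiv_apply (hΩ : IsOpen Ω) {h : W → ℝ} (hh : ContDiffOn ℝ ∞ h Ω) (v : W) :
    ContDiffOn ℝ ∞ (fun z => fderiv ℝ h z v) Ω :=
  (hh.fderiv_of_isOpen hΩ (by simp)).clm_apply contDiffOn_const

/-- The directional derivative as a derivation of the algebra of smooth functions. -/
def dirDeriv (hΩ : IsOpen Ω) (v : W) : Derivation ℝ (smoothFun Ω) (smoothFun Ω) :=
  Derivation.mk'
    { toFun := fun f => restr (fun z => fderiv ℝ (extend f) z v)
        (contDiffOn_fderiv_apply hΩ (represents_extend f).contDiffOn v)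
      map_add' := fun f g => by
        refine Subtype.ext (funext fun z => ?_)
        have h1 : Represents (f + g) (extend f + extend g) := fun w =>
          congrArg₂ (· + ·) (represents_extend f w) (represents_extend g w)
        change fderiv ℝ (extend (f + g)) z v
          = fderiv ℝ (extend f) z v + fderiv ℝ (extend g) z v
        rw [((represents_extend (f + g)).eventuallyEq hΩ h1 z.2).fderiv_eq,
          fderiv_add ((represents_extend f).differentiableAt hΩ z.2)
            ((represents_extend g).differentiableAt hΩ z.2)]
        rfl
      map_smul' := fun r f => by
        refine Subtype.ext (funext fun z => ?_)
        have h1 : Represents (r • f) (r • extend f) := fun w =>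
          congrArg (r * ·) (represents_extend f w)
        change fderiv ℝ (extend (r • f)) z v = r * fderiv ℝ (extend f) z v
        rw [((represents_extend (r • f)).eventuallyEq hΩ h1 z.2).fderiv_eq,
          fderiv_const_smul ((represents_extend f).differentiableAt hΩ z.2)]
        rfl }
    fun f g => by
      refine Subtype.ext (funext fun z => ?_)
      have h1 : Represents (f * g) (extend f * extend g) := fun w =>
        congrArg₂ (· * ·) (represents_extend f w) (represents_extend g w)
      change fderiv ℝ (extend (f * g)) z v
        = f.1 z * fderiv ℝ (extend g) z v + g.1 z * fderiv ℝ (extend f) z v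
      rw [((represents_extend (f * g)).eventuallyEq hΩ h1 z.2).fderiv_eq,
        fderiv_mul ((represents_extend f).differentiableAt hΩ z.2)
          ((represents_extend g).differentiableAt hΩ z.2), represents_extend f z,
        represents_extend g z]
      rfl

/-- `Ω` is open, so a derivative may be computed from any function agreeing on `Ω`, not only from
the chosen `extend f`. -/
theorem Represents.dirDeriv (hΩ : IsOpen Ω) {f : smoothFun Ω} {h : W → ℝ} (hf : Represents f h)
    (v : W) : Represents (dirDeriv hΩ v f) fun z => fderiv ℝ h z v := fun z => by
  change fderiv ℝ (extend f) z v = _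
  rw [((represents_extend f).eventuallyEq hΩ hf z.2).fderiv_eq]

theorem dirDeriv_comm (hΩ : IsOpen Ω) (v w : W) (f : smoothFun Ω) :
    dirDeriv hΩ v (dirDeriv hΩ w f) = dirDeriv hΩ w (dirDeriv hΩ v f) := by
  refine Subtype.ext (funext fun z => ?_)
  have hf := represents_extend f
  rw [(hf.dirDeriv hΩ w).dirDeriv hΩ v z, (hf.dirDeriv hΩ v).dirDeriv hΩ w z]
  have hc := hf.contDiffOn.contDiffAt (hΩ.mem_nhds z.2)
  have hd : DifferentiableAt ℝ (fderiv ℝ (extend f)) z :=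
    (hc.fderiv_right (m := 1) (by norm_cast)).differentiableAt (by simp)
  have key : ∀ a b : W, fderiv ℝ (fun u => fderiv ℝ (extend f) u a) z b
      = fderiv ℝ (fderiv ℝ (extend f)) z b a := by
    intro a b
    rw [fderiv_clm_apply hd (differentiableAt_const a)]
    simp
  exact (key w v).trans (((hc.isSymmSndFDerivAt
    (by rw [minSmoothness_of_isRCLikeNormedField]; exact WithTop.coe_le_coe.2 (le_top : (2 : ℕ∞) ≤ ⊤))).eq v w).trans (key v w).symm)

/-- The inverse of a nowhere vanishing smooth function. -/
def smoothInv (f : smoothFun Ω) (hf : ∀ z, f.1 z ≠ 0) : smoothFun Ω :=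
  restr (fun z => (extend f z)⁻¹) <| (represents_extend f).contDiffOn.inv fun z hz => by
    rw [← represents_extend f ⟨z, hz⟩]
    exact hf _

theorem smoothInv_apply (f : smoothFun Ω) (hf : ∀ z, f.1 z ≠ 0) (z : Ω) :
    (smoothInv f hf).1 z = (f.1 z)⁻¹ := by
  rw [represents_extend f z]
  rfl

theorem mul_smoothInv (f : smoothFun Ω) (hf : ∀ z, f.1 z ≠ 0) : f * smoothInv f hf = 1 :=
  Subtype.ext (funext fun z => by
    change f.1 z * (smoothInv f hf).1 z = 1
    rw [smoothInv_apply, mul_inv_cancel₀ (hf z)])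

/-- Evaluation at a point. -/
def evalAt (z : Ω) : smoothFun Ω →+* ℝ :=
  (Pi.evalRingHom (fun _ : Ω => ℝ) z).comp (smoothFun Ω).val.toRingHom

theorem evalAt_apply (z : Ω) (f : smoothFun Ω) : evalAt z f = f.1 z := rfl

theorem smoothFun_ext {f g : smoothFun Ω} (h : ∀ z, evalAt z f = evalAt z g) : f = g :=
  Subtype.ext (funext h)

theorem evalAt_smul (z : Ω) (r : ℝ) (f : smoothFun Ω) : evalAt z (r • f) = r * evalAt z f := rfl

end SmoothAlgebra

/-! ### Partial derivatives in the coordinates (x, y). -/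

section Coordinates

variable {n : ℕ} {Ω : Set (Vec n × Vec n)}

theorem dx_eq_fderiv {f : Vec n × Vec n → ℝ} {z : Vec n × Vec n} (hf : DifferentiableAt ℝ f z)
    (i : Fin n) : dx i f z = fderiv ℝ f z (EuclideanSpace.single i 1, 0) := by
  have h1 : HasFDerivAt (fun w : Vec n => (w, z.2)) (ContinuousLinearMap.inl ℝ _ _) z.1 :=
    (hasFDerivAt_id z.1).prodMk (hasFDerivAt_const z.2 z.1)
  have h2 := HasFDerivAt.comp z.1 (f := fun w : Vec n => (w, z.2)) (g := f) hf.hasFDerivAt h1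
  rw [dx, pd]
  erw [h2.fderiv]
  simp

theorem dy_eq_fderiv {f : Vec n × Vec n → ℝ} {z : Vec n × Vec n} (hf : DifferentiableAt ℝ f z)
    (i : Fin n) : dy i f z = fderiv ℝ f z (0, EuclideanSpace.single i 1) := by
  have h1 : HasFDerivAt (fun w : Vec n => (z.1, w)) (ContinuousLinearMap.inr ℝ _ _) z.2 :=
    (hasFDerivAt_const z.1 z.2).prodMk (hasFDerivAt_id z.2)
  have h2 := HasFDerivAt.comp z.2 (f := fun w : Vec n => (z.1, w)) (g := f) hf.hasFDerivAt h1
  rw [dy, pd]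
  erw [h2.fderiv]
  simp

/-- A directional derivative in terms of partial derivatives. -/
theorem fderiv_apply_eq_sum {f : Vec n × Vec n → ℝ} {z : Vec n × Vec n}
    (hf : DifferentiableAt ℝ f z) (v : Vec n × Vec n) :
    fderiv ℝ f z v = (∑ k, v.1 k * dx k f z) + ∑ k, v.2 k * dy k f z := by
  have key : ∀ w : Vec n, w = ∑ k, w k • (EuclideanSpace.single k 1 : Vec n) := fun w => by
    ext j
    simp [Pi.single_apply]
  have h1 : ((v.1, 0) : Vec n × Vec n)
      = ∑ k, v.1 k • ((EuclideanSpace.single k 1 : Vec n), (0 : Vec n)) := by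
    refine Prod.ext ?_ ?_
    · rw [Prod.fst_sum]
      exact key v.1
    · simp [Prod.snd_sum]
  have h2 : ((0, v.2) : Vec n × Vec n)
      = ∑ k, v.2 k • ((0 : Vec n), (EuclideanSpace.single k 1 : Vec n)) := by
    refine Prod.ext ?_ ?_
    · simp [Prod.fst_sum]
    · rw [Prod.snd_sum]
      exact key v.2
  have h3 : v = (v.1, 0) + (0, v.2) := by simp
  rw [h3, map_add, h1, h2, map_sum, map_sum, ← h1, ← h2]
  simp only [map_smul, smul_eq_mul, dx_eq_fderiv hf, dy_eq_fderiv hf]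
  simp

/-- The coordinate derivations on smooth functions of `(xⁱ, yⁱ)`. -/
def coordDerivations (hΩ : IsOpen Ω) : CoordDerivations n (smoothFun Ω) where
  dX i := dirDeriv hΩ (EuclideanSpace.single i 1, 0)
  dV i := dirDeriv hΩ (0, EuclideanSpace.single i 1)
  y i := restr (fun z => z.2 i) (by fun_prop)
  dX_comm _ _ f := dirDeriv_comm hΩ _ _ f
  dV_comm _ _ f := dirDeriv_comm hΩ _ _ f
  dV_dX _ _ f := dirDeriv_comm hΩ _ _ f
  dX_y i j := smoothFun_ext fun z => by
    have h := (represents_restr (Ω := Ω) (h := fun z : Vec n × Vec n => z.2 j)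
      (by fun_prop)).dirDeriv hΩ (EuclideanSpace.single i 1, 0) z
    refine h.trans ?_
    have h2 : HasFDerivAt (fun z : Vec n × Vec n => z.2 j)
      ((EuclideanSpace.proj j).comp (ContinuousLinearMap.snd ℝ (Vec n) (Vec n))) z.1 :=
      ((EuclideanSpace.proj (𝕜 := ℝ) j).comp
        (ContinuousLinearMap.snd ℝ (Vec n) (Vec n))).hasFDerivAt
    beta_reduce
    rw [h2.fderiv]
    simp
  dV_y i j := smoothFun_ext fun z => by
    have h := (represents_restr (Ω := Ω) (h := fun z : Vec n × Vec n => z.2 j)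
      (by fun_prop)).dirDeriv hΩ (0, EuclideanSpace.single i 1) z
    refine h.trans ?_
    have h2 : HasFDerivAt (fun z : Vec n × Vec n => z.2 j)
      ((EuclideanSpace.proj j).comp (ContinuousLinearMap.snd ℝ (Vec n) (Vec n))) z.1 :=
      ((EuclideanSpace.proj (𝕜 := ℝ) j).comp
        (ContinuousLinearMap.snd ℝ (Vec n) (Vec n))).hasFDerivAt
    beta_reduce
    rw [h2.fderiv]
    by_cases hij : i = j
    · simp [hij]
    · simp [hij, Ne.symm hij]

variable {hΩ : IsOpen Ω} {f : smoothFun Ω} {h : Vec n × Vec n → ℝ}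

theorem Represents.dX (hf : Represents f h) (i : Fin n) :
    Represents ((coordDerivations hΩ).dX i f) (dx i h) := fun z =>
  (hf.dirDeriv hΩ _ z).trans (dx_eq_fderiv (hf.differentiableAt hΩ z.2) i).symm

theorem Represents.dV (hf : Represents f h) (i : Fin n) :
    Represents ((coordDerivations hΩ).dV i f) (dy i h) := fun z =>
  (hf.dirDeriv hΩ _ z).trans (dy_eq_fderiv (hf.differentiableAt hΩ z.2) i).symm

theorem evalAt_dV (hf : Represents f h) (i : Fin n) (z : Ω) :
    evalAt z ((coordDerivations hΩ).dV i f) = dy i h z :=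
  hf.dV (hΩ := hΩ) i z

theorem evalAt_y (i : Fin n) (z : Ω) : evalAt z ((coordDerivations hΩ).y i) = z.1.2 i := rfl

end Coordinates

/-! ### Gauges and the volume of their unit balls. -/

section Gauge

variable {n : ℕ}

/-- A positive, positively homogeneous function on `ℝⁿ`, continuous away from the origin. -/
structure IsGauge (f : Vec n → ℝ) : Prop where
  cont : ContinuousOn f {0}ᶜ
  pos : ∀ y, y ≠ 0 → 0 < f y
  homog : ∀ (y : Vec n) (a : ℝ), 0 < a → f (a • y) = a * f y

namespace IsGauge

variable {f : Vec n → ℝ}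

theorem zero (hf : IsGauge f) : f 0 = 0 := by
  have := hf.homog 0 2 two_pos
  rw [smul_zero] at this
  linarith

theorem nonneg (hf : IsGauge f) (y : Vec n) : 0 ≤ f y := by
  by_cases hy : y = 0
  · rw [hy, hf.zero]
  · exact (hf.pos y hy).le

/-- Bounds on the unit sphere propagate by homogeneity. -/
theorem eq_norm_mul (hf : IsGauge f) {y : Vec n} (hy : y ≠ 0) :
    f y = ‖y‖ * f (‖y‖⁻¹ • y) := by
  have h := norm_pos_iff.2 hy
  rw [← hf.homog _ _ h, smul_smul, mul_inv_cancel₀ h.ne', one_smul]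

theorem exists_bounds (hf : IsGauge f) :
    ∃ a b : ℝ, 0 < a ∧ 0 < b ∧ ∀ y, a * ‖y‖ ≤ f y ∧ f y ≤ b * ‖y‖ := by
  have hc : ContinuousOn f (Metric.sphere 0 1) := hf.cont.mono fun y hy h => by
    rw [Set.mem_singleton_iff.1 h] at hy
    simp at hy
  have hs : IsCompact (Metric.sphere (0 : Vec n) 1) := isCompact_sphere _ _
  obtain ⟨a, ha, ha'⟩ := hs.exists_forall_le' hc (a := 0) fun y hy => hf.pos y fun h => by
    rw [h] at hy
    simp at hy
  obtain ⟨b, hb⟩ := hs.bddAbove_image hc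
  -- The maximum with 1 keeps the upper constant positive even if the sphere is empty, as it is for
  -- n = 0.
  refine ⟨a, max b 1, ha, lt_max_of_lt_right one_pos, fun y => ?_⟩
  by_cases hy : y = 0
  · simp [hy, hf.zero]
  have h := norm_pos_iff.2 hy
  have hmem : ‖y‖⁻¹ • y ∈ Metric.sphere (0 : Vec n) 1 := by
    rw [mem_sphere_zero_iff_norm, norm_smul, norm_inv, norm_norm, inv_mul_cancel₀ h.ne']
  rw [hf.eq_norm_mul hy]
  constructor
  · rw [mul_comm a]
    exact mul_le_mul_of_nonneg_left (ha' _ hmem) h.le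
  · rw [mul_comm (max b 1)]
    exact mul_le_mul_of_nonneg_left ((hb (Set.mem_image_of_mem f hmem)).trans (le_max_left _ _)) h.le

theorem continuous (hf : IsGauge f) : Continuous f := by
  rw [continuous_iff_continuousAt]
  intro y
  by_cases hy : y = 0
  · obtain ⟨a, b, -, -, h⟩ := hf.exists_bounds
    rw [hy, ContinuousAt, hf.zero]
    refine squeeze_zero (fun w => hf.nonneg w) (fun w => (h w).2) ?_
    have : Filter.Tendsto (fun w : Vec n => b * ‖w‖) (𝓝 0) (𝓝 (b * ‖(0 : Vec n)‖)) :=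
      (continuous_const.mul continuous_norm).tendsto 0
    simpa using this
  · exact hf.cont.continuousAt (isOpen_compl_singleton.mem_nhds hy)

theorem volume_ball_lt_top (hf : IsGauge f) : (volume : Measure (Vec n)) {w | f w < 1} < ⊤ := by
  obtain ⟨a, b, ha, -, h⟩ := hf.exists_bounds
  refine (measure_mono fun w hw => ?_).trans_lt (measure_ball_lt_top (x := 0) (r := a⁻¹))
  rw [mem_ball_zero_iff, ← one_div, lt_div_iff₀ ha, mul_comm]
  exact (h w).1.trans_lt hw

theorem volume_ball_pos (hf : IsGauge f) : 0 < (volume : Measure (Vec n)) {w | f w < 1} :=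
  (isOpen_lt hf.continuous continuous_const).measure_pos _ ⟨0, by simp [hf.zero]⟩

open scoped Pointwise in
theorem volume_lt (hf : IsGauge f) {r : ℝ} (hr : 0 < r) :
    (volume : Measure (Vec n)) {w | f w < r}
      = ENNReal.ofReal (r ^ n) * (volume : Measure (Vec n)) {w | f w < 1} := by
  have h1 : {w | f w < r} = r • {w | f w < 1} := by
    ext w
    rw [Set.mem_smul_set_iff_inv_smul_mem₀ hr.ne', Set.mem_ofPred_eq, Set.mem_ofPred_eq,
      hf.homog _ _ (inv_pos.2 hr), inv_mul_lt_iff₀ hr, mul_one]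
  rw [h1, Measure.addHaar_smul, finrank_euclideanSpace, Fintype.card_fin, abs_of_nonneg (by positivity)]

theorem volume_lt_nonpos (hf : IsGauge f) {r : ℝ} (hr : r ≤ 0) :
    (volume : Measure (Vec n)) {w | f w < r} = 0 := by
  have : {w | f w < r} = ∅ := by
    ext w
    simpa using hr.trans (hf.nonneg w)
  rw [this, measure_empty]

theorem norm : IsGauge (fun y : Vec n => ‖y‖) where
  cont := continuous_norm.continuousOn
  pos _ hy := norm_pos_iff.2 hy
  homog y a ha := by rw [norm_smul, Real.norm_of_nonneg ha.le]

/-- The distribution of a gauge is determined by the volume of its unit ball. -/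
theorem map_volume (hf : IsGauge f) {g : Vec n → ℝ} (hg : IsGauge g) :
    (volume : Measure (Vec n)).map f
      = ((volume : Measure (Vec n)) {w | f w < 1} / (volume : Measure (Vec n)) {w | g w < 1}) •
        (volume : Measure (Vec n)).map g := by
  set c := (volume : Measure (Vec n)) {w | f w < 1} / (volume : Measure (Vec n)) {w | g w < 1}
    with hcdef
  have hc : c * (volume : Measure (Vec n)) {w | g w < 1}
      = (volume : Measure (Vec n)) {w | f w < 1} :=
    ENNReal.div_mul_cancel hg.volume_ball_pos.ne' hg.volume_ball_lt_top.ne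
  -- Both distribution functions are multiples of rⁿ for r > 0, so they are proportional.
  have hIio : ∀ r, (volume : Measure (Vec n)).map f (Set.Iio r)
      = (c • (volume : Measure (Vec n)).map g) (Set.Iio r) := by
    intro r
    rw [Measure.smul_apply, Measure.map_apply hf.continuous.measurable measurableSet_Iio,
      Measure.map_apply hg.continuous.measurable measurableSet_Iio, smul_eq_mul]
    change volume {w | f w < r} = c * volume {w | g w < r}
    rcases le_or_gt r 0 with hr | hr
    · rw [hf.volume_lt_nonpos hr, hg.volume_lt_nonpos hr, mul_zero]
    · rw [hf.volume_lt hr, hg.volume_lt hr, ← hc]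
      ring
  have hfin : ∀ r, (volume : Measure (Vec n)).map f (Set.Iio r) ≠ ⊤ := by
    intro r
    rw [Measure.map_apply hf.continuous.measurable measurableSet_Iio]
    change volume {w | f w < r} ≠ ⊤
    rcases le_or_gt r 0 with hr | hr
    · rw [hf.volume_lt_nonpos hr]
      exact ENNReal.zero_ne_top
    · rw [hf.volume_lt hr]
      exact ENNReal.mul_ne_top ENNReal.ofReal_ne_top hf.volume_ball_lt_top.ne
  have hdiff : ∀ (μ : Measure ℝ) (a b : ℝ), a < b → μ (Set.Iio a) ≠ ⊤ →
      μ (Set.Ico a b) = μ (Set.Iio b) - μ (Set.Iio a) := by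
    intro μ a b hab h
    rw [← measure_sdiff (Set.Iio_subset_Iio hab.le) measurableSet_Iio.nullMeasurableSet h]
    congr 1
    ext t
    simp
  refine Measure.ext_of_Ico' _ _ (fun a b hab => ?_) fun a b hab => ?_
  · exact ((measure_mono Set.Ico_subset_Iio_self).trans_lt (hfin b).lt_top).ne
  · rw [hdiff _ _ _ hab (hfin a), hdiff _ _ _ hab (by rw [← hIio]; exact hfin a), hIio, hIio]

/-- Integrals of functions of a gauge. -/
theorem integral_comp (hf : IsGauge f) {g : Vec n → ℝ} (hg : IsGauge g) {φ : ℝ → ℝ}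
    (hφ : Continuous φ) :
    (∫ w, φ (f w)) = (volume : Measure (Vec n)).real {w | f w < 1}
      / (volume : Measure (Vec n)).real {w | g w < 1} * ∫ w, φ (g w) := by
  rw [← integral_map hf.continuous.measurable.aemeasurable hφ.aestronglyMeasurable,
    ← integral_map hg.continuous.measurable.aemeasurable hφ.aestronglyMeasurable,
    hf.map_volume hg, integral_smul_measure, ENNReal.toReal_div]
  rfl

end IsGauge

end Gauge

/-! ### Smooth dependence of the unit ball volume on the base point. -/

section Volume

variable {n : ℕ}

/-- The expression of a Finsler metric in local coordinates over an open set. -/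
structure IsLocalFinsler (U : Set (Vec n)) (L : Vec n × Vec n → ℝ) : Prop where
  isOpen : IsOpen U
  smooth : ContDiffOn ℝ ∞ L (U ×ˢ {0}ᶜ)
  pos : ∀ x ∈ U, ∀ y, y ≠ 0 → 0 < L (x, y)
  homog : ∀ x ∈ U, ∀ (y : Vec n) (a : ℝ), 0 < a → L (x, a • y) = a * L (x, y)
  posDef : ∀ x ∈ U, ∀ y, y ≠ 0 → (gram (fun w => L (x, w)) y).PosDef

namespace IsLocalFinsler

variable {U : Set (Vec n)} {L : Vec n × Vec n → ℝ}

theorem isOpen_slit (h : IsLocalFinsler U L) : IsOpen (U ×ˢ ({0}ᶜ : Set (Vec n))) :=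
  h.isOpen.prod isOpen_compl_singleton

theorem isGauge (h : IsLocalFinsler U L) {x : Vec n} (hx : x ∈ U) :
    IsGauge fun w => L (x, w) where
  cont := h.smooth.continuousOn.comp (by fun_prop) fun _ hy => ⟨hx, hy⟩
  pos := h.pos x hx
  homog := h.homog x hx

theorem exists_uniform_bounds (h : IsLocalFinsler U L) {s : Set (Vec n)} (hs : IsCompact s)
    (hsU : s ⊆ U) :
    ∃ a b : ℝ, 0 < a ∧ 0 < b ∧ ∀ x ∈ s, ∀ y, a * ‖y‖ ≤ L (x, y) ∧ L (x, y) ≤ b * ‖y‖ := by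
  have hne : ∀ y ∈ Metric.sphere (0 : Vec n) 1, y ≠ 0 := fun y hy h => by
    rw [h] at hy
    simp at hy
  have hK : IsCompact (s ×ˢ Metric.sphere (0 : Vec n) 1) := hs.prod (isCompact_sphere _ _)
  have hc : ContinuousOn L (s ×ˢ Metric.sphere (0 : Vec n) 1) :=
    h.smooth.continuousOn.mono fun z hz => ⟨hsU hz.1, hne _ hz.2⟩
  obtain ⟨a, ha, ha'⟩ := hK.exists_forall_le' hc (a := 0) fun z hz =>
    h.pos _ (hsU hz.1) _ (hne _ hz.2)
  obtain ⟨b, hb⟩ := hK.bddAbove_image hc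
  refine ⟨a, max b 1, ha, lt_max_of_lt_right one_pos, fun x hx y => ?_⟩
  have hg := h.isGauge (hsU hx)
  by_cases hy : y = 0
  · have := hg.zero
    simp [hy, this]
  have hy' := norm_pos_iff.2 hy
  have hmem : (x, ‖y‖⁻¹ • y) ∈ s ×ˢ Metric.sphere (0 : Vec n) 1 := by
    refine ⟨hx, ?_⟩
    rw [mem_sphere_zero_iff_norm, norm_smul, norm_inv, norm_norm, inv_mul_cancel₀ hy'.ne']
  have heq := hg.eq_norm_mul hy
  rw [heq]
  constructor
  · rw [mul_comm a]
    exact mul_le_mul_of_nonneg_left (ha' _ hmem) hy'.le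
  · rw [mul_comm (max b 1)]
    exact mul_le_mul_of_nonneg_left ((hb (Set.mem_image_of_mem L hmem)).trans (le_max_left _ _))
      hy'.le

/-- `L` is not smooth on the zero section, but there L < 1 locally, so the composite vanishes
nearby. -/
theorem contDiffOn_comp_bump (h : IsLocalFinsler U L) {φ : ℝ → ℝ} (hφ : ContDiff ℝ ∞ φ)
    (hφ0 : ∀ t < 1, φ t = 0) {s : Set (Vec n)} {b : ℝ} (hb : 0 < b) (hs : IsOpen s) (hsU : s ⊆ U)
    (hbd : ∀ x ∈ s, ∀ y, L (x, y) ≤ b * ‖y‖) :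
    ContDiffOn ℝ ∞ (fun z => φ (L z)) (s ×ˢ Set.univ) := by
  intro z hz
  refine ContDiffAt.contDiffWithinAt ?_
  by_cases hz2 : z.2 = 0
  · have hev : (fun z => φ (L z)) =ᶠ[𝓝 z] fun _ => 0 := by
      have ho : IsOpen (s ×ˢ Metric.ball (0 : Vec n) b⁻¹) := hs.prod Metric.isOpen_ball
      filter_upwards [ho.mem_nhds ⟨hz.1, by simp [hz2, hb]⟩] with w hw
      refine hφ0 _ ((hbd w.1 hw.1 w.2).trans_lt ?_)
      have := mem_ball_zero_iff.1 hw.2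
      rwa [← one_div, lt_div_iff₀ hb, mul_comm] at this
    exact contDiffAt_const.congr_of_eventuallyEq hev
  · exact hφ.contDiffAt.comp z
      (h.smooth.contDiffAt (h.isOpen_slit.mem_nhds ⟨hsU hz.1, hz2⟩))

/-- The volume of the unit ball is a smooth function of the base point. -/
theorem contDiffOn_volume (h : IsLocalFinsler U L) (hn : 1 ≤ n) :
    ContDiffOn ℝ ∞ (fun x => (volume : Measure (Vec n)).real {w | L (x, w) < 1}) U := by
  intro x₀ hx₀
  refine ContDiffAt.contDiffWithinAt ?_
  obtain ⟨r, hr, hrU⟩ := Metric.nhds_basis_closedBall.mem_iff.1 (h.isOpen.mem_nhds hx₀)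
  obtain ⟨a, b, ha, hb, hab⟩ := h.exists_uniform_bounds (isCompact_closedBall x₀ r) hrU
  -- A bump vanishing outside [1, 2] avoids both the zero section and infinity. By homogeneity the
  -- volume is a fixed multiple of ∫ φ(L(x, w)) dw, with the constant read off from the Euclidean
  -- norm.
  let φ : ContDiffBump (3 / 2 : ℝ) := ⟨1 / 4, 1 / 2, by norm_num, by norm_num⟩
  have hφ : ContDiff ℝ ∞ φ := φ.contDiff
  have hφ0 : ∀ t < 1, φ t = 0 := fun t ht => φ.zero_of_le_dist (by
    rw [Real.dist_eq, abs_of_neg (by linarith)]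
    change 1 / 2 ≤ _
    linarith)
  have hφ2 : ∀ t, 2 ≤ t → φ t = 0 := fun t ht => φ.zero_of_le_dist (by
    rw [Real.dist_eq, abs_of_pos (by linarith)]
    change 1 / 2 ≤ _
    linarith)
  set s := Metric.ball x₀ r with hsdef
  have hsc : s ⊆ Metric.closedBall x₀ r := Metric.ball_subset_closedBall
  have hsm := h.contDiffOn_comp_bump hφ hφ0 hb Metric.isOpen_ball (hsc.trans hrU)
    fun x hx y => (hab x (hsc hx) y).2
  -- Convolution with the constant 1, evaluated at 0, is the integral over the fibre; this gives
  -- smoothness in the parameter, with common support in the ball of radius 2/a.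
  have hconv := contDiffOn_convolution_right_with_param (𝕜 := ℝ) (n := ⊤) (μ := volume)
    (f := fun _ : Vec n => (1 : ℝ)) (g := fun x w => φ (L (x, w)))
    (ContinuousLinearMap.mul ℝ ℝ) (s := s) Metric.isOpen_ball
    (isCompact_closedBall (0 : Vec n) (2 / a)) (fun x w hx hw => by
      refine hφ2 _ ?_
      have h1 : 2 / a < ‖w‖ := by simpa using hw
      rw [div_lt_iff₀ ha, mul_comm] at h1
      exact h1.le.trans (hab x (hsc hx) w).1) (locallyIntegrable_const 1) hsm
  have h0 : ContDiffOn ℝ ∞ (fun x => ∫ w, φ (L (x, w))) s := by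
    refine (hconv.comp (f := fun x : Vec n => (x, (0 : Vec n))) (by fun_prop)
      fun x hx => ⟨hx, trivial⟩).congr fun x hx => ?_
    simp only [Function.comp, convolution, ContinuousLinearMap.mul_apply', one_mul, zero_sub]
    exact (integral_neg_eq_self (fun w => φ (L (x, w))) volume).symm
  set C := ∫ w : Vec n, φ ‖w‖ with hC
  have hC0 : 0 < C := by
    have hcont : Continuous fun w : Vec n => φ ‖w‖ := φ.continuous.comp continuous_norm
    -- Positivity of `C` needs a vector of norm 3/2, hence n ≥ 1.
    refine hcont.integral_pos_of_hasCompactSupport_nonneg_nonzero (x := EuclideanSpace.single ⟨0, hn⟩ (3 / 2))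
      ?_ (fun w => φ.nonneg) ?_
    · refine HasCompactSupport.intro (isCompact_closedBall (0 : Vec n) 2) fun w hw => hφ2 _ ?_
      simpa using (not_le.1 (fun hh => hw (by simpa using hh))).le
    · have : ‖(EuclideanSpace.single ⟨0, hn⟩ (3 / 2) : Vec n)‖ = 3 / 2 := by simp
      rw [this, φ.one_of_mem_closedBall (by simp [φ.rIn_pos.le])]
      exact one_ne_zero
  set B := (volume : Measure (Vec n)).real {w : Vec n | ‖w‖ < 1} with hB
  have hB0 : 0 < B := ENNReal.toReal_pos IsGauge.norm.volume_ball_pos.ne'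
    IsGauge.norm.volume_ball_lt_top.ne
  have hev : (fun x => (volume : Measure (Vec n)).real {w | L (x, w) < 1})
      =ᶠ[𝓝 x₀] fun x => B / C * ∫ w, φ (L (x, w)) := by
    filter_upwards [Metric.ball_mem_nhds x₀ hr] with x hx
    have h1 := (h.isGauge (hrU (hsc hx))).integral_comp IsGauge.norm φ.continuous
    rw [← hC, ← hB] at h1
    rw [h1]
    field_simp
  exact (contDiffAt_const.mul (h0.contDiffAt (Metric.ball_mem_nhds x₀ hr))).congr_of_eventuallyEq hev

theorem volume_pos (h : IsLocalFinsler U L) {x : Vec n} (hx : x ∈ U) :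
    0 < (volume : Measure (Vec n)).real {w | L (x, w) < 1} :=
  ENNReal.toReal_pos (h.isGauge hx).volume_ball_pos.ne' (h.isGauge hx).volume_ball_lt_top.ne

end IsLocalFinsler

end Volume

/-! ### From a local Finsler metric to the algebraic relations. -/

section Represents

variable {W : Type*} [NormedAddCommGroup W] [NormedSpace ℝ W] {Ω : Set W}

theorem Represents.evalAt_eq {f : smoothFun Ω} {h : W → ℝ} (hf : Represents f h) (z : Ω) :
    evalAt z f = h z := hf z

theorem isUnit_of_ne_zero {f : smoothFun Ω} (hf : ∀ z, evalAt z f ≠ 0) : IsUnit f :=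
  IsUnit.of_mul_eq_one _ (mul_smoothInv f hf)

/-- The logarithmic derivative. -/
theorem mul_dirDeriv_log (hΩ : IsOpen Ω) {f g : smoothFun Ω} {h : W → ℝ} (hf : Represents f h)
    (h0 : ∀ z : Ω, h z ≠ 0) (hg : Represents g fun z => Real.log (h z)) (v : W) :
    f * dirDeriv hΩ v g = dirDeriv hΩ v f := by
  refine smoothFun_ext fun z => ?_
  rw [map_mul, (hg.dirDeriv hΩ v).evalAt_eq, (hf.dirDeriv hΩ v).evalAt_eq, hf.evalAt_eq]
  rw [fderiv.log (hf.differentiableAt hΩ z.2) (h0 z)]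
  simp [h0 z]

end Represents

namespace IsLocalFinsler

variable {n : ℕ} {U : Set (Vec n)} {L : Vec n × Vec n → ℝ}

/-- The coordinate derivations over the slit tangent bundle of `U`. -/
abbrev coord (h : IsLocalFinsler U L) :
    CoordDerivations n (smoothFun (U ×ˢ ({0}ᶜ : Set (Vec n)))) :=
  coordDerivations h.isOpen_slit

/-- The Finsler metric as a smooth function. -/
abbrev fn (h : IsLocalFinsler U L) : smoothFun (U ×ˢ ({0}ᶜ : Set (Vec n))) := restr L h.smooth

theorem represents_fn (h : IsLocalFinsler U L) : Represents h.fn L := represents_restr _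

theorem represents_sq (h : IsLocalFinsler U L) : Represents (h.fn * h.fn) fun w => L w ^ 2 :=
  fun z => (sq (L z)).symm

abbrev hess (h : IsLocalFinsler U L) : Matrix (Fin n) (Fin n) (smoothFun (U ×ˢ ({0}ᶜ : Set (Vec n)))) :=
  FinslerRelations.hess h.coord h.fn

theorem represents_hess (h : IsLocalFinsler U L) (i j : Fin n) :
    Represents (h.hess i j) (dy i (dy j fun w => L w ^ 2)) :=
  (h.represents_sq.dV (hΩ := h.isOpen_slit) j).dV (hΩ := h.isOpen_slit) i

theorem evalAt_hess (h : IsLocalFinsler U L) (i j : Fin n) (z) :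
    evalAt z (h.hess i j) = 2 * metricMatrix L z i j := by
  have h1 : metricMatrix L z i j = 1 / 2 * dy i (dy j fun w => L w ^ 2) z := rfl
  rw [(h.represents_hess i j).evalAt_eq, h1]
  ring

theorem map_hess (h : IsLocalFinsler U L) (z) :
    (evalAt z).mapMatrix h.hess = (2 : ℝ) • metricMatrix L z := by
  ext i j
  exact h.evalAt_hess i j z

theorem evalAt_det (h : IsLocalFinsler U L) (z) :
    evalAt z h.hess.det = 2 ^ n * (metricMatrix L z).det := by
  rw [RingHom.map_det, h.map_hess, Matrix.det_smul, Fintype.card_fin]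

theorem det_metricMatrix_pos (h : IsLocalFinsler U L) {z : Vec n × Vec n} (hx : z.1 ∈ U)
    (hy : z.2 ≠ 0) : 0 < (metricMatrix L z).det :=
  (h.posDef z.1 hx z.2 hy).det_pos

theorem evalAt_det_pos (h : IsLocalFinsler U L) (z) : 0 < evalAt z h.hess.det := by
  rw [h.evalAt_det]
  exact mul_pos (by positivity) (h.det_metricMatrix_pos z.2.1 z.2.2)

theorem isUnit_det (h : IsLocalFinsler U L) : IsUnit h.hess.det :=
  isUnit_of_ne_zero fun z => (h.evalAt_det_pos z).ne'

/-- `hess` is twice the fundamental tensor, which is why the factor ¼ of `spray` becomes ½ in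
`sprayFn`. -/
theorem inv_metricMatrix (h : IsLocalFinsler U L) (z : (U ×ˢ ({0}ᶜ : Set (Vec n)) : Set _)) :
    (metricMatrix L z)⁻¹ = (2 : ℝ) • (evalAt z).mapMatrix h.hess⁻¹ := by
  refine Matrix.inv_eq_left_inv ?_
  rw [smul_mul_assoc, ← mul_smul_comm, ← h.map_hess, ← map_mul,
    Matrix.nonsing_inv_mul _ h.isUnit_det, map_one]

/-- The spray coefficients as smooth functions. -/
def sprayFn (h : IsLocalFinsler U L) (i : Fin n) : smoothFun (U ×ˢ ({0}ᶜ : Set (Vec n))) :=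
  (1 / 2 : ℝ) • ∑ l, h.hess⁻¹ i l *
    ((∑ k, h.coord.dX k (h.coord.dV l (h.fn * h.fn)) * h.coord.y k)
      - h.coord.dX l (h.fn * h.fn))

theorem represents_spray (h : IsLocalFinsler U L) (i : Fin n) :
    Represents (h.sprayFn i) (spray L i) := by
  intro z
  rw [← evalAt_apply, sprayFn, evalAt_smul, map_sum, spray, h.inv_metricMatrix z, Finset.mul_sum,
    Finset.mul_sum]
  refine Finset.sum_congr rfl fun l _ => ?_
  rw [map_mul, map_sub, map_sum, (h.represents_sq.dX l).evalAt_eq]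
  have : ∀ k, evalAt z (h.coord.dX k (h.coord.dV l (h.fn * h.fn)) * h.coord.y k)
      = dx k (dy l fun w => L w ^ 2) z * z.1.2 k := fun k => by
    rw [map_mul, ((h.represents_sq.dV l).dX k).evalAt_eq]
    rfl
  simp only [this, Matrix.smul_apply, RingHom.mapMatrix_apply, Matrix.map_apply, smul_eq_mul]
  ring

theorem contDiffOn_spray (h : IsLocalFinsler U L) (i : Fin n) :
    ContDiffOn ℝ ∞ (spray L i) (U ×ˢ {0}ᶜ) :=
  (h.represents_spray i).contDiffOn

theorem euler (h : IsLocalFinsler U L) {x y : Vec n} (hx : x ∈ U) (hy : y ≠ 0) :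
    ∑ k, y k * dy k L (x, y) = L (x, y) := by
  have hd := h.represents_fn.differentiableAt h.isOpen_slit (z := (x, y)) ⟨hx, hy⟩
  have h1 : HasDerivAt (fun t : ℝ => (x, t • y)) ((0 : Vec n), y) 1 := by
    have h2 : HasDerivAt (fun t : ℝ => t • y) ((1 : ℝ) • y) 1 := (hasDerivAt_id 1).smul_const y
    rw [one_smul] at h2
    exact (hasDerivAt_const 1 x).prodMk h2
  have h2 : HasDerivAt (fun t : ℝ => L (x, t • y)) (fderiv ℝ L (x, y) (0, y)) 1 := by
    have hd' : HasFDerivAt L (fderiv ℝ L (x, y)) (x, (1 : ℝ) • y) := by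
      rw [one_smul]
      exact hd.hasFDerivAt
    exact hd'.comp_hasDerivAt (1 : ℝ) h1
  have h3 : HasDerivAt (fun t : ℝ => t * L (x, y)) (1 * L (x, y)) 1 :=
    (hasDerivAt_id (1 : ℝ)).mul_const _
  have h4 : (fun t : ℝ => L (x, t • y)) =ᶠ[𝓝 1] fun t => t * L (x, y) := by
    filter_upwards [lt_mem_nhds (zero_lt_one : (0 : ℝ) < 1)] with t ht
    exact h.homog x hx y t ht
  have h5 := (h2.congr_of_eventuallyEq h4.symm).unique h3
  rw [one_mul] at h5
  rw [← h5]
  rw [fderiv_apply_eq_sum hd]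
  simp

theorem relations (h : IsLocalFinsler U L) :
    ∃ Fi, FinslerRelations h.coord h.fn Fi h.sprayFn := by
  refine ⟨smoothInv h.fn fun z => (h.pos _ z.2.1 _ z.2.2).ne', mul_smoothInv _ _, ?_, ?_,
    h.isUnit_det⟩
  · refine smoothFun_ext fun z => ?_
    rw [map_sum]
    refine Eq.trans (Finset.sum_congr rfl fun k _ => ?_) (h.euler z.2.1 z.2.2)
    rw [map_mul, (h.represents_fn.dV k).evalAt_eq]
    rfl
  · intro l
    set w : Fin n → smoothFun (U ×ˢ ({0}ᶜ : Set (Vec n))) := fun l =>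
      (∑ k, h.coord.dX k (h.coord.dV l (h.fn * h.fn)) * h.coord.y k)
        - h.coord.dX l (h.fn * h.fn) with hw
    have h1 : ∀ m, 2 * h.sprayFn m = (h.hess⁻¹.mulVec w) m := by
      intro m
      have : (2 : smoothFun (U ×ˢ ({0}ᶜ : Set (Vec n)))) = algebraMap ℝ _ 2 :=
        (map_ofNat (algebraMap ℝ _) 2).symm
      rw [sprayFn, this, ← Algebra.smul_def, smul_smul]
      rw [show (2 : ℝ) * (1 / 2) = 1 by norm_num, one_smul]
      rfl
    have h2 : (h.hess.mulVec (h.hess⁻¹.mulVec w)) l = w l := by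
      rw [Matrix.mulVec_mulVec, Matrix.mul_nonsing_inv _ h.isUnit_det, Matrix.one_mulVec]
    have h3 : 2 * ∑ m, h.coord.dV l (h.coord.dV m (h.fn * h.fn)) * h.sprayFn m
        = (h.hess.mulVec (h.hess⁻¹.mulVec w)) l := by
      rw [Finset.mul_sum]
      refine Finset.sum_congr rfl fun m _ => ?_
      rw [← h1]
      change _ = h.coord.dV l (h.coord.dV m (h.fn * h.fn)) * (2 * h.sprayFn m)
      ring
    rw [h3, h2, hw]
    simp only [mul_comm]

theorem represents_conn (h : IsLocalFinsler U L) (i k : Fin n) :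
    Represents (h.coord.conn h.sprayFn i k) (dy k (spray L i)) :=
  (h.represents_spray i).dV k

theorem evalAt_sprayField (h : IsLocalFinsler U L) {f : smoothFun (U ×ˢ ({0}ᶜ : Set (Vec n)))}
    {k : Vec n × Vec n → ℝ} (hf : Represents f k) (z) :
    evalAt z (h.coord.sprayField h.sprayFn f)
      = (∑ m, z.1.2 m * dx m k z) - 2 * ∑ m, spray L m z * dy m k z := by
  rw [CoordDerivations.sprayField_apply, map_sum, Finset.mul_sum, ← Finset.sum_sub_distrib]
  refine Finset.sum_congr rfl fun m _ => ?_
  rw [map_sub, map_mul, map_mul, map_mul, (hf.dX m).evalAt_eq, (hf.dV m).evalAt_eq,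
    (h.represents_spray m).evalAt_eq, evalAt_y, map_ofNat]
  ring

theorem evalAt_curv (h : IsLocalFinsler U L) (i k : Fin n) (z) :
    evalAt z (h.coord.curv h.sprayFn i k) = riemannCurvature L z i k := by
  rw [CoordDerivations.curv, map_sub, map_sub, map_mul, map_sum,
    h.evalAt_sprayField (h.represents_conn i k), ((h.represents_spray i).dX k).evalAt_eq, map_ofNat]
  simp only [map_mul, (h.represents_conn _ _).evalAt_eq]
  simp only [riemannCurvature, Matrix.of_apply]
  ring

/-- The logarithm of the volume of the unit ball, normalized. -/
def logVolume (L : Vec n × Vec n → ℝ) (x : Vec n) : ℝ :=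
  Real.log ((volume : Measure (Vec n)).real {w | L (x, w) < 1})
    - Real.log ((volume : Measure (Vec n)).real (Metric.ball 0 1)) - n / 2 * Real.log 2

theorem contDiffOn_logVolume (h : IsLocalFinsler U L) (hn : 1 ≤ n) :
    ContDiffOn ℝ ∞ (logVolume L) U :=
  (((h.contDiffOn_volume hn).log fun _ hx => (h.volume_pos hx).ne').sub contDiffOn_const).sub
    contDiffOn_const

/-- The summand -(n/2) log 2 of `logVolume` compensates det(2g) = 2ⁿ det g. -/
theorem localDistortion_eq (h : IsLocalFinsler U L) (z : (U ×ˢ ({0}ᶜ : Set (Vec n)) : Set _)) :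
    localDistortion L z = 1 / 2 * Real.log (evalAt z h.hess.det) + logVolume L z.1.1 := by
  have hd := h.det_metricMatrix_pos z.2.1 z.2.2
  have hv := h.volume_pos z.2.1
  have hB : 0 < (volume : Measure (Vec n)).real (Metric.ball 0 1) :=
    ENNReal.toReal_pos (Metric.measure_ball_pos _ _ one_pos).ne' measure_ball_lt_top.ne
  have h1 : localDistortion L z = Real.log (√((metricMatrix L z).det)
    / (volume : Measure (Vec n)).real (Metric.ball 0 1)
    * (volume : Measure (Vec n)).real {w | L (z.1.1, w) < 1}) := rfl
  rw [h1, Real.log_mul (by positivity) hv.ne', Real.log_div (by positivity) hB.ne',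
    Real.log_sqrt hd.le, h.evalAt_det, Real.log_mul (by positivity) hd.ne', Real.log_pow, logVolume]
  ring

theorem contDiffOn_log_det (h : IsLocalFinsler U L) :
    ContDiffOn ℝ ∞ (fun z => Real.log (extend h.hess.det z)) (U ×ˢ {0}ᶜ) :=
  (represents_extend h.hess.det).contDiffOn.log fun z hz => by
    rw [← represents_extend h.hess.det ⟨z, hz⟩]
    exact (h.evalAt_det_pos _).ne'

theorem exists_distortion (h : IsLocalFinsler U L) (hn : 1 ≤ n) :
    ∃ τ v, Represents τ (localDistortion L) ∧ FinslerRelations.IsDistortion h.coord h.fn τ v := by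
  have hlv : ContDiffOn ℝ ∞ (fun z : Vec n × Vec n => logVolume L z.1) (U ×ˢ {0}ᶜ) :=
    (h.contDiffOn_logVolume hn).comp contDiffOn_fst fun z hz => hz.1
  set l := restr _ h.contDiffOn_log_det with hl
  set v := restr _ hlv with hv
  have key : ∀ w : Vec n × Vec n, 2 * h.hess.det * dirDeriv h.isOpen_slit w ((1 / 2 : ℝ) • l + v)
      = dirDeriv h.isOpen_slit w h.hess.det + 2 * h.hess.det * dirDeriv h.isOpen_slit w v := by
    intro w
    have h1 := mul_dirDeriv_log h.isOpen_slit (represents_extend h.hess.det)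
      (fun z => by
        rw [← represents_extend h.hess.det z]
        exact (h.evalAt_det_pos _).ne') (represents_restr h.contDiffOn_log_det) w
    have h2 : (2 : smoothFun (U ×ˢ ({0}ᶜ : Set (Vec n)))) * (1 / 2 : ℝ) • dirDeriv h.isOpen_slit w l
        = dirDeriv h.isOpen_slit w l := by
      have : (2 : smoothFun (U ×ˢ ({0}ᶜ : Set (Vec n)))) = algebraMap ℝ _ 2 :=
        (map_ofNat (algebraMap ℝ _) 2).symm
      rw [this, ← Algebra.smul_def, smul_smul]
      norm_num
    rw [map_add, Derivation.map_smul]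
    linear_combination h.hess.det * h2 + h1
  have hv0 : ∀ k, h.coord.dV k v = 0 := by
    intro k
    refine smoothFun_ext fun z => ?_
    rw [((represents_restr hlv).dV k).evalAt_eq, map_zero]
    simp [dy, pd]
  refine ⟨(1 / 2 : ℝ) • l + v, v, fun z => ?_, fun k => key _, fun k => ?_, hv0⟩
  · rw [h.localDistortion_eq]
    change 1 / 2 * Real.log (extend h.hess.det z) + _ = _
    rw [← represents_extend h.hess.det z]
    rfl
  · have := hv0 k
    refine (key _).trans ?_
    erw [this]
    rw [mul_zero, add_zero]
    rfl

end IsLocalFinsler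

/-! ### Geodesics and the S-curvature. -/

section Geodesic

variable {n : ℕ}

theorem hasDerivAt_vec {f : ℝ → Vec n} {f' : Vec n} {t : ℝ}
    (h : ∀ i, HasDerivAt (fun r => f r i) (f' i) t) : HasDerivAt f f' t := by
  have h1 : HasDerivAt (fun r => (f r).ofLp) f'.ofLp t := hasDerivAt_pi.2 h
  exact (EuclideanSpace.equiv (Fin n) ℝ).symm.hasFDerivAt.comp_hasDerivAt t h1

namespace IsLocalFinsler

variable {U : Set (Vec n)} {L : Vec n × Vec n → ℝ}

/-- Picard–Lindelöf for the first-order system on (x, y). Existence is what makes the choice in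
`geodesic` a genuine geodesic. -/
theorem exists_geodesic (h : IsLocalFinsler U L) (z : (U ×ˢ ({0}ᶜ : Set (Vec n)) : Set _)) :
    ∃ s, IsGeodesicFrom L z s := by
  have hΦ : ContDiffAt ℝ 1
      (fun w : Vec n × Vec n => (w.2, (WithLp.toLp 2 fun i => -2 * spray L i w : Vec n))) z.1 := by
    refine contDiffAt_snd.prodMk (contDiffAt_euclidean.2 fun i => ?_)
    exact contDiffAt_const.mul (((h.contDiffOn_spray i).contDiffAt
      (h.isOpen_slit.mem_nhds z.2)).of_le (by norm_cast))
  obtain ⟨α, hα0, ε, hε, hα⟩ :=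
    hΦ.exists_forall_mem_closedBall_exists_eq_forall_mem_Ioo_hasDerivAt₀ 0
  rw [zero_sub, zero_add] at hα
  have h1 : ∀ t ∈ Set.Ioo (-ε) ε, HasDerivAt (fun r => (α r).1) (α t).2 t := fun t ht =>
    (hasFDerivAt_fst (𝕜 := ℝ) (p := α t)).comp_hasDerivAt t (hα t ht)
  have h2 : ∀ t ∈ Set.Ioo (-ε) ε, deriv (fun r => (α r).1) t = (α t).2 := fun t ht =>
    (h1 t ht).deriv
  have h3 : ∀ t ∈ Set.Ioo (-ε) ε, ∀ i,
      HasDerivAt (fun r => (α r).2 i) (-2 * spray L i (α t)) t := fun t ht i => by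
    have := ((EuclideanSpace.proj (𝕜 := ℝ) i).comp
      (ContinuousLinearMap.snd ℝ (Vec n) (Vec n))).hasFDerivAt.comp_hasDerivAt t (hα t ht)
    exact this
  have h0 : (0 : ℝ) ∈ Set.Ioo (-ε) ε := ⟨by linarith, hε⟩
  refine ⟨fun t => (α t).1, by simp [hα0], by rw [h2 0 h0, hα0], ?_⟩
  filter_upwards [Ioo_mem_nhds h0.1 h0.2] with t ht
  refine ⟨(h1 t ht).differentiableAt, fun i => ?_⟩
  rw [h2 t ht]
  refine (h3 t ht i).congr_of_eventuallyEq ?_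
  filter_upwards [Ioo_mem_nhds ht.1 ht.2] with r hr
  rw [h2 r hr]

/-- The S-curvature is the derivative of the distortion along the spray. -/
theorem evalAt_sprayField_distortion (h : IsLocalFinsler U L)
    {τ : smoothFun (U ×ˢ ({0}ᶜ : Set (Vec n)))} (hτ : Represents τ (localDistortion L)) (z) :
    evalAt z (h.coord.sprayField h.sprayFn τ) = sCurvature L z := by
  -- Only the position, velocity and acceleration at time 0 enter the derivative, so uniqueness of
  -- the geodesic is not needed.
  obtain ⟨hs0, hs1, hs⟩ := Classical.epsilon_spec (h.exists_geodesic z)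
  change geodesic L z 0 = _ at hs0
  change deriv (geodesic L z) 0 = _ at hs1
  obtain ⟨hd, hdd⟩ := hs.self_of_nhds
  change DifferentiableAt ℝ (geodesic L z) 0 at hd
  change ∀ i, HasDerivAt (fun r => deriv (geodesic L z) r i)
    (-2 * spray L i (geodesic L z 0, deriv (geodesic L z) 0)) 0 at hdd
  rw [hs0, hs1] at hdd
  have h1 : HasDerivAt (geodesic L z) z.1.2 0 := hs1 ▸ hd.hasDerivAt
  have h2 : HasDerivAt (deriv (geodesic L z)) (WithLp.toLp 2 fun i => -2 * spray L i z) 0 :=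
    hasDerivAt_vec hdd
  have hT := hτ.differentiableAt h.isOpen_slit z.2
  have h3 : HasFDerivAt (localDistortion L) (fderiv ℝ (localDistortion L) z)
      (geodesic L z 0, deriv (geodesic L z) 0) := by
    rw [hs0, hs1]
    exact hT.hasFDerivAt
  have h4 := h3.comp_hasDerivAt (0 : ℝ) (h1.prodMk h2)
  rw [sCurvature]
  refine Eq.trans ?_ h4.deriv.symm
  rw [h.evalAt_sprayField hτ, fderiv_apply_eq_sum hT, Finset.mul_sum, sub_eq_add_neg,
    ← Finset.sum_neg_distrib]
  congr 1
  refine Finset.sum_congr rfl fun m _ => ?_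
  simp only
  ring

end IsLocalFinsler

end Geodesic

/-! ### The curvature operator of a metric of scalar curvature. -/

section LinearAlgebra

open Matrix

variable {n : ℕ}

theorem eq_zero_of_dotProduct_mulVec {B : Matrix (Fin n) (Fin n) ℝ} (hB : B.IsSymm)
    (h : ∀ u : Fin n → ℝ, u ⬝ᵥ B *ᵥ u = 0) : B = 0 := by
  have hd : ∀ j, B j j = 0 := fun j => by
    have := h (Pi.single j 1)
    simpa using this
  ext j k
  have h1 := h (Pi.single j 1 + Pi.single k 1)
  simp only [mulVec_add, add_dotProduct, dotProduct_add, mulVec_single_one,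
    single_one_dotProduct] at h1
  change B j j + B k j + (B j k + B k k) = 0 at h1
  rw [hd, hd, hB.apply j k] at h1
  simp only [Matrix.zero_apply]
  linarith

/-- A self-adjoint operator with constant sectional values is determined. -/
theorem eq_of_constant_flag {g R : Matrix (Fin n) (Fin n) ℝ} (hg : g.PosDef) {y : Fin n → ℝ}
    (hy : y ≠ 0) (hsymm : (g * R).IsSymm) (hRy : (g * R) *ᵥ y = 0) {K : ℝ}
    (hflag : ∀ u : Fin n → ℝ, (∀ a : ℝ, a • y ≠ u) →
      u ⬝ᵥ (g * R) *ᵥ u / ((y ⬝ᵥ g *ᵥ y) * (u ⬝ᵥ g *ᵥ u) - (y ⬝ᵥ g *ᵥ u) ^ 2) = K) :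
    R = K • ((y ⬝ᵥ g *ᵥ y) • (1 : Matrix (Fin n) (Fin n) ℝ) - vecMulVec y (g *ᵥ y)) := by
  have hgs : g.IsSymm := by
    have := hg.1
    rwa [IsHermitian, conjTranspose_eq_transpose_of_trivial] at this
  have hsw : ∀ a b : Fin n → ℝ, a ⬝ᵥ g *ᵥ b = b ⬝ᵥ g *ᵥ a := fun a b => by
    rw [dotProduct_mulVec, ← mulVec_transpose, hgs.eq, dotProduct_comm]
  have hpos : ∀ a : Fin n → ℝ, a ≠ 0 → 0 < a ⬝ᵥ g *ᵥ a := fun a ha => by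
    simpa using hg.dotProduct_mulVec_pos ha
  have hvv : ∀ u : Fin n → ℝ, u ⬝ᵥ (vecMulVec (g *ᵥ y) (g *ᵥ y)) *ᵥ u = (y ⬝ᵥ g *ᵥ u) ^ 2 := by
    intro u
    rw [vecMulVec_mulVec, dotProduct_comm (g *ᵥ y) u, hsw y u]
    simp [sq]
  set B := g * R - K • ((y ⬝ᵥ g *ᵥ y) • g - vecMulVec (g *ᵥ y) (g *ᵥ y)) with hB
  have hBs : B.IsSymm := by
    rw [hB]
    refine hsymm.sub (IsSymm.smul ((hgs.smul _).sub ?_) _)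
    rw [IsSymm, transpose_vecMulVec]
  have hBu : ∀ u : Fin n → ℝ, u ⬝ᵥ B *ᵥ u = u ⬝ᵥ (g * R) *ᵥ u
      - K * ((y ⬝ᵥ g *ᵥ y) * (u ⬝ᵥ g *ᵥ u) - (y ⬝ᵥ g *ᵥ u) ^ 2) := by
    intro u
    rw [hB, sub_mulVec, smul_mulVec, sub_mulVec, smul_mulVec, dotProduct_sub, dotProduct_smul,
      dotProduct_sub, dotProduct_smul, hvv]
    rfl
  have hB0 : B = 0 := by
    refine eq_zero_of_dotProduct_mulVec hBs fun u => ?_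
    rw [hBu]
    by_cases hu : ∃ a : ℝ, a • y = u
    · obtain ⟨a, rfl⟩ := hu
      rw [mulVec_smul, hRy]
      simp only [mulVec_smul, dotProduct_smul, smul_dotProduct, smul_eq_mul, dotProduct_zero,
        smul_zero]
      ring
    · push Not at hu
      have hyy := hpos y hy
      -- The rescaled component of `u` orthogonal to `y`: its squared length is g(y, y) times the
      -- denominator of the flag curvature, which is therefore positive.
      have hw : (y ⬝ᵥ g *ᵥ y) • u - (y ⬝ᵥ g *ᵥ u) • y ≠ 0 := fun h0 => by
        refine hu ((y ⬝ᵥ g *ᵥ y)⁻¹ * (y ⬝ᵥ g *ᵥ u)) ?_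
        rw [mul_smul, ← sub_eq_zero.1 h0, smul_smul, inv_mul_cancel₀ hyy.ne', one_smul]
      have h1 := hpos _ hw
      have h2 : 0 < (y ⬝ᵥ g *ᵥ y) * (u ⬝ᵥ g *ᵥ u) - (y ⬝ᵥ g *ᵥ u) ^ 2 := by
        simp only [mulVec_sub, mulVec_smul, dotProduct_sub, dotProduct_smul, sub_dotProduct,
          smul_dotProduct, smul_eq_mul, hsw u y] at h1
        refine pos_of_mul_pos_right (a := y ⬝ᵥ g *ᵥ y) ?_ hyy.le
        linarith
      have h3 := hflag u hu
      rw [div_eq_iff h2.ne'] at h3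
      rw [h3, sub_self]
  have hdet : IsUnit g.det := hg.det_pos.ne'.isUnit
  have h4 : g * R = g * (K • ((y ⬝ᵥ g *ᵥ y) • (1 : Matrix (Fin n) (Fin n) ℝ)
      - vecMulVec y (g *ᵥ y))) := by
    rw [sub_eq_zero.1 hB0, mul_smul_comm, mul_sub, mul_smul_comm, mul_one, mul_vecMulVec]
  have h5 := congrArg (g⁻¹ * ·) h4
  simpa only [nonsing_inv_mul_cancel_left _ _ hdet] using h5

end LinearAlgebra

/-- The punctured space is connected in dimension at least 2; in dimension 1 the two half-lines
could carry different constants. -/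
theorem mem_compl_zero_constant {n : ℕ} (hn : 2 ≤ n) {f : Vec n → ℝ}
    (hd : ∀ y ≠ 0, DifferentiableAt ℝ f y) (hf : ∀ y ≠ 0, ∀ k, pd k f y = 0) {y y' : Vec n}
    (hy : y ≠ 0) (hy' : y' ≠ 0) : f y = f y' := by
  have hrank : 1 < Module.rank ℝ (Vec n) := by
    rw [← Module.finrank_eq_rank, finrank_euclideanSpace, Fintype.card_fin]
    exact_mod_cast hn
  refine isOpen_compl_singleton.is_const_of_fderiv_eq_zero
    (isConnected_compl_singleton_of_one_lt_rank hrank (0 : Vec n)).isPreconnected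
    (fun w hw => (hd w hw).differentiableWithinAt) (fun w hw => ?_) hy hy'
  ext v
  have : v = ∑ k, v k • (EuclideanSpace.single k 1 : Vec n) := by
    ext j
    simp [Pi.single_apply]
  rw [this, map_sum]
  refine Finset.sum_eq_zero fun k _ => ?_
  rw [map_smul]
  have := hf w hw k
  rw [pd] at this
  rw [this, smul_zero]

namespace IsLocalFinsler

open Matrix

variable {n : ℕ} {U : Set (Vec n)} {L : Vec n × Vec n → ℝ}

theorem constant_of_dV_eq_zero (h : IsLocalFinsler U L) (hn : 2 ≤ n)
    {f : smoothFun (U ×ˢ ({0}ᶜ : Set (Vec n)))} {k : Vec n × Vec n → ℝ} (hf : Represents f k)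
    (h0 : ∀ i, h.coord.dV i f = 0) {x y y' : Vec n} (hx : x ∈ U) (hy : y ≠ 0) (hy' : y' ≠ 0) :
    k (x, y) = k (x, y') := by
  refine mem_compl_zero_constant hn (f := fun w => k (x, w)) (fun w hw => ?_) (fun w hw i => ?_)
    hy hy'
  · have := hf.differentiableAt h.isOpen_slit (z := (x, w)) ⟨hx, hw⟩
    exact this.comp w (by fun_prop)
  · have := (hf.dV (hΩ := h.isOpen_slit) i).evalAt_eq ⟨(x, w), hx, hw⟩
    rw [h0, map_zero] at this
    exact this.symm

theorem metricForm_eq (L : Vec n × Vec n → ℝ) (z : Vec n × Vec n) (u v : Fin n → ℝ) :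
    metricForm L z u v = u ⬝ᵥ metricMatrix L z *ᵥ v := by
  simp only [metricForm, dotProduct, mulVec, Finset.mul_sum]
  exact Finset.sum_congr rfl fun i _ => Finset.sum_congr rfl fun j _ => by ring

/-- `g_ij yʲ = F ∂F/∂yⁱ`. -/
theorem metricMatrix_mulVec (h : IsLocalFinsler U L) (z : (U ×ˢ ({0}ᶜ : Set (Vec n)) : Set _))
    (i : Fin n) : (metricMatrix L z *ᵥ z.1.2) i = L z * dy i L z := by
  obtain ⟨Fi, hR⟩ := h.relations
  have h1 := congrArg (evalAt z) (hR.euler_dV_sq i)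
  rw [Derivation.leibniz] at h1
  simp only [map_sum, map_mul, map_add, smul_eq_mul, (h.represents_fn.dV i).evalAt_eq,
    h.represents_fn.evalAt_eq, evalAt_y] at h1
  have h2 : ∀ m, evalAt z (h.coord.dV m (h.fn • h.coord.dV i h.fn + h.fn • h.coord.dV i h.fn))
      = 2 * metricMatrix L z i m := fun m => by
    rw [← h.evalAt_hess, ← Derivation.leibniz, h.coord.dV_comm]
    rfl
  simp only [smul_eq_mul] at h2
  simp only [← map_add, h2] at h1
  have h3 : (metricMatrix L z *ᵥ z.1.2) i = 1 / 2 * ∑ m, z.1.2 m * (2 * metricMatrix L z i m) := by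
    rw [mulVec, dotProduct, Finset.mul_sum]
    exact Finset.sum_congr rfl fun m _ => by ring
  rw [h3, h1]
  ring

/-- The Riemann curvature of a metric of scalar curvature. -/
theorem riemannCurvature_eq (h : IsLocalFinsler U L)
    (z : (U ×ˢ ({0}ᶜ : Set (Vec n)) : Set _)) {K : ℝ}
    (hflag : ∀ u : Vec n, LinearIndependent ℝ ![z.1.2, u] → flagCurvature L z u = K)
    (i k : Fin n) : riemannCurvature L z i k
      = K * (L z * L z * (if i = k then 1 else 0) - z.1.2 i * (L z * dy k L z)) := by
  obtain ⟨Fi, hR⟩ := h.relations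
  set g := metricMatrix L z with hg
  set R := riemannCurvature L z with hRdef
  have hy0 : z.1.2 ≠ 0 := z.2.2
  have hgR : ∀ j k, (g * R) j k = 1 / 2 * evalAt z (∑ m, h.coord.dV j (h.coord.dV m (h.fn * h.fn))
      * h.coord.curv h.sprayFn m k) := by
    intro j k
    rw [mul_apply, map_sum, Finset.mul_sum]
    refine Finset.sum_congr rfl fun m _ => ?_
    rw [map_mul, h.evalAt_curv]
    have : evalAt z (h.coord.dV j (h.coord.dV m (h.fn * h.fn))) = 2 * g j m := h.evalAt_hess j m z
    rw [this]
    ring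
  have hsymm : (g * R).IsSymm := by
    ext j k
    rw [transpose_apply, hgR, hgR, hR.hess_curv_symm]
  have hgy : g *ᵥ z.1.2 = fun i => L z * dy i L z := funext fun i => h.metricMatrix_mulVec z i
  have hgs : gᵀ = g := by
    have := (h.posDef _ z.2.1 _ hy0).1
    rwa [IsHermitian, conjTranspose_eq_transpose_of_trivial] at this
  -- Self-adjointness moves the claim to the other index, where `g y` is half the vertical
  -- differential of F² and `curv_dV_sq` applies.
  have hRy : (g * R) *ᵥ z.1.2 = 0 := by
    rw [← hsymm.eq, transpose_mul, ← mulVec_mulVec, hgs, hgy]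
    ext k
    have h1 := congrArg (evalAt z) (hR.curv_dV_sq k)
    rw [map_sum, map_zero] at h1
    have h2 : ∀ m, evalAt z (h.coord.curv h.sprayFn m k * h.coord.dV m (h.fn * h.fn))
        = 2 * (R m k * (L z * dy m L z)) := by
      intro m
      rw [Derivation.leibniz, map_mul, h.evalAt_curv, map_add, smul_eq_mul, map_mul,
        (h.represents_fn.dV m).evalAt_eq, h.represents_fn.evalAt_eq]
      ring
    simp only [h2, ← Finset.mul_sum] at h1
    simpa [mulVec, dotProduct] using h1
  have hyg : z.1.2 ⬝ᵥ g *ᵥ z.1.2 = L z * L z := by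
    rw [hgy]
    have := h.euler z.2.1 hy0
    calc _ = L z * ∑ k, z.1.2 k * dy k L z := by
          rw [dotProduct, Finset.mul_sum]
          exact Finset.sum_congr rfl fun m _ => by ring
      _ = _ := by rw [this]
  have key := eq_of_constant_flag (g := g) (R := R) (K := K) (h.posDef _ z.2.1 _ hy0)
    (y := z.1.2) (fun h0 => hy0 (by ext i; exact congrFun h0 i)) hsymm hRy (fun u hu => ?_)
  · have := congrFun (congrFun key i) k
    rw [this, hyg]
    simp only [Matrix.smul_apply, Matrix.sub_apply, vecMulVec_apply, hgy, smul_eq_mul, one_apply]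
  · have hli : LinearIndependent ℝ ![z.1.2, (WithLp.toLp 2 u : Vec n)] :=
      (LinearIndependent.pair_iff' hy0).2 fun a ha => hu a (by rw [← WithLp.ofLp_smul, ha])
    rw [← hflag _ hli, flagCurvature]
    simp only [metricForm_eq, mulVec_mulVec]
    rfl

end IsLocalFinsler

/-! ### The two fibrewise constants. -/

theorem dirDeriv_exp {W : Type*} [NormedAddCommGroup W] [NormedSpace ℝ W] {Ω : Set W}
    (hΩ : IsOpen Ω) {f g : smoothFun Ω} {h : W → ℝ} (hf : Represents f h)
    (hg : Represents g fun z => Real.exp (h z)) (v : W) :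
    dirDeriv hΩ v g = g * dirDeriv hΩ v f := by
  refine smoothFun_ext fun z => ?_
  rw [map_mul, (hg.dirDeriv hΩ v).evalAt_eq, (hf.dirDeriv hΩ v).evalAt_eq, hg.evalAt_eq,
    fderiv_exp (hf.differentiableAt hΩ z.2)]
  rfl

/-- The final computation of the two fibrewise constants, for one vertical derivation. -/
theorem derivation_fiber_constants {A : Type*} [CommRing A] [Algebra ℝ A] (D : Derivation ℝ A A)
    {n : ℕ} {F Fi κ c c₀ p e τ : A} (hFFi : F * Fi = 1) (hc : D c = 0) (hc₀ : D c₀ = p)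
    (he : (n + 1) * D e = e * (2 * D τ))
    (T1 : F * F * D κ = 3 * (p * F - c₀ * D F))
    (T2 : (n + 1) * (c₀ * D F - p * F) = (c * c * (F * F) - c₀ * F + κ * (F * F)) * D τ) :
    D (κ - 3 * (c₀ * Fi)) = 0 ∧ D ((κ + c ^ 2 - c₀ * Fi) * e) = 0 := by
  have dFi : D Fi = -(Fi * Fi * D F) := by
    have := congrArg D hFFi
    rw [Derivation.leibniz, Derivation.map_one_eq_zero] at this
    simp only [smul_eq_mul] at this
    linear_combination Fi * this - D Fi * hFFi
  have dcF : D (c₀ * Fi) = p * Fi - c₀ * (Fi * Fi * D F) := by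
    rw [Derivation.leibniz, smul_eq_mul, smul_eq_mul, dFi, hc₀]
    ring
  have dκ : D κ = 3 * D (c₀ * Fi) := by
    rw [dcF]
    linear_combination (Fi * Fi) * T1 + (3 * p * Fi - D κ * (F * Fi + 1)) * hFFi
  have h3 : D (3 : A) = 0 := by
    exact_mod_cast D.map_natCast 3
  refine ⟨?_, ?_⟩
  · rw [map_sub, D.leibniz 3, h3, dκ]
    simp
  -- With Q = κ + c² - c₀/F, the first part gives 3 DQ = 2 Dκ, and `hT1` gives (n + 1)Dκ = -3Q Dτ;
  -- together they cancel De. The factor 9(n + 1) clears denominators.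
  · refine natCast_mul_cancel (k := 9 * (n + 1)) (by omega) ?_
    have hT1 : (3 : A) * (n + 1) * D κ = -9 * (κ + c * c - c₀ * Fi) * D τ := by
      linear_combination (3 * (n + 1) * Fi * Fi) * T1 - 9 * Fi * Fi * T2
        + (-3 * (n + 1) * D κ * (F * Fi + 1)
          - 9 * (c * c + κ) * D τ * (F * Fi + 1) + 9 * c₀ * Fi * D τ) * hFFi
    have hl : D ((κ + c ^ 2 - c₀ * Fi) * e)
        = (κ + c ^ 2 - c₀ * Fi) * D e + e * (D κ - D (c₀ * Fi)) := by
      rw [D.leibniz, map_sub, map_add, pow_two, D.leibniz c, hc]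
      simp
    rw [mul_zero, hl]
    push_cast
    linear_combination 9 * (κ + c ^ 2 - c₀ * Fi) * he + 3 * (n + 1) * e * dκ + 2 * e * hT1

namespace IsLocalFinsler

variable {n : ℕ} {U : Set (Vec n)} {L K : Vec n × Vec n → ℝ} {c : Vec n → ℝ}

/-- The two functions of `K`, `c`, `τ` that are constant along the fibres. -/
theorem fiber_constants (h : IsLocalFinsler U L) (hn : 2 ≤ n) (hc : ContDiffOn ℝ ∞ c U)
    (hflag : ∀ z ∈ U ×ˢ ({0}ᶜ : Set (Vec n)), ∀ u : Vec n, LinearIndependent ℝ ![z.2, u] →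
      flagCurvature L z u = K z)
    (hS : ∀ z ∈ U ×ˢ ({0}ᶜ : Set (Vec n)), sCurvature L z = (n + 1) * c z.1 * L z)
    (hJ : ∀ z ∈ U ×ˢ ({0}ᶜ : Set (Vec n)), ∀ i,
      meanLandsberg L i z + c z.1 * L z * meanCartan L i z = 0) :
    ∃ s w : smoothFun (U ×ˢ ({0}ᶜ : Set (Vec n))),
      Represents s (fun z => K z - 3 * fderiv ℝ c z.1 z.2 / L z) ∧
      Represents w (fun z => (K z + c z.1 ^ 2 - fderiv ℝ c z.1 z.2 / L z)
        * Real.exp (2 / (n + 1) * localDistortion L z)) ∧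
      (∀ k, h.coord.dV k s = 0) ∧ ∀ k, h.coord.dV k w = 0 := by
  obtain ⟨Fi, hR⟩ := h.relations
  obtain ⟨τ, v, hτ, hdist⟩ := h.exists_distortion (by omega)
  set F := h.fn with hF
  have hLpos : ∀ z : (U ×ˢ ({0}ᶜ : Set (Vec n)) : Set _), L z ≠ 0 := fun z =>
    (h.pos _ z.2.1 _ z.2.2).ne'
  have hFi : ∀ z, evalAt z Fi = (L z)⁻¹ := fun z => by
    have := congrArg (evalAt z) hR.mul_inv
    rw [map_mul, h.represents_fn.evalAt_eq, map_one] at this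
    exact eq_inv_of_mul_eq_one_right this
  have hn1 : (n : ℝ) - 1 ≠ 0 := by
    have : (2 : ℝ) ≤ n := by exact_mod_cast hn
    linarith
  have hcurv : ∀ (z : (U ×ˢ ({0}ᶜ : Set (Vec n)) : Set _)) i k, riemannCurvature L z i k
      = K z * (L z * L z * (if i = k then 1 else 0) - z.1.2 i * (L z * dy k L z)) :=
    fun z i k => h.riemannCurvature_eq z (hflag z z.2) i k
  -- `K` is not assumed smooth; smoothness follows by recovering it as the curvature trace divided
  -- by (n - 1)F².
  set κ := ((n : ℝ) - 1)⁻¹ • ((∑ m, h.coord.curv h.sprayFn m m) * (Fi * Fi)) with hκdef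
  have hκ : Represents κ K := by
    intro z
    rw [← evalAt_apply, hκdef, evalAt_smul, map_mul, map_mul, map_sum, hFi]
    simp only [h.evalAt_curv, hcurv, if_true, mul_one]
    have e : ∑ m, K z * (L z * L z - z.1.2 m * (L z * dy m L z))
        = n * (K z * (L z * L z)) - K z * L z * ∑ m, z.1.2 m * dy m L z := by
      simp only [mul_sub, Finset.sum_sub_distrib, Finset.sum_const, Finset.card_univ,
        Fintype.card_fin, nsmul_eq_mul, Finset.mul_sum]
      congr 1
      exact Finset.sum_congr rfl fun m _ => by ring
    have heul := h.euler z.2.1 z.2.2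
    rw [Prod.mk.eta] at heul
    rw [e, heul]
    have := hLpos z
    field_simp
  have hκcurv : ∀ i k, h.coord.curv h.sprayFn i k
      = κ * (F * F * (if i = k then 1 else 0) - h.coord.y i * (F * h.coord.dV k F)) := by
    intro i k
    refine smoothFun_ext fun z => ?_
    have hif : evalAt z (if i = k then (1 : smoothFun (U ×ˢ ({0}ᶜ : Set (Vec n)))) else 0)
        = if i = k then 1 else 0 := by
      split_ifs <;> simp
    simp only [h.evalAt_curv, hcurv, map_mul, map_sub, hκ.evalAt_eq, h.represents_fn.evalAt_eq,
      (h.represents_fn.dV k).evalAt_eq, evalAt_y, hif, hF]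
  have hcs : ContDiffOn ℝ ∞ (fun z : Vec n × Vec n => c z.1) (U ×ˢ {0}ᶜ) :=
    hc.comp contDiffOn_fst fun _ hz => hz.1
  set cf := restr _ hcs with hcf
  have hcr : Represents cf fun z => c z.1 := represents_restr hcs
  have hcV : ∀ k, h.coord.dV k cf = 0 := fun k => smoothFun_ext fun z => by
    rw [(hcr.dV k).evalAt_eq, map_zero]
    simp [dy, pd]
  have hSa : h.coord.sprayField h.sprayFn τ = (n + 1) * cf * F := smoothFun_ext fun z => by
    rw [h.evalAt_sprayField_distortion hτ, hS z z.2, map_mul, map_mul, map_add, map_natCast, map_one,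
      hcr.evalAt_eq, h.represents_fn.evalAt_eq]
  have hI : ∀ k, Represents (h.coord.dV k τ) (meanCartan L k) := fun k => hτ.dV k
  have hJa : ∀ k, h.coord.sprayField h.sprayFn (h.coord.dV k τ)
      - ∑ m, h.coord.conn h.sprayFn m k * h.coord.dV m τ = -(cf * F * h.coord.dV k τ) := by
    intro k
    refine smoothFun_ext fun z => ?_
    have := hJ z z.2 k
    rw [meanLandsberg] at this
    rw [map_sub, h.evalAt_sprayField (hI k), map_sum, map_neg, map_mul, map_mul, hcr.evalAt_eq,
      h.represents_fn.evalAt_eq, (hI k).evalAt_eq]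
    simp only [map_mul, (h.represents_conn _ _).evalAt_eq, (hI _).evalAt_eq]
    have e : ∑ m, meanCartan L m z * dy k (spray L m) z
        = ∑ m, dy k (spray L m) z * meanCartan L m z :=
      Finset.sum_congr rfl fun m _ => mul_comm _ _
    rw [e] at this
    linear_combination this
  set c₀ := ∑ m, h.coord.y m * h.coord.dX m cf with hc₀
  have hc₀r : Represents c₀ fun z => fderiv ℝ c z.1 z.2 := by
    intro z
    rw [← evalAt_apply, hc₀, map_sum]
    have e : z.1.2 = ∑ k, z.1.2 k • (EuclideanSpace.single k 1 : Vec n) := by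
      ext j
      simp [Pi.single_apply]
    change _ = fderiv ℝ c z.1.1 z.1.2
    conv_rhs => rw [e, map_sum]
    refine Finset.sum_congr rfl fun m _ => ?_
    rw [map_mul, (hcr.dX m).evalAt_eq, map_smul]
    rfl
  have T1 := fun k => hR.dV_flagCurvature hn hdist hκcurv hcV hSa k
  have T2 := fun k => hR.dV_distortion hdist hκcurv hcV hSa hJa k
  rw [← hc₀] at T1 T2
  have dc₀ : ∀ k, h.coord.dV k c₀ = h.coord.dX k cf := by
    intro k
    have h0 : ∀ m, h.coord.dV k (h.coord.dX m cf) = 0 := fun m => by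
      rw [h.coord.dV_dX, hcV, map_zero]
    simp only [hc₀, map_sum, Derivation.leibniz, h0, h.coord.dV_y]
    simp
  have hes : ContDiffOn ℝ ∞ (fun z => Real.exp (2 / (n + 1) * localDistortion L z))
      (U ×ˢ {0}ᶜ) := (contDiffOn_const.mul hτ.contDiffOn).exp
  set e := restr _ hes with hedef
  have he : ∀ k, (n + 1) * h.coord.dV k e = e * (2 * h.coord.dV k τ) := by
    intro k
    have hr : Represents ((2 / (n + 1) : ℝ) • τ) fun z => 2 / (n + 1) * localDistortion L z :=
      fun z => congrArg ((2 / (n + 1) : ℝ) * ·) (hτ z)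
    have := dirDeriv_exp h.isOpen_slit hr (represents_restr hes) (0, EuclideanSpace.single k 1)
    rw [← hedef, Derivation.map_smul] at this
    change h.coord.dV k e = e * ((2 / (n + 1) : ℝ) • h.coord.dV k τ) at this
    rw [this]
    refine smoothFun_ext fun z => ?_
    simp only [map_mul, evalAt_smul, map_add, map_natCast, map_one, map_ofNat]
    have : (n : ℝ) + 1 ≠ 0 := by positivity
    field_simp
  have key := fun k => derivation_fiber_constants (h.coord.dV k) hR.mul_inv (hcV k) (dc₀ k) (he k)
    (T1 k) (T2 k)
  refine ⟨κ - 3 * (c₀ * Fi), (κ + cf ^ 2 - c₀ * Fi) * e, fun z => ?_, fun z => ?_,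
    fun k => (key k).1, fun k => (key k).2⟩
  · rw [← evalAt_apply, map_sub, map_mul, map_mul, map_ofNat, hκ.evalAt_eq, hc₀r.evalAt_eq, hFi,
      ← mul_assoc, ← div_eq_mul_inv]
  · rw [← evalAt_apply, map_mul, map_sub, map_add, map_mul, map_pow, hκ.evalAt_eq, hc₀r.evalAt_eq,
      hFi, hcr.evalAt_eq, ← div_eq_mul_inv]
    rfl

end IsLocalFinsler

/-! ### Deicke's theorem. -/

namespace FinslerRelations

open Matrix

variable {n : ℕ} {A : Type*} [CommRing A] [Algebra ℝ A] {E : CoordDerivations n A} {F Fi : A}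
  {G : Fin n → A}

theorem map_derivation_mul (D : Derivation ℝ A A) (M N : Matrix (Fin n) (Fin n) A) :
    (M * N).map D = M.map D * N + M * N.map D := by
  ext i j
  simp only [map_apply, mul_apply, map_sum, Derivation.leibniz, Matrix.add_apply, smul_eq_mul,
    Finset.sum_add_distrib]
  rw [add_comm]
  congr 1
  exact Finset.sum_congr rfl fun m _ => mul_comm _ _

theorem map_derivation_inv (D : Derivation ℝ A A) {M : Matrix (Fin n) (Fin n) A}
    (hM : IsUnit M.det) : M⁻¹.map D = -(M⁻¹ * M.map D * M⁻¹) := by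
  have h1 := map_derivation_mul D M⁻¹ M
  have h2 : (1 : Matrix (Fin n) (Fin n) A).map D = 0 := by
    ext i j
    rw [map_apply, one_apply]
    split_ifs <;> simp
  rw [nonsing_inv_mul _ hM, h2] at h1
  have h3 : M⁻¹.map D * M = -(M⁻¹ * M.map D) := eq_neg_of_add_eq_zero_left h1.symm
  rw [← neg_mul, ← h3, Matrix.mul_assoc, mul_nonsing_inv _ hM, Matrix.mul_one]

theorem dV_hess_rotate (i j k : Fin n) : E.dV i (hess E F j k) = E.dV k (hess E F i j) := by
  simp only [hess, of_apply]
  rw [E.dV_comm j k, E.dV_comm i k]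

/-- If the volume form is constant along the fibres, the Laplacian of a diagonal entry of the
fundamental tensor is a square. -/
theorem laplacian_hess (h : FinslerRelations E F Fi G) (hdet : ∀ k, E.dV k (hess E F).det = 0)
    (k : Fin n) :
    ∑ i, E.dV i (∑ j, (hess E F)⁻¹ i j * E.dV j (hess E F k k))
      = ((hess E F)⁻¹ * (hess E F).map (E.dV k) * (hess E F)⁻¹ * (hess E F).map (E.dV k)).trace := by
  set H := hess E F with hH
  set P := H⁻¹ with hP
  have hadj : H.adjugate = H.det • P := by
    have := mul_adjugate H
    have h2 : P * (H * H.adjugate) = P * (H.det • 1) := by rw [this]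
    rwa [← Matrix.mul_assoc, nonsing_inv_mul H h.isUnit_det, Matrix.one_mul, Matrix.mul_smul,
      Matrix.mul_one] at h2
  have t1 : ∀ k, ∑ i, ∑ j, P i j * E.dV k (H j i) = 0 := by
    intro k
    -- Constant determinant means tr(H⁻¹ ∂_k H) = 0, which is vanishing of the mean Cartan torsion.
    have := derivation_det (E.dV k) H
    rw [hdet, hadj] at this
    refine h.isUnit_det.mul_left_cancel ?_
    rw [mul_zero]
    refine Eq.trans ?_ this.symm
    simp only [Finset.mul_sum, Matrix.smul_apply, smul_eq_mul, mul_assoc]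
    rfl
  have hPd : ∀ k, P.map (E.dV k) = -(P * H.map (E.dV k) * P) := fun k =>
    map_derivation_inv (E.dV k) h.isUnit_det
  -- Total symmetry of the third derivatives of F² turns the divergence of the inverse Hessian into
  -- the traces of `t1`; hence the Laplacian has divergence form.
  have t2 : ∀ j, ∑ i, E.dV i (P i j) = 0 := by
    intro j
    have e : ∀ i, E.dV i (P i j) = -∑ b, (∑ a, P i a * E.dV b (H a i)) * P b j := by
      intro i
      have := congrFun (congrFun (hPd i) i) j
      rw [map_apply, Matrix.neg_apply, mul_apply] at this
      rw [this]
      congr 1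
      refine Finset.sum_congr rfl fun b _ => ?_
      rw [mul_apply]
      congr 1
      refine Finset.sum_congr rfl fun a _ => ?_
      rw [map_apply, hH, dV_hess_rotate i a b]
      simp only [hess, of_apply]
      rw [E.dV_comm i a]
    simp only [e]
    rw [Finset.sum_neg_distrib, Finset.sum_comm, neg_eq_zero]
    refine Finset.sum_eq_zero fun b _ => ?_
    rw [← Finset.sum_mul, t1, zero_mul]
  have e1 : ∑ i, E.dV i (∑ j, P i j * E.dV j (H k k)) = ∑ i, ∑ j, P i j * E.dV i (E.dV j (H k k)) := by
    have : ∀ i, E.dV i (∑ j, P i j * E.dV j (H k k)) = ∑ j, P i j * E.dV i (E.dV j (H k k))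
        + ∑ j, E.dV j (H k k) * E.dV i (P i j) := by
      intro i
      simp only [map_sum, Derivation.leibniz, smul_eq_mul, Finset.sum_add_distrib]
    simp only [this, Finset.sum_add_distrib]
    rw [Finset.sum_comm (f := fun i j => E.dV j (H k k) * E.dV i (P i j))]
    simp only [← Finset.mul_sum, t2, mul_zero, Finset.sum_const_zero, add_zero]
  -- Fourth derivatives of F² are symmetric, so the Laplacian of H_kk becomes P contracted with
  -- ∂_k∂_k H, which the derivative of `t1` computes.
  have e2 : ∑ i, ∑ j, P i j * E.dV i (E.dV j (H k k)) = ∑ i, ∑ j, P i j * E.dV k (E.dV k (H j i)) := by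
    refine Finset.sum_congr rfl fun i _ => Finset.sum_congr rfl fun j _ => ?_
    simp only [hH, hess, of_apply]
    rw [E.dV_comm j k, E.dV_comm i k, E.dV_comm j k, E.dV_comm i k, E.dV_comm i j]
  have e3 := congrArg (E.dV k) (t1 k)
  rw [map_zero] at e3
  have e4 : E.dV k (∑ i, ∑ j, P i j * E.dV k (H j i))
      = ∑ i, ∑ j, P i j * E.dV k (E.dV k (H j i))
        + ∑ i, ∑ j, P.map (E.dV k) i j * (H.map (E.dV k)) j i := by
    simp only [map_sum, Derivation.leibniz, smul_eq_mul, Finset.sum_add_distrib, map_apply]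
    congr 1
    exact Finset.sum_congr rfl fun i _ => Finset.sum_congr rfl fun j _ => mul_comm _ _
  have e5 : ∑ i, ∑ j, P.map (E.dV k) i j * (H.map (E.dV k)) j i
      = -(P * H.map (E.dV k) * P * H.map (E.dV k)).trace := by
    have key : ∀ X Y : Matrix (Fin n) (Fin n) A, ∑ i, ∑ j, X i j * Y j i = (X * Y).trace :=
      fun X Y => by simp only [trace, diag_apply, mul_apply]
    rw [key, hPd, Matrix.neg_mul, trace_neg]
  rw [e1, e2]
  rw [e4, e5] at e3
  linear_combination e3

/-- The fundamental tensor identifies `dF` with the radial direction. -/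
theorem hess_inv_dV (h : FinslerRelations E F Fi G) (f : A) :
    2 * (F * ∑ i, E.dV i F * ∑ j, (hess E F)⁻¹ i j * E.dV j f) = ∑ j, E.y j * E.dV j f := by
  set H := hess E F with hH
  set P := H⁻¹ with hP
  have hHs : Hᵀ = H := by
    ext i j
    exact E.dV_comm j i _
  have hPs : Pᵀ = P := by
    rw [hP, transpose_nonsing_inv, hHs]
  have h1 : H *ᵥ E.y = fun i => 2 * (F * E.dV i F) := by
    ext i
    have h0 : E.dV i (F * F) = 2 * (F * E.dV i F) := by
      rw [Derivation.leibniz, smul_eq_mul]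
      ring
    rw [← h0, ← h.euler_dV_sq i, mulVec, dotProduct]
    refine Finset.sum_congr rfl fun m _ => ?_
    rw [hH, hess, of_apply, E.dV_comm i m]
    exact mul_comm _ _
  have h2 : E.y = P *ᵥ fun i => 2 * (F * E.dV i F) := by
    rw [← h1, mulVec_mulVec, nonsing_inv_mul H h.isUnit_det, one_mulVec]
  have h3 : ∀ j, E.y j = ∑ i, P i j * (2 * (F * E.dV i F)) := by
    intro j
    rw [h2, mulVec, dotProduct]
    refine Finset.sum_congr rfl fun i _ => ?_
    rw [← hPs, transpose_apply, hPs]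
  simp only [h3, Finset.mul_sum, Finset.sum_mul]
  rw [Finset.sum_comm]
  exact Finset.sum_congr rfl fun j _ => Finset.sum_congr rfl fun i _ => by ring

end FinslerRelations

section Trace

open Matrix

variable {n : ℕ}

open scoped MatrixOrder in
-- Factoring p = BᵀB with `B` invertible turns the trace into the squared Hilbert–Schmidt norm of
-- the symmetric matrix B m Bᵀ.
theorem trace_square_nonneg {p m : Matrix (Fin n) (Fin n) ℝ} (hp : p.PosDef) (hm : m.IsSymm) :
    0 ≤ (p * m * p * m).trace ∧ ((p * m * p * m).trace = 0 → m = 0) := by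
  obtain ⟨B, hB⟩ := CStarAlgebra.nonneg_iff_eq_star_mul_self.1 hp.posSemidef.nonneg
  rw [star_eq_conjTranspose, conjTranspose_eq_transpose_of_trivial] at hB
  have hBdet : IsUnit B.det := by
    have h1 := hp.det_pos
    rw [hB, det_mul, det_transpose] at h1
    exact (left_ne_zero_of_mul h1.ne').isUnit
  set N := B * m * Bᵀ with hN
  have hNs : Nᵀ = N := by
    rw [hN, transpose_mul, transpose_mul, transpose_transpose, hm.eq, Matrix.mul_assoc]
  have htr : (p * m * p * m).trace = (Nᵀ * N).trace := by
    rw [hNs, hB, hN, trace_mul_comm (B * m * Bᵀ) (B * m * Bᵀ)]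
    calc _ = (Bᵀ * (B * m * Bᵀ * B * m)).trace := by simp only [Matrix.mul_assoc]
      _ = ((B * m * Bᵀ * B * m) * Bᵀ).trace := trace_mul_comm _ _
      _ = _ := by simp only [Matrix.mul_assoc]
  have hsum : (Nᵀ * N).trace = ∑ i, ∑ j, N j i ^ 2 := by
    simp only [trace, diag_apply, mul_apply, transpose_apply, sq]
  refine ⟨?_, fun h0 => ?_⟩
  · rw [htr, hsum]
    exact Finset.sum_nonneg fun i _ => Finset.sum_nonneg fun j _ => sq_nonneg _
  · have hN0 : N = 0 := by
      rw [htr, ← conjTranspose_eq_transpose_of_trivial, trace_conjTranspose_mul_self_eq_zero_iff]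
        at h0
      exact h0
    have hBt : IsUnit Bᵀ.det := by rwa [det_transpose]
    have h2 : B⁻¹ * N * Bᵀ⁻¹ = m := by
      rw [hN, Matrix.mul_assoc B, nonsing_inv_mul_cancel_left _ _ hBdet,
        mul_nonsing_inv_cancel_right _ _ hBt]
    rw [← h2, hN0, Matrix.mul_zero, Matrix.zero_mul]

end Trace

section Deicke

open Matrix

variable {n : ℕ} {f : Vec n → ℝ}

theorem integral_pd_eq_zero {g : Vec n → ℝ} (hg : ContDiff ℝ 1 g) (hs : HasCompactSupport g)
    (i : Fin n) : Integrable (pd i g) ∧ ∫ y, pd i g y = 0 := by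
  have hc : Continuous (pd i g) := (hg.continuous_fderiv (by simp)).clm_apply continuous_const
  have hs' : HasCompactSupport (pd i g) := hs.fderiv_apply (𝕜 := ℝ) _
  have hint := hc.integrable_of_hasCompactSupport (μ := volume) hs'
  refine ⟨hint, ?_⟩
  have hint' : Integrable fun y => fderiv ℝ g y (EuclideanSpace.single i 1) := hint
  have := integral_mul_fderiv_eq_neg_fderiv_mul_of_integrable (μ := volume)
    (f := fun _ : Vec n => (1 : ℝ)) (g := g) (v := EuclideanSpace.single i 1)
    (by simp) (by simpa using hint')
    (by simpa using hg.continuous.integrable_of_hasCompactSupport hs)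
    (fun _ _ => differentiableAt_const _) (fun x _ => hg.differentiable (by simp) x)
  have h0 : ∫ y, fderiv ℝ g y (EuclideanSpace.single i 1) = 0 := by simpa using this
  exact h0

/-- A Minkowski norm as a Finsler metric on `ℝⁿ` that is independent of the base point. -/
theorem isLocalFinsler_of_fiber (hs : ContDiffOn ℝ ∞ f {0}ᶜ) (hpos : ∀ y, y ≠ 0 → 0 < f y)
    (hhom : ∀ (y : Vec n) (a : ℝ), 0 < a → f (a • y) = a * f y)
    (hpd : ∀ y, y ≠ 0 → (gram f y).PosDef) :
    IsLocalFinsler Set.univ fun z : Vec n × Vec n => f z.2 where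
  isOpen := isOpen_univ
  smooth := hs.comp contDiffOn_snd fun _ hz => hz.2
  pos _ _ := hpos
  homog _ _ := hhom
  posDef _ _ := hpd

/-- A nonzero vector at the origin. -/
def slitPoint (y : Vec n) (hy : y ≠ 0) :
    (Set.univ ×ˢ ({0}ᶜ : Set (Vec n)) : Set (Vec n × Vec n)) :=
  ⟨(0, y), trivial, hy⟩

namespace IsLocalFinsler

variable {U : Set (Vec n)} {L : Vec n × Vec n → ℝ}

theorem posDef_inv_hess (h : IsLocalFinsler U L) (z) :
    ((evalAt z).mapMatrix h.hess⁻¹).PosDef := by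
  have h1 := (h.posDef _ z.2.1 _ z.2.2).inv
  have h2 := h.inv_metricMatrix z
  have h3 : (evalAt z).mapMatrix h.hess⁻¹ = (1 / 2 : ℝ) • (metricMatrix L z)⁻¹ := by
    rw [h2, smul_smul]
    norm_num
  rw [h3]
  exact h1.smul (by norm_num)

/-- The divergence of the radial cut-off of the gradient of a diagonal entry of the fundamental
tensor. -/
theorem divergence_cutoff (h : IsLocalFinsler U L) (hdet : ∀ k, h.coord.dV k h.hess.det = 0)
    {φ : ℝ → ℝ} (hφ : ContDiff ℝ ∞ φ) (k : Fin n)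
    {Φ : smoothFun (U ×ˢ ({0}ᶜ : Set (Vec n)))} (hΦ : Represents Φ fun z => φ (L z)) :
    ∑ i, h.coord.dV i (Φ * ∑ j, h.hess⁻¹ i j * h.coord.dV j (h.hess k k))
      = Φ * (h.hess⁻¹ * h.hess.map (h.coord.dV k) * h.hess⁻¹ * h.hess.map (h.coord.dV k)).trace := by
  obtain ⟨Fi, hR⟩ := h.relations
  have hφ' : ContDiffOn ℝ ∞ (fun z => deriv φ (L z)) (U ×ˢ {0}ᶜ) :=
    ((contDiff_infty_iff_deriv.1 hφ).2).comp_contDiffOn h.smooth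
  set Φ' := restr _ hφ' with hΦ'
  have hd : ∀ i, h.coord.dV i Φ = Φ' * h.coord.dV i h.fn := by
    intro i
    refine smoothFun_ext fun z => ?_
    rw [map_mul]
    refine ((hΦ.dirDeriv h.isOpen_slit _).evalAt_eq z).trans (Eq.trans ?_ (congrArg _
      ((h.represents_fn.dirDeriv h.isOpen_slit _).evalAt_eq z)).symm)
    beta_reduce
    have h1 := h.represents_fn.differentiableAt h.isOpen_slit z.2
    have h2 : DifferentiableAt ℝ φ (L z) := hφ.differentiable (by simp) _
    have h3 := h2.hasDerivAt.comp_hasFDerivAt z.1 h1.hasFDerivAt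
    have h4 : fderiv ℝ (fun z => φ (L z)) z = deriv φ (L z) • fderiv ℝ L z := h3.fderiv
    rw [h4]
    rfl
  -- The cut-off contributes φ′(F) times the pairing of dF with the gradient of H_kk. That pairing
  -- is a radial derivative up to a factor, and H_kk is homogeneous of degree zero.
  have h0 : ∑ i, h.coord.dV i h.fn * ∑ j, h.hess⁻¹ i j * h.coord.dV j (h.hess k k) = 0 := by
    have h1 := hR.hess_inv_dV (h.hess k k)
    rw [hR.euler_hess] at h1
    have h2 := FinslerRelations.two_cancel (h1.trans (mul_zero 2).symm)
    have h3 := congrArg (Fi * ·) h2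
    simp only [mul_zero, ← mul_assoc] at h3
    rwa [mul_comm Fi, hR.mul_inv, one_mul] at h3
  rw [← hR.laplacian_hess hdet k, Finset.mul_sum, ← add_zero (∑ i, Φ * _),
    ← mul_zero Φ', ← h0, Finset.mul_sum, ← Finset.sum_add_distrib]
  refine Finset.sum_congr rfl fun i _ => ?_
  rw [(h.coord.dV i).leibniz Φ, hd, smul_eq_mul, smul_eq_mul]
  ring

end IsLocalFinsler

/-- Deicke's theorem: a Minkowski norm with constant `det g_ij` is Euclidean. -/
theorem gram_eq_of_det_eq (hn : 2 ≤ n) (hs : ContDiffOn ℝ ∞ f {0}ᶜ)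
    (hpos : ∀ y, y ≠ 0 → 0 < f y)
    (hhom : ∀ (y : Vec n) (a : ℝ), 0 < a → f (a • y) = a * f y)
    (hpd : ∀ y, y ≠ 0 → (gram f y).PosDef)
    (hdet : ∀ y y', y ≠ 0 → y' ≠ 0 → (gram f y).det = (gram f y').det) {y y' : Vec n}
    (hy : y ≠ 0) (hy' : y' ≠ 0) : gram f y = gram f y' := by
  have h := isLocalFinsler_of_fiber hs hpos hhom hpd
  have hdet0 : ∀ k, h.coord.dV k h.hess.det = 0 := by
    intro k
    have hr : Represents h.hess.det fun _ => 2 ^ n * (gram f y).det := fun z => by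
      rw [← evalAt_apply, h.evalAt_det, hdet y z.1.2 hy z.2.2]
      rfl
    refine smoothFun_ext fun z => ?_
    rw [(hr.dV k).evalAt_eq, map_zero]
    simp [dy, pd]
  have hg : IsGauge f := ⟨hs.continuousOn, hpos, hhom⟩
  have key : ∀ (y₀ : Vec n) (hy₀ : y₀ ≠ 0) (k : Fin n),
      (evalAt (slitPoint y₀ hy₀)).mapMatrix (h.hess.map (h.coord.dV k))
        = 0 := by
    intro y₀ hy₀ k
    set tr := (h.hess⁻¹ * h.hess.map (h.coord.dV k) * h.hess⁻¹ * h.hess.map (h.coord.dV k)).trace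
      with htr
    have hmap : ∀ z, evalAt z tr = ((evalAt z).mapMatrix h.hess⁻¹
        * (evalAt z).mapMatrix (h.hess.map (h.coord.dV k)) * (evalAt z).mapMatrix h.hess⁻¹
        * (evalAt z).mapMatrix (h.hess.map (h.coord.dV k))).trace := fun z => by
      rw [htr, ← map_mul, ← map_mul, ← map_mul, RingHom.mapMatrix_apply]
      exact AddMonoidHom.map_trace (evalAt z) _
    have hsymm : ∀ z, ((evalAt z).mapMatrix (h.hess.map (h.coord.dV k))).IsSymm := fun z => by
      ext i j
      change evalAt z (h.coord.dV k (h.coord.dV j (h.coord.dV i _)))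
        = evalAt z (h.coord.dV k (h.coord.dV i (h.coord.dV j _)))
      rw [h.coord.dV_comm j i]
    have hq := fun z => trace_square_nonneg (h.posDef_inv_hess z) (hsymm z)
    simp only [← hmap] at hq
    refine (hq _).2 ?_
    have ha := hpos y₀ hy₀
    -- Equal to 1 at `f y₀` and zero for values below `f y₀ / 2` and above `2 * f y₀`, so the
    -- cut-off field is smooth across the origin and compactly supported.
    let φ : ContDiffBump (f y₀) := ⟨f y₀ / 4, f y₀ / 2, by linarith, by linarith⟩
    have hφ : ContDiff ℝ ∞ φ := φ.contDiff
    have hφ0 : ∀ t < f y₀ / 2, φ t = 0 := fun t ht => φ.zero_of_le_dist (by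
      rw [Real.dist_eq, abs_of_neg (by linarith)]
      change f y₀ / 2 ≤ _
      linarith)
    have hφ2 : ∀ t, 2 * f y₀ ≤ t → φ t = 0 := fun t ht => φ.zero_of_le_dist (by
      rw [Real.dist_eq, abs_of_pos (by linarith)]
      change f y₀ / 2 ≤ _
      linarith)
    have hφs : ContDiffOn ℝ ∞ (fun z : Vec n × Vec n => φ (f z.2)) (Set.univ ×ˢ {0}ᶜ) :=
      hφ.comp_contDiffOn h.smooth
    set Φ := restr _ hφs with hΦ
    have hΦr : Represents Φ fun z => φ (f z.2) := represents_restr hφs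
    have hdiv := h.divergence_cutoff hdet0 hφ k hΦr
    set W := fun i => ∑ j, h.hess⁻¹ i j * h.coord.dV j (h.hess k k) with hW
    set g : Fin n → Vec n → ℝ := fun i w => φ (f w) * extend (W i) (0, w) with hgdef
    have hgr : ∀ i, Represents (Φ * W i) fun z => φ (f z.2) * extend (W i) z := fun i z =>
      congrArg₂ (· * ·) (hΦr z) (represents_extend (W i) z)
    have hg0 : ∀ i, g i =ᶠ[𝓝 0] fun _ => 0 := by
      intro i
      have ho : IsOpen {w | f w < f y₀ / 2} := isOpen_lt hg.continuous continuous_const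
      filter_upwards [ho.mem_nhds (by rw [Set.mem_ofPred_eq, hg.zero]; linarith)] with w hw
      rw [hgdef]
      simp only [hφ0 _ hw, zero_mul]
    have hgc : ∀ i, ContDiff ℝ 1 (g i) := by
      intro i
      rw [contDiff_iff_contDiffAt]
      intro w
      by_cases hw : w = 0
      · rw [hw]
        exact contDiffAt_const.congr_of_eventuallyEq (hg0 i)
      · have h1 := (hgr i).contDiffOn.contDiffAt
          (h.isOpen_slit.mem_nhds (x := ((0 : Vec n), w)) ⟨trivial, hw⟩)
        exact (h1.comp w (f := fun w : Vec n => ((0 : Vec n), w)) (by fun_prop)).of_le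
          (by norm_cast)
    obtain ⟨lo, _, hlo, -, hbd⟩ := hg.exists_bounds
    have hgs : ∀ i, HasCompactSupport (g i) := by
      intro i
      refine HasCompactSupport.intro (isCompact_closedBall (0 : Vec n) (2 * f y₀ / lo))
        fun w hw => ?_
      have h1 : 2 * f y₀ / lo < ‖w‖ := by simpa using hw
      rw [div_lt_iff₀ hlo] at h1
      rw [hgdef]
      simp only [hφ2 (f w) (by linarith [(hbd w).1, mul_comm lo ‖w‖]), zero_mul]
    set D : Vec n → ℝ := fun w => ∑ i, pd i (g i) w with hD
    have hDint : ∫ w, D w = 0 := by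
      rw [hD, integral_finsetSum _ fun i _ => (integral_pd_eq_zero (hgc i) (hgs i) i).1]
      exact Finset.sum_eq_zero fun i _ => (integral_pd_eq_zero (hgc i) (hgs i) i).2
    have hDcont : Continuous D := continuous_finsetSum _ fun i _ =>
      ((hgc i).continuous_fderiv (by simp)).clm_apply continuous_const
    have hDval : ∀ (w : Vec n) (hw : w ≠ 0), D w
        = φ (f w) * evalAt (slitPoint w hw) tr := by
      intro w hw
      have h1 := congrArg (evalAt (slitPoint w hw)) hdiv
      rw [map_sum, map_mul, hΦr.evalAt_eq] at h1
      refine Eq.trans ?_ h1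
      exact Finset.sum_congr rfl fun i _ => (evalAt_dV (hΩ := h.isOpen_slit) (hgr i) i (slitPoint w hw)).symm
    have hD0 : D 0 = 0 := by
      refine Finset.sum_eq_zero fun i _ => ?_
      rw [pd, (hg0 i).fderiv_eq]
      simp
    have hDnn : ∀ w, 0 ≤ D w := by
      intro w
      by_cases hw : w = 0
      · rw [hw, hD0]
      · rw [hDval w hw]
        exact mul_nonneg φ.nonneg (hq _).1
    have hDs : HasCompactSupport D := by
      refine HasCompactSupport.intro (isCompact_closedBall (0 : Vec n) (2 * f y₀ / lo))
        fun w hw => ?_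
      have h1 : 2 * f y₀ / lo < ‖w‖ := by simpa using hw
      have h2 : w ≠ 0 := norm_pos_iff.1 (lt_of_le_of_lt (by positivity) h1)
      rw [div_lt_iff₀ hlo] at h1
      rw [hDval w h2, hφ2 (f w) (by linarith [(hbd w).1, mul_comm lo ‖w‖]), zero_mul]
    -- The divergence `D` is continuous, nonnegative and of integral zero; a nonzero trace at `y₀`
    -- would make the integral positive.
    by_contra hne
    have hpos' := hDcont.integral_pos_of_hasCompactSupport_nonneg_nonzero (μ := volume) hDs hDnn
      (x := y₀) (by
        rw [hDval y₀ hy₀, φ.one_of_mem_closedBall (by simp [φ.rIn_pos.le]), one_mul]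
        exact hne)
    exact hpos'.ne' hDint
  ext i j
  have hr := h.represents_hess i j
  have hz : ∀ (w : Vec n) (hw : w ≠ 0), gram f w i j = 1 / 2 * dy i (dy j fun w => f w.2 ^ 2) (0, w) :=
    fun w hw => rfl
  rw [hz y hy, hz y' hy']
  congr 1
  refine mem_compl_zero_constant hn (f := fun w => dy i (dy j fun w => f w.2 ^ 2) (0, w))
    (fun w hw => ?_) (fun w hw k => ?_) hy hy'
  · exact (hr.differentiableAt h.isOpen_slit (z := (0, w)) ⟨trivial, hw⟩).comp w (by fun_prop)
  · have h1 := (hr.dV (hΩ := h.isOpen_slit) k).evalAt_eq (slitPoint w hw)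
    have h2 := congrFun (congrFun (key w hw k) i) j
    exact h1.symm.trans h2

end Deicke

/-! ### Linear changes of fibre coordinates. -/

section LinearChange

open Matrix

variable {n : ℕ} {f : Vec n → ℝ}

/-- The matrix of a linear map in the standard basis. -/
def stdMatrix (A : Vec n →L[ℝ] Vec n) : Matrix (Fin n) (Fin n) ℝ :=
  of fun i j => A (EuclideanSpace.single j 1) i

theorem det_stdMatrix (A : Vec n →L[ℝ] Vec n) :
    (stdMatrix A).det = LinearMap.det (A : Vec n →ₗ[ℝ] Vec n) := by
  rw [← LinearMap.det_toMatrix (EuclideanSpace.basisFun (Fin n) ℝ).toBasis]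
  congr 1

theorem pd_comp_linear {g : Vec n → ℝ} (A : Vec n →L[ℝ] Vec n) {y : Vec n}
    (hg : DifferentiableAt ℝ g (A y)) (j : Fin n) :
    pd j (fun w => g (A w)) y = ∑ m, stdMatrix A m j * pd m g (A y) := by
  have h1 := hg.hasFDerivAt.comp y A.hasFDerivAt
  have h2 : fderiv ℝ (fun w => g (A w)) y = (fderiv ℝ g (A y)).comp A := h1.fderiv
  rw [pd, h2, ContinuousLinearMap.comp_apply]
  have : A (EuclideanSpace.single j 1)
      = ∑ m, A (EuclideanSpace.single j 1) m • (EuclideanSpace.single m 1 : Vec n) := by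
    ext i
    simp [Pi.single_apply]
  rw [this, map_sum]
  exact Finset.sum_congr rfl fun m _ => by rw [map_smul]; rfl

theorem gram_comp_linear (hs : ContDiffOn ℝ ∞ f {0}ᶜ) (A : Vec n →L[ℝ] Vec n) {y : Vec n}
    (hy : A y ≠ 0) :
    gram (fun w => f (A w)) y = (stdMatrix A)ᵀ * gram f (A y) * stdMatrix A := by
  have hsq : ContDiffOn ℝ ∞ (fun w => f w ^ 2) {0}ᶜ := hs.pow 2
  have hd : ∀ w, w ≠ 0 → DifferentiableAt ℝ (fun w => f w ^ 2) w := fun w hw =>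
    (hsq.contDiffAt (isOpen_compl_singleton.mem_nhds hw)).differentiableAt (by simp)
  have hd2 : ∀ m, DifferentiableAt ℝ (pd m fun w => f w ^ 2) (A y) := fun m =>
    ((contDiffOn_fderiv_apply isOpen_compl_singleton hsq _).contDiffAt
      (isOpen_compl_singleton.mem_nhds hy)).differentiableAt (by simp)
  ext i j
  have hev : (pd j fun w => f (A w) ^ 2)
      =ᶠ[𝓝 y] fun w => ∑ m, stdMatrix A m j * pd m (fun w => f w ^ 2) (A w) := by
    have ho : IsOpen {w | A w ≠ 0} := isOpen_ne_fun A.continuous continuous_const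
    filter_upwards [ho.mem_nhds hy] with w hw
    exact pd_comp_linear (g := fun w => f w ^ 2) A (hd _ hw) j
  have h1 : pd i (pd j fun w => f (A w) ^ 2) y
      = ∑ m, stdMatrix A m j * ∑ l, stdMatrix A l i * pd l (pd m fun w => f w ^ 2) (A y) := by
    have hc : ∀ m, DifferentiableAt ℝ (fun w => pd m (fun w => f w ^ 2) (A w)) y := fun m =>
      (hd2 m).comp y A.differentiableAt
    rw [pd, hev.fderiv_eq, fderiv_fun_sum fun m _ => (hc m).const_mul _,
      _root_.sum_apply]
    refine Finset.sum_congr rfl fun m _ => ?_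
    rw [fderiv_const_mul (hc m), ← pd_comp_linear A (hd2 m)]
    rfl
  rw [gram, of_apply, h1, mul_apply, Finset.mul_sum]
  refine Finset.sum_congr rfl fun m _ => ?_
  rw [mul_apply, Finset.sum_mul, Finset.mul_sum, Finset.mul_sum]
  refine Finset.sum_congr rfl fun l _ => ?_
  rw [gram, of_apply, transpose_apply]
  ring

theorem isUnit_det_stdMatrix {A B : Vec n →L[ℝ] Vec n} (hBA : ∀ y, B (A y) = y) :
    (stdMatrix A).det ≠ 0 := by
  rw [det_stdMatrix]
  intro h0
  have h1 : (B : Vec n →ₗ[ℝ] Vec n) ∘ₗ (A : Vec n →ₗ[ℝ] Vec n) = LinearMap.id :=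
    LinearMap.ext hBA
  have h2 := congrArg LinearMap.det h1
  rw [LinearMap.det_comp, h0, mul_zero, LinearMap.det_id] at h2
  exact zero_ne_one h2

theorem posDef_gram_comp_linear (hs : ContDiffOn ℝ ∞ f {0}ᶜ) {A B : Vec n →L[ℝ] Vec n}
    (hBA : ∀ y, B (A y) = y) {y : Vec n} (hy : A y ≠ 0) (hpd : (gram f (A y)).PosDef) :
    (gram (fun w => f (A w)) y).PosDef := by
  rw [gram_comp_linear hs A hy, ← conjTranspose_eq_transpose_of_trivial]
  exact hpd.conjTranspose_mul_mul_same
    (mulVec_injective_iff_isUnit.2 ((isUnit_iff_isUnit_det _).2 (isUnit_det_stdMatrix hBA).isUnit))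

/-- The distortion does not depend on the linear coordinates. -/
theorem fiberDistortion_comp_linear (hs : ContDiffOn ℝ ∞ f {0}ᶜ) {A B : Vec n →L[ℝ] Vec n}
    (hBA : ∀ y, B (A y) = y) {y : Vec n} (hy : A y ≠ 0) :
    fiberDistortion (fun w => f (A w)) y = fiberDistortion f (A y) := by
  have hM := isUnit_det_stdMatrix hBA
  have hvol : (volume : Measure (Vec n)).real {w | f (A w) < 1}
      = |(stdMatrix A).det|⁻¹ * (volume : Measure (Vec n)).real {w | f w < 1} := by
    have h1 := Measure.addHaar_preimage_linearMap (volume : Measure (Vec n))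
      (f := (A : Vec n →ₗ[ℝ] Vec n)) (by rwa [← det_stdMatrix]) {w | f w < 1}
    rw [← det_stdMatrix] at h1
    have h2 := congrArg ENNReal.toReal h1
    rw [ENNReal.toReal_mul, ENNReal.toReal_ofReal (abs_nonneg _), abs_inv] at h2
    exact h2
  rw [fiberDistortion, fiberDistortion, hvol, gram_comp_linear hs A hy, det_mul, det_mul,
    det_transpose]
  congr 1
  have h3 : √((stdMatrix A).det * (gram f (A y)).det * (stdMatrix A).det)
      = |(stdMatrix A).det| * √((gram f (A y)).det) := by
    rw [mul_right_comm, ← sq, Real.sqrt_mul (sq_nonneg _), Real.sqrt_sq_eq_abs]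
  rw [h3]
  have := abs_ne_zero.2 hM
  field_simp

end LinearChange

/-! ### From charts to the manifold. -/

section Manifold

theorem contMDiff_of_charts {n : ℕ} {M : Type*} [TopologicalSpace M] [ChartedSpace (Vec n) M]
    {σ : M → ℝ} (h : ∀ p : M, ContDiffOn ℝ ∞
    (fun a => σ ((extChartAt (𝓡 n) p).symm a)) (extChartAt (𝓡 n) p).target) :
    ContMDiff (𝓡 n) 𝓘(ℝ, ℝ) ∞ σ := by
  intro p
  have h1 : ContMDiffOn 𝓘(ℝ, Vec n) 𝓘(ℝ, ℝ) ∞ (fun a => σ ((extChartAt (𝓡 n) p).symm a))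
      (extChartAt (𝓡 n) p).target := contMDiffOn_iff_contDiffOn.2 (h p)
  have h2 := (h1.contMDiffAt ((isOpen_extChartAt_target p).mem_nhds (mem_extChartAt_target p))).comp
    p (contMDiffAt_extChartAt (I := 𝓡 n) (n := ∞) (x := p))
  refine h2.congr_of_eventuallyEq ?_
  filter_upwards [extChartAt_source_mem_nhds (I := 𝓡 n) p] with q hq
  simp only [Function.comp, (extChartAt (𝓡 n) p).left_inv hq]

variable {n : ℕ} {M : Type*} [TopologicalSpace M] [ChartedSpace (Vec n) M] [IsManifold (𝓡 n) ∞ M]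

/-- The linear map sending the components `yⁱ` at the point with coordinates `a` in the chart around
`p` to the tangent vector `yⁱ ∂/∂xⁱ`. -/
def chartMap (p : M) (a : Vec n) : Vec n →L[ℝ] Vec n :=
  (trivializationAt (Vec n) (TangentSpace (𝓡 n)) p).symmL ℝ ((extChartAt (𝓡 n) p).symm a)

/-- The inverse of `chartMap`. -/
def chartMapInv (p : M) (a : Vec n) : Vec n →L[ℝ] Vec n :=
  (trivializationAt (Vec n) (TangentSpace (𝓡 n)) p).continuousLinearMapAt ℝ
    ((extChartAt (𝓡 n) p).symm a)

theorem mem_baseSet {p : M} {a : Vec n} (ha : a ∈ (extChartAt (𝓡 n) p).target) :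
    (extChartAt (𝓡 n) p).symm a
      ∈ (trivializationAt (Vec n) (TangentSpace (𝓡 n)) p).baseSet := by
  rw [TangentBundle.trivializationAt_baseSet, ← extChartAt_source (𝓡 n)]
  exact (extChartAt (𝓡 n) p).map_target ha

theorem chartMapInv_chartMap {p : M} {a : Vec n} (ha : a ∈ (extChartAt (𝓡 n) p).target)
    (y : Vec n) : chartMapInv p a (chartMap p a y) = y :=
  Bundle.Trivialization.continuousLinearMapAt_symmL _ (mem_baseSet ha) y

theorem chartMap_ne_zero {p : M} {a : Vec n} (ha : a ∈ (extChartAt (𝓡 n) p).target) {y : Vec n}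
    (hy : y ≠ 0) : chartMap p a y ≠ 0 := fun h => by
  have := chartMapInv_chartMap ha y
  rw [h, map_zero] at this
  exact hy this.symm

/-- The bundle chart is the base chart combined with a linear isomorphism of fibres. Coordinate
statements thus reduce to linear changes of `fiber F`. -/
theorem tangentCoord_eq {p : M} {a : Vec n} (ha : a ∈ (extChartAt (𝓡 n) p).target) (y : Vec n) :
    tangentCoord p (a, y) = ⟨(extChartAt (𝓡 n) p).symm a, chartMap p a y⟩ := by
  have hx := mem_baseSet ha
  have h1 : chartMap p a y
      = (trivializationAt (Vec n) (TangentSpace (𝓡 n)) p).symm ((extChartAt (𝓡 n) p).symm a) y :=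
    Bundle.Trivialization.symmL_apply _ hx y
  rw [tangentCoord, FiberBundle.extChartAt, h1]
  exact (Bundle.Trivialization.mk_symm _ hx y).symm

/-- At the centre of its own chart the trivialization is the identity on the fibre, so intrinsic
statements at `p` can be read off without a linear change. -/
theorem tangentCoord_self (p : M) (y : Vec n) :
    tangentCoord p (extChartAt (𝓡 n) p p, y) = ⟨p, y⟩ := by
  have h1 : extChartAt (𝓡 n).tangent (⟨p, 0⟩ : TangentBundle (𝓡 n) M) ⟨p, y⟩
      = (extChartAt (𝓡 n) p p, y) := by
    rw [FiberBundle.extChartAt]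
    have h2 : (trivializationAt (Vec n) (TangentSpace (𝓡 n)) p) (⟨p, y⟩ : TangentBundle (𝓡 n) M)
        = (p, y) := by
      rw [TangentBundle.trivializationAt_apply]
      refine Prod.ext rfl ?_
      have := tangentCoordChange_self (I := 𝓡 n) (x := p) (z := p) (v := y) (mem_extChartAt_source p)
      rw [tangentCoordChange_def] at this
      exact this
    change ((extChartAt (𝓡 n) p).prod (PartialEquiv.refl (Vec n)))
      ((trivializationAt (Vec n) (TangentSpace (𝓡 n)) p) (⟨p, y⟩ : TangentBundle (𝓡 n) M)) = _
    rw [h2]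
    rfl
  rw [tangentCoord, ← h1]
  refine (extChartAt (𝓡 n).tangent _).left_inv ?_
  rw [extChartAt_source, TangentBundle.mem_chart_source_iff]
  exact mem_chart_source _ p

variable {F : TangentBundle (𝓡 n) M → ℝ}

theorem loc_eq {p : M} {a : Vec n} (ha : a ∈ (extChartAt (𝓡 n) p).target) (y : Vec n) :
    loc F p (a, y) = fiber F ((extChartAt (𝓡 n) p).symm a) (chartMap p a y) :=
  congrArg F (tangentCoord_eq ha y)

theorem loc_self (p : M) (y : Vec n) : loc F p (extChartAt (𝓡 n) p p, y) = fiber F p y :=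
  congrArg F (tangentCoord_self p y)

namespace IsFinslerMetric

theorem contDiffOn_loc (hF : IsFinslerMetric F) (p : M) :
    ContDiffOn ℝ ∞ (loc F p) ((extChartAt (𝓡 n) p).target ×ˢ {0}ᶜ) := by
  rw [← contMDiffOn_iff_contDiffOn]
  have h1 := contMDiffOn_extChartAt_symm (I := (𝓡 n).tangent) (n := ∞)
    (⟨p, 0⟩ : TangentBundle (𝓡 n) M)
  refine hF.smooth.comp (h1.mono ?_) ?_
  · rintro ⟨a, y⟩ ⟨ha, -⟩
    rw [FiberBundle.extChartAt_target]
    exact ⟨⟨ha, mem_baseSet ha⟩, trivial⟩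
  · rintro ⟨a, y⟩ ⟨ha, hy⟩
    change (tangentCoord p (a, y)).2 ≠ 0
    rw [tangentCoord_eq ha]
    exact chartMap_ne_zero ha hy

theorem contDiffOn_fiber (hF : IsFinslerMetric F) (x : M) : ContDiffOn ℝ ∞ (fiber F x) {0}ᶜ :=
  ((hF.contDiffOn_loc x).comp (f := fun y : Vec n => (extChartAt (𝓡 n) x x, y)) (by fun_prop)
    fun y hy => ⟨mem_extChartAt_target x, hy⟩).congr fun y _ => (loc_self x y).symm

theorem isLocalFinsler (hF : IsFinslerMetric F) (p : M) :
    IsLocalFinsler (extChartAt (𝓡 n) p).target (loc F p) where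
  isOpen := isOpen_extChartAt_target p
  smooth := hF.contDiffOn_loc p
  pos a ha y hy := by
    rw [loc_eq ha]
    exact hF.pos _ _ (chartMap_ne_zero ha hy)
  homog a ha y r hr := by
    rw [loc_eq ha, loc_eq ha, map_smul, hF.homog _ _ _ hr]
  posDef a ha y hy := by
    have h1 : (fun w => loc F p (a, w))
        = fun w => fiber F ((extChartAt (𝓡 n) p).symm a) (chartMap p a w) := funext (loc_eq ha)
    rw [h1]
    exact posDef_gram_comp_linear (hF.contDiffOn_fiber _) (chartMapInv_chartMap ha)
      (chartMap_ne_zero ha hy) (hF.posDef _ _ (chartMap_ne_zero ha hy))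

theorem localDistortion_loc (hF : IsFinslerMetric F) {p : M} {a y : Vec n}
    (ha : a ∈ (extChartAt (𝓡 n) p).target) (hy : y ≠ 0) :
    localDistortion (loc F p) (a, y) = distortion F (tangentCoord p (a, y)) := by
  have h1 : (fun w => loc F p (a, w))
      = fun w => fiber F ((extChartAt (𝓡 n) p).symm a) (chartMap p a w) := funext (loc_eq ha)
  rw [tangentCoord_eq ha, localDistortion]
  change fiberDistortion (fun w => loc F p (a, w)) y = fiberDistortion _ (chartMap p a y)
  rw [h1]
  exact fiberDistortion_comp_linear (hF.contDiffOn_fiber _) (chartMapInv_chartMap ha)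
    (chartMap_ne_zero ha hy)

end IsFinslerMetric

theorem contDiffOn_base {c : M → ℝ} (hc : ContMDiff (𝓡 n) 𝓘(ℝ, ℝ) ∞ c) (p : M) :
    ContDiffOn ℝ ∞ (fun a => c ((extChartAt (𝓡 n) p).symm a)) (extChartAt (𝓡 n) p).target := by
  rw [← contMDiffOn_iff_contDiffOn]
  exact hc.comp_contMDiffOn (contMDiffOn_extChartAt_symm p)

/-- The chain rule, since `chartMap p a` is the derivative of the inverse chart at `a`. -/
theorem dAt_chartMap {c : M → ℝ} (hc : ContMDiff (𝓡 n) 𝓘(ℝ, ℝ) ∞ c) {p : M} {a : Vec n}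
    (ha : a ∈ (extChartAt (𝓡 n) p).target) (y : Vec n) :
    dAt c ((extChartAt (𝓡 n) p).symm a) (chartMap p a y)
      = fderiv ℝ (fun a => c ((extChartAt (𝓡 n) p).symm a)) a y := by
  have : IsManifold (𝓡 n) 1 M := IsManifold.of_le (n := ∞) (by norm_cast)
  have hx := mem_baseSet ha
  rw [TangentBundle.trivializationAt_baseSet] at hx
  have h1 : chartMap p a = mfderiv 𝓘(ℝ, Vec n) (𝓡 n) (extChartAt (𝓡 n) p).symm a := by
    have := TangentBundle.symmL_trivializationAt (𝕜 := ℝ) (I := 𝓡 n) hx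
    rw [(extChartAt (𝓡 n) p).right_inv ha, ModelWithCorners.range_eq_univ, mfderivWithin_univ] at this
    exact this
  have h2 : MDifferentiableAt 𝓘(ℝ, Vec n) (𝓡 n) (extChartAt (𝓡 n) p).symm a :=
    ((contMDiffOn_extChartAt_symm (n := 1) p).contMDiffAt
      ((isOpen_extChartAt_target p).mem_nhds ha)).mdifferentiableAt (by simp)
  have h3 : MDifferentiableAt (𝓡 n) 𝓘(ℝ, ℝ) c ((extChartAt (𝓡 n) p).symm a) :=
    (hc _).mdifferentiableAt (by simp)
  have h4 := mfderiv_comp a h3 h2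
  rw [mfderiv_eq_fderiv] at h4
  rw [dAt, h1]
  exact (congrArg (fun T : Vec n →L[ℝ] ℝ => T y) h4).symm

/-- A function with vanishing differential on a connected manifold is constant. -/
theorem constant_of_dAt_eq_zero [PreconnectedSpace M] {c : M → ℝ}
    (hc : ContMDiff (𝓡 n) 𝓘(ℝ, ℝ) ∞ c) (h0 : ∀ x (y : Vec n), dAt c x y = 0) (x x' : M) :
    c x = c x' := by
  refine IsLocallyConstant.apply_eq_of_preconnectedSpace ?_ x x'
  rw [IsLocallyConstant.iff_eventually_eq]
  intro p
  obtain ⟨r, hr, hrU⟩ := Metric.isOpen_iff.1 (isOpen_extChartAt_target (I := 𝓡 n) p) _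
    (mem_extChartAt_target (I := 𝓡 n) p)
  have hd : ∀ a ∈ Metric.ball (extChartAt (𝓡 n) p p) r,
      fderiv ℝ (fun a => c ((extChartAt (𝓡 n) p).symm a)) a = 0 := fun a ha => by
    ext y
    rw [← dAt_chartMap hc (hrU ha), h0]
    rfl
  have hdiff : DifferentiableOn ℝ (fun a => c ((extChartAt (𝓡 n) p).symm a))
      (Metric.ball (extChartAt (𝓡 n) p p) r) :=
    ((contDiffOn_base hc p).mono hrU).differentiableOn (by simp)
  have hnear : ∀ᶠ q in 𝓝 p, extChartAt (𝓡 n) p q ∈ Metric.ball (extChartAt (𝓡 n) p p) r :=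
    (continuousAt_extChartAt p).eventually (Metric.ball_mem_nhds _ hr)
  filter_upwards [hnear, extChartAt_source_mem_nhds (I := 𝓡 n) p] with q hq hqs
  have := Metric.isOpen_ball.is_const_of_fderiv_eq_zero
    (convex_ball (extChartAt (𝓡 n) p p) r).isPreconnected hdiff hd hq (Metric.mem_ball_self hr)
  rwa [(extChartAt (𝓡 n) p).left_inv hqs, (extChartAt (𝓡 n) p).left_inv (mem_extChartAt_source p)]
    at this

end Manifold

/-! ### Descent to the base and rigidity. -/

section Rigidity

variable {n : ℕ} {M : Type*} [TopologicalSpace M] [ChartedSpace (Vec n) M] [IsManifold (𝓡 n) ∞ M]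

/-- The function `K - 3 c_{xᵐ} yᵐ / F`. -/
def sigmaFun (F K : TangentBundle (𝓡 n) M → ℝ) (c : M → ℝ) (v : TangentBundle (𝓡 n) M) : ℝ :=
  K v - 3 * dAt c v.1 v.2 / F v

/-- The function `(K + c² - c_{xᵐ} yᵐ / F) e^{2 τ / (n + 1)}`. -/
def nuFun (F K : TangentBundle (𝓡 n) M → ℝ) (c : M → ℝ) (v : TangentBundle (𝓡 n) M) : ℝ :=
  (K v + c v.1 ^ 2 - dAt c v.1 v.2 / F v) * Real.exp (2 / (n + 1) * distortion F v)

variable {F K : TangentBundle (𝓡 n) M → ℝ} {c : M → ℝ}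

/-- The intrinsic form of `fiber_constants`: the distortion is invariant under linear changes of
fibre coordinates and dc transforms by the chain rule. Both functions are treated at once to share
the chart computations. -/
theorem sigmaFun_nuFun_charts (hn : 2 ≤ n) (hF : IsFinslerMetric F) (hK : IsOfScalarCurvature F K)
    (hc : ContMDiff (𝓡 n) 𝓘(ℝ, ℝ) ∞ c) (hS : HasIsotropicSCurvature F c)
    (hJ : HasIsotropicMeanLandsberg F c) (p : M) :
    ∀ u ∈ ({sigmaFun F K c, nuFun F K c} : Set (TangentBundle (𝓡 n) M → ℝ)),
      ContDiffOn ℝ ∞ (fun z => u (tangentCoord p z)) ((extChartAt (𝓡 n) p).target ×ˢ {0}ᶜ) ∧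
      ∀ a ∈ (extChartAt (𝓡 n) p).target, ∀ y y' : Vec n, y ≠ 0 → y' ≠ 0 →
        u (tangentCoord p (a, y)) = u (tangentCoord p (a, y')) := by
  have h := hF.isLocalFinsler p
  have hbase : ∀ z ∈ (extChartAt (𝓡 n) p).target ×ˢ ({0}ᶜ : Set (Vec n)),
      c (tangentCoord p z).1 = c ((extChartAt (𝓡 n) p).symm z.1) := fun z hz => by
    rw [← Prod.mk.eta (p := z), tangentCoord_eq hz.1]
  have hdc : ∀ z ∈ (extChartAt (𝓡 n) p).target ×ˢ ({0}ᶜ : Set (Vec n)),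
      dAt c (tangentCoord p z).1 (tangentCoord p z).2
        = fderiv ℝ (fun a => c ((extChartAt (𝓡 n) p).symm a)) z.1 z.2 := fun z hz => by
    rw [← Prod.mk.eta (p := z), tangentCoord_eq hz.1]
    exact dAt_chartMap hc hz.1 z.2
  obtain ⟨s, w, hs, hw, hs0, hw0⟩ := h.fiber_constants (K := fun z => K (tangentCoord p z)) hn
    (contDiffOn_base hc p) (fun z hz u hu => hK p z hz u hu)
    (fun z hz => by rw [hS p z hz, hbase z hz])
    (fun z hz i => by rw [← hbase z hz]; exact hJ p z hz i)
  have hs' : Represents s fun z => sigmaFun F K c (tangentCoord p z) := fun z => by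
    refine (hs z).trans ?_
    simp only [sigmaFun, hdc z z.2, loc]
  have hw' : Represents w fun z => nuFun F K c (tangentCoord p z) := fun z => by
    have hd := hF.localDistortion_loc z.2.1 z.2.2
    rw [Prod.mk.eta] at hd
    refine (hw z).trans ?_
    simp only [nuFun, hdc z z.2, hbase z z.2, hd, loc]
  rintro u (rfl | rfl)
  · exact ⟨hs'.contDiffOn, fun a ha y y' hy hy' => h.constant_of_dV_eq_zero hn hs' hs0 ha hy hy'⟩
  · exact ⟨hw'.contDiffOn, fun a ha y y' hy hy' => h.constant_of_dV_eq_zero hn hw' hw0 ha hy hy'⟩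

/-- A function on the tangent bundle that is smooth and constant on the slit tangent spaces in all
charts descends to a smooth function on the manifold. -/
theorem descends (hn : 2 ≤ n) {u : TangentBundle (𝓡 n) M → ℝ}
    (hu : ∀ p, ContDiffOn ℝ ∞ (fun z => u (tangentCoord p z))
        ((extChartAt (𝓡 n) p).target ×ˢ {0}ᶜ) ∧
      ∀ a ∈ (extChartAt (𝓡 n) p).target, ∀ y y' : Vec n, y ≠ 0 → y' ≠ 0 →
        u (tangentCoord p (a, y)) = u (tangentCoord p (a, y'))) :
    ∃ σ : M → ℝ, ContMDiff (𝓡 n) 𝓘(ℝ, ℝ) ∞ σ ∧ ∀ (x : M) (y : Vec n), y ≠ 0 → u ⟨x, y⟩ = σ x := by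
  have he : (EuclideanSpace.single ⟨0, by omega⟩ 1 : Vec n) ≠ 0 := by simp
  have hconst : ∀ (x : M) (y y' : Vec n), y ≠ 0 → y' ≠ 0 → u ⟨x, y⟩ = u ⟨x, y'⟩ := by
    intro x y y' hy hy'
    have := (hu x).2 _ (mem_extChartAt_target x) y y' hy hy'
    rwa [tangentCoord_self, tangentCoord_self] at this
  refine ⟨fun x => u ⟨x, EuclideanSpace.single ⟨0, by omega⟩ 1⟩, contMDiff_of_charts fun p => ?_,
    fun x y hy => hconst x _ _ hy he⟩
  refine ((hu p).1.comp
    (f := fun a : Vec n => (a, (EuclideanSpace.single ⟨0, by omega⟩ 1 : Vec n)))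
    (by fun_prop) fun a ha => ⟨ha, he⟩).congr fun a ha => ?_
  rw [Function.comp_apply, tangentCoord_eq ha]
  exact hconst _ _ _ he (chartMap_ne_zero ha he)

/-- If the distortion is constant on a tangent space, the metric is Euclidean there. -/
theorem gram_eq_of_distortion_eq (hn : 2 ≤ n) (hF : IsFinslerMetric F) (x : M)
    (hτ : ∀ y y' : Vec n, y ≠ 0 → y' ≠ 0 → distortion F ⟨x, y⟩ = distortion F ⟨x, y'⟩)
    {y y' : Vec n} (hy : y ≠ 0) (hy' : y' ≠ 0) : gram (fiber F x) y = gram (fiber F x) y' := by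
  have hg : IsGauge (fiber F x) := ⟨(hF.contDiffOn_fiber x).continuousOn, hF.pos x, hF.homog x⟩
  refine gram_eq_of_det_eq hn (hF.contDiffOn_fiber x) (hF.pos x) (hF.homog x) (hF.posDef x)
    (fun w w' hw hw' => ?_) hy hy'
  have hV : 0 < (volume : Measure (Vec n)).real {w | fiber F x w < 1} :=
    ENNReal.toReal_pos hg.volume_ball_pos.ne' hg.volume_ball_lt_top.ne
  have hB : 0 < (volume : Measure (Vec n)).real (Metric.ball 0 1) :=
    ENNReal.toReal_pos (Metric.measure_ball_pos _ _ one_pos).ne' measure_ball_lt_top.ne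
  have h1 := (hF.posDef x w hw).det_pos
  have h2 := (hF.posDef x w' hw').det_pos
  have h3 := Real.log_injOn_pos (Set.mem_Ioi.2 (by positivity)) (Set.mem_Ioi.2 (by positivity))
    (hτ w w' hw hw')
  have h4 : √((gram (fiber F x) w).det) = √((gram (fiber F x) w').det) := by
    have := mul_right_cancel₀ hV.ne' h3
    exact (div_left_inj' hB.ne').1 this
  rwa [Real.sqrt_inj h1.le h2.le] at h4

end Rigidity

end Finsler
end

/-! ### The curvature formulas and their consequences. -/

theorem mainTheorem3 {n : ℕ} (hn : 2 ≤ n) {M : Type*} [TopologicalSpace M]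
    [ChartedSpace (Finsler.Vec n) M] [IsManifold (𝓡 n) ∞ M]
    (F : TangentBundle (𝓡 n) M → ℝ) (hF : Finsler.IsFinslerMetric F)
    (K : TangentBundle (𝓡 n) M → ℝ) (hK : Finsler.IsOfScalarCurvature F K)
    (c : M → ℝ) (hc : ContMDiff (𝓡 n) 𝓘(ℝ, ℝ) ∞ c)
    (hS : Finsler.HasIsotropicSCurvature F c)
    (hJ : Finsler.HasIsotropicMeanLandsberg F c) :
    ∃ σ ν : M → ℝ,
      ContMDiff (𝓡 n) 𝓘(ℝ, ℝ) ∞ σ ∧ ContMDiff (𝓡 n) 𝓘(ℝ, ℝ) ∞ ν ∧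
      -- the two formulas for the flag curvature
      (∀ (x : M) (y : Finsler.Vec n), y ≠ 0 →
        K ⟨x, y⟩ = 3 * Finsler.dAt c x y / F ⟨x, y⟩ + σ x ∧
        K ⟨x, y⟩ = -(3 * c x ^ 2 + σ x) / 2
          + ν x * Real.exp (-(2 * Finsler.distortion F ⟨x, y⟩) / (n + 1))) ∧
      -- (a)
      ((∀ U : Set M, IsOpen U → U.Nonempty → ¬ Finsler.IsRiemannianOn F U) →
        (∃ c₀ : ℝ, ∀ x, c x = c₀) →
        (∀ (x : M) (y : Finsler.Vec n), y ≠ 0 → K ⟨x, y⟩ = -c x ^ 2) ∧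
        (∀ x, σ x = -c x ^ 2) ∧ (∀ x, ν x = 0)) ∧
      -- (b)
      ((PreconnectedSpace M → (¬ ∃ c₀ : ℝ, ∀ x, c x = c₀) →
          ∃ x, ∃ y : Finsler.Vec n, Finsler.dAt c x y ≠ 0) ∧
        (∀ (x : M), (∃ y : Finsler.Vec n, Finsler.dAt c x y ≠ 0) → ν x ≠ 0) ∧
        (∀ (x : M), ν x ≠ 0 → ∀ y : Finsler.Vec n, y ≠ 0 →
          6 * Finsler.dAt c x y + 3 * (σ x + c x ^ 2) * F ⟨x, y⟩ ≠ 0 ∧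
          0 < 2 * ν x * F ⟨x, y⟩ /
            (6 * Finsler.dAt c x y + 3 * (σ x + c x ^ 2) * F ⟨x, y⟩) ∧
          Finsler.distortion F ⟨x, y⟩ = Real.log
            ((2 * ν x * F ⟨x, y⟩ /
              (6 * Finsler.dAt c x y + 3 * (σ x + c x ^ 2) * F ⟨x, y⟩)) ^ (((n : ℝ) + 1) / 2)))) := by
  have hne : (EuclideanSpace.single ⟨0, by omega⟩ 1 : Finsler.Vec n) ≠ 0 := by simp
  obtain ⟨σ, hσ, hσK⟩ := Finsler.descends hn fun p =>
    Finsler.sigmaFun_nuFun_charts hn hF hK hc hS hJ p (Finsler.sigmaFun F K c) (Or.inl rfl)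
  obtain ⟨ν, hν, hνK⟩ := Finsler.descends hn fun p =>
    Finsler.sigmaFun_nuFun_charts hn hF hK hc hS hJ p (Finsler.nuFun F K c) (Or.inr rfl)
  have hn0 : (n : ℝ) + 1 ≠ 0 := by positivity
  have h1 : ∀ (x : M) (y : Finsler.Vec n), y ≠ 0 →
      K ⟨x, y⟩ = 3 * Finsler.dAt c x y / F ⟨x, y⟩ + σ x := fun x y hy => by
    rw [← hσK x y hy, Finsler.sigmaFun]
    ring
  have h2 : ∀ (x : M) (y : Finsler.Vec n), y ≠ 0 →
      K ⟨x, y⟩ = -(3 * c x ^ 2 + σ x) / 2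
        -- Replacing c₀/F by (K - σ)/3 turns K + c² - c₀/F into (2/3)K + c² + σ/3; solving for K
        -- produces the factor 3/2, which the final witness absorbs.
        + 3 / 2 * ν x * Real.exp (-(2 * Finsler.distortion F ⟨x, y⟩) / (n + 1)) := by
    intro x y hy
    have he : Real.exp (2 / (n + 1) * Finsler.distortion F ⟨x, y⟩)
        * Real.exp (-(2 * Finsler.distortion F ⟨x, y⟩) / (n + 1)) = 1 := by
      rw [← Real.exp_add, Real.exp_eq_one_iff]
      ring
    have hs := h1 x y hy
    rw [← hνK x y hy, Finsler.nuFun, mul_assoc, mul_assoc, he]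
    rw [mul_div_assoc] at hs
    simp only
    linarith
  have hFpos : ∀ (x : M) (y : Finsler.Vec n), y ≠ 0 → 0 < F ⟨x, y⟩ := hF.pos
  have hsmul : ∀ (x : M) (y : Finsler.Vec n), Finsler.dAt c x (-y) = -Finsler.dAt c x y :=
    fun x y => map_neg (mfderiv (𝓡 n) 𝓘(ℝ, ℝ) c x) y
  refine ⟨σ, fun x => 3 / 2 * ν x, hσ, contMDiff_const.mul hν,
    fun x y hy => ⟨h1 x y hy, h2 x y hy⟩, fun hU ⟨c₀, hc₀⟩ => ?_, fun hM hcc => ?_, fun x hx => ?_,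
    fun x hx y hy => ?_⟩
  · have hd : ∀ x (y : Finsler.Vec n), Finsler.dAt c x y = 0 := fun x y => by
      rw [Finsler.dAt, (funext hc₀ : c = fun _ => c₀), mfderiv_const]
      rfl
    have hσc : ∀ x, σ x = -c x ^ 2 := by
      by_contra! hx
      obtain ⟨x₀, hx₀⟩ := hx
      -- This set is open by continuity. On it the nonzero factor σ + c² can be cancelled from the
      -- fibre constant, so the distortion depends on x only.
      refine hU {x | σ x ≠ -c x ^ 2}
        (isOpen_ne_fun hσ.continuous (hc.continuous.pow 2).neg) ⟨x₀, hx₀⟩ ?_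
      intro x hx y y' hy hy'
      refine Finsler.gram_eq_of_distortion_eq hn hF x (fun w w' hw hw' => ?_) hy hy'
      have e1 := hνK x w hw
      have e2 := hνK x w' hw'
      have k1 := h1 x w hw
      have k2 := h1 x w' hw'
      rw [hd, mul_zero, zero_div, zero_add] at k1 k2
      rw [Finsler.nuFun] at e1 e2
      simp only [k1, k2, hd, zero_div, sub_zero] at e1 e2
      have hne0 : σ x + c x ^ 2 ≠ 0 := fun h0 => hx (by linarith)
      have e3 := Real.exp_injective (mul_left_cancel₀ hne0 (e1.trans e2.symm))
      exact mul_left_cancel₀ (by positivity) e3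
    have hKc : ∀ (x : M) (y : Finsler.Vec n), y ≠ 0 → K ⟨x, y⟩ = -c x ^ 2 := fun x y hy => by
      rw [h1 x y hy, hd, hσc]
      simp
    refine ⟨hKc, hσc, fun x => ?_⟩
    have e1 := h2 x _ hne
    rw [hKc x _ hne, hσc x] at e1
    have e2 := Real.exp_pos (-(2 * Finsler.distortion F
      ⟨x, (EuclideanSpace.single ⟨0, by omega⟩ 1 : Finsler.Vec n)⟩) / (n + 1))
    refine (mul_eq_zero.1 ?_).resolve_right e2.ne'
    linarith
  · by_contra! h0
    rcases isEmpty_or_nonempty M with hE | ⟨⟨x₀⟩⟩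
    · exact hcc ⟨0, fun x => (hE.false x).elim⟩
    · exact hcc ⟨c x₀, fun x => Finsler.constant_of_dAt_eq_zero hc h0 x x₀⟩
  · obtain ⟨y, hy⟩ := hx
    intro (hν0 : 3 / 2 * ν x = 0)
    have hy0 : y ≠ 0 := fun h0 => hy (by
      rw [h0]
      exact map_zero (mfderiv (𝓡 n) 𝓘(ℝ, ℝ) c x))
    have e1 := h2 x y hy0
    -- Opposite vectors have the same K once ν = 0, while c₀ changes sign and F stays positive.
    have e2 := h2 x (-y) (neg_ne_zero.2 hy0)
    rw [hν0, zero_mul, add_zero] at e1 e2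
    have e3 := h1 x y hy0
    have e4 := h1 x (-y) (neg_ne_zero.2 hy0)
    rw [hsmul] at e4
    have p1 := hFpos x y hy0
    have p2 := hFpos x (-y) (neg_ne_zero.2 hy0)
    have e5 : 3 * Finsler.dAt c x y / F ⟨x, y⟩ = 3 * -Finsler.dAt c x y / F ⟨x, -y⟩ := by linarith
    rw [div_eq_div_iff p1.ne' p2.ne'] at e5
    have e6 : Finsler.dAt c x y * (F ⟨x, -y⟩ + F ⟨x, y⟩) = 0 := by linarith
    exact (mul_ne_zero hy (by positivity)) e6
  · have p := hFpos x y hy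
    have e1 := h1 x y hy
    have e2 := h2 x y hy
    have hexp := Real.exp_pos (-(2 * Finsler.distortion F ⟨x, y⟩) / (n + 1))
    -- The two formulas for K, equated and multiplied by 2F.
    have key : 6 * Finsler.dAt c x y + 3 * (σ x + c x ^ 2) * F ⟨x, y⟩
        = 2 * (3 / 2 * ν x) * F ⟨x, y⟩
          * Real.exp (-(2 * Finsler.distortion F ⟨x, y⟩) / (n + 1)) := by
      have e3 := e1.symm.trans e2
      have e4 : 3 * Finsler.dAt c x y / F ⟨x, y⟩ * F ⟨x, y⟩ = 3 * Finsler.dAt c x y :=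
        div_mul_cancel₀ _ p.ne'
      linear_combination 2 * F ⟨x, y⟩ * e3 - 2 * e4
    have hne2 : 2 * (3 / 2 * ν x) * F ⟨x, y⟩ ≠ 0 := mul_ne_zero (mul_ne_zero two_ne_zero hx) p.ne'
    have hq : 2 * (3 / 2 * ν x) * F ⟨x, y⟩
        / (6 * Finsler.dAt c x y + 3 * (σ x + c x ^ 2) * F ⟨x, y⟩)
        = Real.exp (2 * Finsler.distortion F ⟨x, y⟩ / (n + 1)) := by
      rw [key, div_mul_cancel_left₀ hne2, ← Real.exp_neg]
      congr 1
      ring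
    refine ⟨?_, ?_, ?_⟩
    · rw [key]
      exact mul_ne_zero hne2 hexp.ne'
    · rw [hq]
      exact Real.exp_pos _
    · rw [hq, Real.log_rpow (Real.exp_pos _), Real.log_exp]
      field_simp
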